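/- **Setting.** Let $\varepsilon_i$, $i\in\mathbb Z$, be i.i.d. random vectors in $\mathbb R^{\tilde d}$, let $\varepsilon_i^*$, $i\in\mathbb Z$, be independent copies of them, independent of $(\varepsilon_i)_{i}$, and let $\mathcal G_i=\sigma(\varepsilon_i,\varepsilon_{i-1},\dots)$. For $q>0$ (or $q=\infty$), $\|W\|_q=\mathbb E[|W|^q]^{1/q}$ (the essential supremum for $q=\infty$). For $n\in\mathbb N=\{1,2,\dots\}$ let $X_i=X_{i,n}=J_{i,n}(\varepsilon_i,\varepsilon_{i-1},\dots)$, $i\in\mathbb Z$, $i\le n$, with measurable $J_{i,n}:(\mathbb R^{\tilde d})^{\mathbb N_0}\to\mathbb R^d$, and $Z_i=(X_i,X_{i-1},\dots)$. For any process $Y_i=J_i(\varepsilon_i,\varepsilon_{i-1},\dots)$ put $Y_i^{*(i-k)}=J_i(\varepsilon_i,\dots,\varepsilon_{i-k+1},\varepsilon^*_{i-k},\varepsilon_{i-k-1},\dots)$ and $\delta^Y_q(k)=\sup_{i\le n}\sup_j\|Y_{ij}-Y_{ij}^{*(i-k)}\|_q$. For each $n$ let $\mathcal F=\mathcal F_n$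 be a finite set of measurable functions $f:(\mathbb R^d)^{\mathbb N_0}\times[0,1]\to\mathbb R$, each written as $f(z,u)=D_{f,n}(u)\,\bar f(z,u)$ with $D_{f,n}(u)\in\mathbb R$ and $\bar f$ measurable, and put $H=1\vee\log|\mathcal F_n|$ and $$\mathbb G_n(f)=\frac1{\sqrt n}\sum_{i=1}^n\Big\{f(Z_i,\tfrac in)-\mathbb E f(Z_i,\tfrac in)\Big\}.$$ Let $(\Delta(k))_{k\in\mathbb N_0}$ be a nonincreasing, nonnegative, summable sequence (not depending on $n$) and $\mathbb D_n\ge 0$. Put $\|f\|_{2,n}=(\frac1n\sum_{i=1}^n\|f(Z_i,\frac in)\|_2^2)^{1/2}$, $$V(f)=\|f\|_{2,n}+\sum_{k=1}^\infty\min\{\|f\|_{2,n},\mathbb D_n\Delta(k)\},\qquad \beta(q)=\sum_{k=q}^\infty\Delta(k),$$ $$q^*(x)=\min\{q\in\mathbb N:\beta(q)\le qx\}\ (x>0),\qquad r(\delta)=\max\{r>0:q^*(r)r\le\delta\}\ (\delta>0).$$ **Assumption A (compatibility), for some real $\nu\ge2$.** There are $d^\circ\in\mathbb N_0$, a summable nonnegative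 sequence $L=(L_j)_{j\in\mathbb N_0}$, $s\in(0,1]$, $p\in(1,\infty]$ and $C_R,C_{\bar f},C_X\in(0,\infty)$, none of them depending on $n$, such that for every $n$ there are a process $X_i^\circ=J_{i,n}^\circ(\varepsilon_i,\varepsilon_{i-1},\dots)\in\mathbb R^{d^\circ}$ with $J_{i,n}^\circ$ measurable, and functions $R\ge 0$ and $\bar\mu^{(\kappa)}_{f,i}$ (for $\kappa\in\{1,2\}$, $f\in\mathcal F_n$, $1\le i\le n$) from $(\mathbb R^{d^\circ})^{\mathbb N_0}\times[0,1]$ to $\mathbb R$, measurable in the first argument, for which the following holds with $Z_{i}^\circ=(X_{i}^\circ,X_{i-1}^\circ,\dots)$: 1. for $\kappa\in\{1,2\}$, $f\in\mathcal F_n$, $1\le i\le n$, $u\in[0,1]$: $\bar f(Z_i,u)\in L^2$ and $\bar\mu^{(\kappa)}_{f,i}(Z^\circ_{i-1},u)=\mathbb E[\bar f(Z_i,u)^\kappa\mid\mathcal G_{i-1}]^{1/\kappa}$ a.s.; 2. every $g=\bar\mu^{(\kappa)}_{f,i}$ satisfies $|g(z,u)-g(z',u)|\le\big(\sum_{j}L_j|z_j-z_j'|_\infty^s\big)\,[R(z,u)+R(z',u)]$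 for all $u\in[0,1]$ and all $z,z'$ for which the series converges, and $|g(0,u)|\le C_{\bar f}$, $|R(0,u)|\le C_R$ for all $u\in[0,1]$; 3. $\sup_{1\le i\le n,\,u\in[0,1]}\|R(Z^\circ_{i-1},u)\|_{\nu p}\le C_R$ and $\sup_{i\le n}\sup_j\|X^\circ_{ij}\|_{\frac{\nu sp}{p-1}}\le C_X$ (with $\frac p{p-1}=1$ if $p=\infty$); 4. $2d^\circ C_R\sum_{j=0}^{k-1}L_j\big(\delta^{X^\circ}_{\frac{\nu sp}{p-1}}(k-j-1)\big)^s\le\Delta(k)$ for all $k\in\mathbb N_0$, and $\sup_{f\in\mathcal F_n}\big(\frac1n\sum_{i=1}^nD_{f,n}(\frac in)^2\big)^{1/2}\le\mathbb D_n$. **Assumption B (submultiplicativity).** There is $C_\beta>0$ with $\beta(q_1q_2)\le C_\beta\,\beta(q_1)\beta(q_2)$ for all $q_1,q_2\in\mathbb N$. **Statement.** Suppose that Assumption A (for some $\nu\ge2$) and Assumption B hold. Let $\bar F=\sup_{f\in\mathcal F_n}|\bar f|$ and assume that for some $\nu_2\in[2,\infty]$ and every $n$, $$C_{\bar F,n}:=\sup_{1\le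 i\le n,\ u\in[0,1]}\|\bar F(Z_i,u)\|_{\nu_2}<\infty .$$ Let $D_n^\infty(u)=\sup_{f\in\mathcal F_n}|D_{f,n}(u)|$, and let $\mathbb D_n^\infty>0$ and $\mathbb D_{\nu_2,n}^\infty$ be such that $\big(\frac1n\sum_{i=1}^nD_n^\infty(\frac in)^{2}\big)^{1/2}\le\mathbb D^\infty_n$ and $\big(\frac1n\sum_{i=1}^nD_n^\infty(\frac in)^{\nu_2}\big)^{1/\nu_2}\le\mathbb D^\infty_{\nu_2,n}$ (read as a maximum over $i$ if $\nu_2=\infty$). If for some real $\sigma>0$ $$\sup_{n\in\mathbb N}\sup_{f\in\mathcal F_n}V(f)\le\sigma,\qquad \sup_{n\in\mathbb N}\frac{\mathbb D_{\nu_2,n}^\infty}{\mathbb D_n^\infty}<\infty,\qquad \sup_{n\in\mathbb N}\frac{C_{\bar F,n}^2\,H}{n^{1-\frac2{\nu_2}}\,r\big(\frac{\sigma}{\mathbb D_n^\infty}\big)^2}<\infty,$$ then $$\max_{f\in\mathcal F_n}|\mathbb G_n(f)|=O_p(\sqrt H),$$ that is, for every $\eta>0$ there is $Q>0$ such that $\mathbb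 P\big(\max_{f\in\mathcal F_n}|\mathbb G_n(f)|>Q\sqrt H\big)\le\eta$ for all $n\in\mathbb N$. -/

import Mathlib

open MeasureTheory ProbabilityTheory
open scoped ENNReal

noncomputable section

namespace EmpProc

/-! ### Bernoulli shift processes and the functional dependence measure -/

/-- `(ℝ^d)^{ℕ₀}`.  The norm of `Fin d → ℝ` is the maximum norm. -/
abbrev Hist (d : ℕ) : Type := ℕ → Fin d → ℝ

/-- Functions `(ℝ^d)^{ℕ₀} × [0,1] → ℝ`, in curried form. -/
abbrev Fn (d : ℕ) : Type := Hist d → unitInterval → ℝ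

/-- The point `i / n` of `[0,1]`; see `coe_grid`. -/
def grid (n i : ℕ) : unitInterval := Set.projIcc (0 : ℝ) 1 zero_le_one ((i : ℝ) / n)

theorem coe_grid {n i : ℕ} (hi : i ≤ n) : (grid n i : ℝ) = (i : ℝ) / n := by
  have h : (i : ℝ) / n ∈ Set.Icc (0 : ℝ) 1 :=
    ⟨by positivity, div_le_one_of_le₀ (by exact_mod_cast hi) (by positivity)⟩
  simp [grid, Set.projIcc_of_mem zero_le_one h]

section Shift

variable {Ω : Type*} {k d : ℕ}

/-- `(ε_i)` is an i.i.d. sequence of random vectors, `(ε*_i)` is a sequence of independent copies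
of them, and the two sequences are independent. -/
structure IsIIDWithCopy [MeasurableSpace Ω] (P : Measure Ω) (ε ε' : ℤ → Ω → Fin k → ℝ) :
    Prop where
  measurable : ∀ i, Measurable (ε i)
  measurable_copy : ∀ i, Measurable (ε' i)
  indep : iIndepFun (fun a : ℤ ⊕ ℤ => Sum.elim ε ε' a) P
  ident : ∀ i, IdentDistrib (ε i) (ε 0) P P
  ident_copy : ∀ i, IdentDistrib (ε' i) (ε 0) P P

/-- The sequence `(ε_i, ε_{i-1}, ε_{i-2}, …)`. -/
def innov (ε : ℤ → Ω → Fin k → ℝ) (i : ℤ) (ω : Ω) : Hist k := fun j => ε (i - j) ω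

/-- The sequence `(ε_i, …, ε_{i-l+1}, ε*_{i-l}, ε_{i-l-1}, …)`. -/
def innovCoupled (ε ε' : ℤ → Ω → Fin k → ℝ) (i : ℤ) (l : ℕ) (ω : Ω) : Hist k :=
  Function.update (innov ε i ω) l (ε' (i - l) ω)

/-- The sigma-algebra `𝒢_i` generated by `ε_i, ε_{i-1}, …`. -/
abbrev pastSigma (ε : ℤ → Ω → Fin k → ℝ) (i : ℤ) : MeasurableSpace Ω :=
  ⨆ (j : ℤ) (_ : j ≤ i), MeasurableSpace.comap (ε j) inferInstance

/-- `X_i = J_i(ε_i, ε_{i-1}, …)`. -/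
def proc (ε : ℤ → Ω → Fin k → ℝ) (J : ℤ → Hist k → Fin d → ℝ) (i : ℤ) (ω : Ω) : Fin d → ℝ :=
  J i (innov ε i ω)

/-- `X_i^{*(i-l)}`. -/
def procCoupled (ε ε' : ℤ → Ω → Fin k → ℝ) (J : ℤ → Hist k → Fin d → ℝ) (i : ℤ) (l : ℕ)
    (ω : Ω) : Fin d → ℝ :=
  J i (innovCoupled ε ε' i l ω)

/-- `Z_i = (X_i, X_{i-1}, X_{i-2}, …)`. -/
def hist (ε : ℤ → Ω → Fin k → ℝ) (J : ℤ → Hist k → Fin d → ℝ) (i : ℤ) (ω : Ω) : Hist d :=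
  fun j => proc ε J (i - j) ω

/-- The functional dependence measure `δ_q^X(l)` of the process `(X_i)_{i ≤ n}`. -/
def depMeasure [MeasurableSpace Ω] (P : Measure Ω) (ε ε' : ℤ → Ω → Fin k → ℝ)
    (J : ℤ → Hist k → Fin d → ℝ) (n : ℕ) (q : ℝ≥0∞) (l : ℕ) : ℝ≥0∞ :=
  ⨆ (i : ℤ) (_ : i ≤ (n : ℤ)) (a : Fin d),
    eLpNorm (fun ω => proc ε J i ω a - procCoupled ε ε' J i l ω a) q P

end Shift

/-! ### Norms, the seminorm `V`, and the functions `β`, `q*`, `r`, `H` -/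

/-- `((1/n) ∑_{i=1}^n a_i^ν)^{1/ν}`, and `max_{1 ≤ i ≤ n} a_i` for `ν = ∞`. -/
def avgNorm (ν : ℝ≥0∞) (n : ℕ) (a : ℕ → ℝ≥0∞) : ℝ≥0∞ :=
  if ν = ∞ then ⨆ i ∈ Finset.Icc 1 n, a i
  else ((∑ i ∈ Finset.Icc 1 n, a i ^ ν.toReal) / n) ^ (1 / ν.toReal)

/-- `‖f‖_{2,n}`, where `Z i` stands for `Z_i`. -/
def normTwo {Ω : Type*} [MeasurableSpace Ω] (P : Measure Ω) {d : ℕ} (Z : ℤ → Ω → Hist d)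
    (n : ℕ) (f : Fn d) : ℝ≥0∞ :=
  avgNorm 2 n (fun i => eLpNorm (fun ω => f (Z i ω) (grid n i)) 2 P)

/-- `V(f) = ‖f‖_{2,n} + ∑_{k ≥ 1} min(‖f‖_{2,n}, 𝔻_n Δ(k))`. -/
def seminormV {Ω : Type*} [MeasurableSpace Ω] (P : Measure Ω) {d : ℕ} (Z : ℤ → Ω → Hist d)
    (Δ : ℕ → ℝ) (𝔻n : ℝ) (n : ℕ) (f : Fn d) : ℝ≥0∞ :=
  normTwo P Z n f + ∑' k : ℕ, min (normTwo P Z n f) (ENNReal.ofReal (𝔻n * Δ (k + 1)))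

/-- `β(q) = ∑_{j ≥ q} Δ(j)`. -/
def betaTail (Δ : ℕ → ℝ) (q : ℕ) : ℝ := ∑' j : ℕ, Δ (q + j)

/-- `q*(x) = min {q ≥ 1 : β(q) ≤ q x}`, for `x > 0`. -/
def qStar (Δ : ℕ → ℝ) (x : ℝ) : ℕ := sInf {q : ℕ | 1 ≤ q ∧ betaTail Δ q ≤ q * x}

/-- `r(δ) = max {r > 0 : q*(r) r ≤ δ}`, for `δ > 0`. -/
def rFun (Δ : ℕ → ℝ) (δ : ℝ) : ℝ := sSup {r : ℝ | 0 < r ∧ (qStar Δ r : ℝ) * r ≤ δ}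

/-- `H = 1 ∨ log N`, where `N` is the cardinality of the class. -/
def logCard (N : ℕ) : ℝ := max 1 (Real.log N)

/-! ### Assumptions on the function class -/

/-- `(L, s, R, C)`-classes of functions, where `C = (C_R, C_f)`.  The Hölder inequality is only
asked for where the series `|z - z'|_{L,s}^s` is finite. -/
structure IsLClass {d : ℕ} (𝒞 : Set (Fn d)) (L : ℕ → ℝ) (s : ℝ) (R : Fn d) (C_R C_f : ℝ) :
    Prop where
  L_nonneg : ∀ j, 0 ≤ L j
  L_summable : Summable L
  s_pos : 0 < s
  s_le_one : s ≤ 1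
  R_nonneg : ∀ z u, 0 ≤ R z u
  C_R_pos : 0 < C_R
  C_f_pos : 0 < C_f
  holder : ∀ g ∈ 𝒞, ∀ (u : unitInterval) (z z' : Hist d),
    Summable (fun j => L j * ‖z j - z' j‖ ^ s) →
      |g z u - g z' u| ≤ (∑' j, L j * ‖z j - z' j‖ ^ s) * (R z u + R z' u)
  zero_le : ∀ g ∈ 𝒞, ∀ u, |g 0 u| ≤ C_f
  R_zero_le : ∀ u, |R 0 u| ≤ C_R

/-- The part of the compatibility condition that concerns one fixed `n`: the process
`X°_i = J°_i(ε_i, ε_{i-1}, …)`, the functions `μ κ f i` and the function `R` are as required,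
with the given constants.  Here `J` generates `X`, the class is `𝓕`, its elements are factorized as
`f(z,u) = D f u * fbar f z u`, and `(1 - p⁻¹)⁻¹` is `p / (p - 1)` (which is `1` for `p = ∞`). -/
structure CompatAt {Ω : Type*} [MeasurableSpace Ω] (P : Measure Ω) {k d d₀ : ℕ}
    (ε ε' : ℤ → Ω → Fin k → ℝ) (J : ℤ → Hist k → Fin d → ℝ) (𝓕 : Finset (Fn d))
    (D : Fn d → unitInterval → ℝ) (fbar : Fn d → Fn d) (ν : ℝ) (Δ : ℕ → ℝ) (𝔻n : ℝ) (n : ℕ)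
    (J₀ : ℤ → Hist k → Fin d₀ → ℝ) (μ : ℕ → Fn d → ℕ → Fn d₀) (R : Fn d₀)
    (L : ℕ → ℝ) (s : ℝ) (p : ℝ≥0∞) (C_R C_f C_X : ℝ) : Prop where
  measurable_J : ∀ i, Measurable (J₀ i)
  measurable_μ : ∀ κ f i u, Measurable (fun z => μ κ f i z u)
  measurable_R : ∀ u, Measurable (fun z => R z u)
  /-- The conditional second moments are finite in mean. -/
  memLp : ∀ f ∈ 𝓕, ∀ i ∈ Finset.Icc 1 n, ∀ u : unitInterval,
    MemLp (fun ω => fbar f (hist ε J i ω) u) 2 P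
  /-- `μ κ f i (Z°_{i-1}, u) = E[fbar(Z_i, u)^κ | 𝒢_{i-1}]^{1/κ}` almost surely. -/
  cond_moment : ∀ κ ∈ ({1, 2} : Finset ℕ), ∀ f ∈ 𝓕, ∀ i ∈ Finset.Icc 1 n, ∀ u : unitInterval,
    (fun ω => μ κ f i (hist ε J₀ ((i : ℤ) - 1) ω) u) =ᵐ[P]
      fun ω => ((P[fun ω' => fbar f (hist ε J i ω') u ^ κ | pastSigma ε ((i : ℤ) - 1)]) ω)
        ^ (1 / (κ : ℝ))
  isLClass : ∀ κ ∈ ({1, 2} : Finset ℕ),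
    IsLClass {g | ∃ f ∈ 𝓕, ∃ i ∈ Finset.Icc 1 n, g = μ κ f i} L s R C_R C_f
  moment_R : ∀ i ∈ Finset.Icc 1 n, ∀ u : unitInterval,
    eLpNorm (fun ω => R (hist ε J₀ ((i : ℤ) - 1) ω) u) (ENNReal.ofReal ν * p) P
      ≤ ENNReal.ofReal C_R
  moment_X : ∀ i : ℤ, i ≤ n → ∀ a : Fin d₀,
    eLpNorm (fun ω => proc ε J₀ i ω a) (ENNReal.ofReal (ν * s) * (1 - p⁻¹)⁻¹) P
      ≤ ENNReal.ofReal C_X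
  dependence : ∀ l : ℕ,
    2 * (d₀ : ℝ≥0∞) * ENNReal.ofReal C_R *
      ∑ j ∈ Finset.range l, ENNReal.ofReal (L j) *
        depMeasure P ε ε' J₀ n (ENNReal.ofReal (ν * s) * (1 - p⁻¹)⁻¹) (l - j - 1) ^ s
      ≤ ENNReal.ofReal (Δ l)
  factor : ∀ f ∈ 𝓕, avgNorm 2 n (fun i => ‖D f (grid n i)‖ₑ) ≤ ENNReal.ofReal 𝔻n

/-- The compatibility condition for a sequence of (not necessarily smooth) classes `𝓕 n`: only the
conditional moments given the past are smooth.  The constants and the sequence `L` do not depend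
on `n`; the process `X°`, the functions `μ` and the function `R` may. -/
def Compat {Ω : Type*} [MeasurableSpace Ω] (P : Measure Ω) {k d : ℕ}
    (ε ε' : ℤ → Ω → Fin k → ℝ) (J : ℕ → ℤ → Hist k → Fin d → ℝ) (𝓕 : ℕ → Finset (Fn d))
    (D : ℕ → Fn d → unitInterval → ℝ) (fbar : ℕ → Fn d → Fn d) (ν : ℝ) (Δ : ℕ → ℝ)
    (𝔻 : ℕ → ℝ) : Prop :=
  ∃ (d₀ : ℕ) (L : ℕ → ℝ) (s : ℝ) (p : ℝ≥0∞) (C_R C_f C_X : ℝ), 1 < p ∧ 0 < C_X ∧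
    ∀ n : ℕ, 1 ≤ n → ∃ (J₀ : ℤ → Hist k → Fin d₀ → ℝ) (μ : ℕ → Fn d → ℕ → Fn d₀) (R : Fn d₀),
      CompatAt P ε ε' (J n) (𝓕 n) (D n) (fbar n) ν Δ (𝔻 n) n J₀ μ R L s p C_R C_f C_X

/-- Submultiplicativity of `β`. -/
def SubmultBeta (Δ : ℕ → ℝ) : Prop :=
  ∃ C_β : ℝ, 0 < C_β ∧ ∀ q₁ q₂ : ℕ, 1 ≤ q₁ → 1 ≤ q₂ →
    betaTail Δ (q₁ * q₂) ≤ C_β * (betaTail Δ q₁ * betaTail Δ q₂)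

/-- `D_n^∞(u) = sup_{f ∈ 𝓕} |D_f(u)|`. -/
def Dsup {d : ℕ} (𝓕 : Finset (Fn d)) (D : Fn d → unitInterval → ℝ) (u : unitInterval) : ℝ≥0∞ :=
  ⨆ f ∈ 𝓕, ‖D f u‖ₑ

/-- The envelope `sup_{f ∈ 𝓕} |fbar|` (a supremum over a finite set). -/
def envelope {d : ℕ} (𝓕 : Finset (Fn d)) (fbar : Fn d → Fn d) : Fn d :=
  fun z u => ⨆ f : {f // f ∈ 𝓕}, |fbar f z u|

/-- `sup_{1 ≤ i ≤ n, u ∈ [0,1]} ‖F(Z_i, u)‖_{ν₂}`. -/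
def envMoment {Ω : Type*} [MeasurableSpace Ω] (P : Measure Ω) {d : ℕ} (Z : ℤ → Ω → Hist d)
    (F : Fn d) (ν₂ : ℝ≥0∞) (n : ℕ) : ℝ≥0∞ :=
  ⨆ i ∈ Finset.Icc 1 n, ⨆ u : unitInterval, eLpNorm (fun ω => F (Z (i : ℤ) ω) u) ν₂ P

/-! ### The empirical process and stochastic boundedness -/

/-- `𝔾_n(f) = n^{-1/2} ∑_{i=1}^n {f(Z_i, i/n) - E f(Z_i, i/n)}`. -/
def empProc {Ω : Type*} [MeasurableSpace Ω] (P : Measure Ω) {d : ℕ} (Z : ℤ → Ω → Hist d)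
    (n : ℕ) (f : Fn d) (ω : Ω) : ℝ :=
  (Real.sqrt n)⁻¹ * ∑ i ∈ Finset.Icc 1 n,
    (f (Z (i : ℤ) ω) (grid n i) - ∫ ω', f (Z (i : ℤ) ω') (grid n i) ∂P)

/-- `Y_n = O_p(a_n)` (over `n ≥ 1`). -/
def IsBigOP {Ω : Type*} [MeasurableSpace Ω] (P : Measure Ω) (Y : ℕ → Ω → ℝ) (a : ℕ → ℝ) : Prop :=
  ∀ η : ℝ, 0 < η → ∃ Q : ℝ, 0 < Q ∧ ∀ n : ℕ, 1 ≤ n →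
    P {ω | Q * a n < |Y n ω|} ≤ ENNReal.ofReal η

end EmpProc

end

/-!
Write `Y_i = f(Z_i, i/n)`, and let `M` be a truncation level, of order `√n ρ 𝔻^∞_n / √H`, and `q` a
block length with `β(q) ≤ q ρ ≤ σ / 𝔻^∞_n` (`exists_blockLength`; `ρ` is of the order of
`r(σ / 𝔻^∞_n)`).  The rate condition says that `M` is at least `n^{1/ν₂}` times the moment of the
envelope, so that the truncation to `[-M, M]` changes the sums by `O_p(M)` in total
(`sum_integral_excess_le`), and the choice of `q` gives `q M = O(σ √n / √H)`, which is the
condition for the exponential inequalities below at a parameter `l` of order `√H / (σ √n)`.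

The truncated and centred sum is split into two parts (`measureReal_exists_abs_sum_ge_le`).

* The martingale part `∑ (Y_i - E[Y_i | 𝒢_{i-1}])` is controlled by Freedman's inequality
  (`integral_exp_martingale_le`) and a union bound over the class.  Its conditional variance is at
  most `∑ E[Y_i² | 𝒢_{i-1}]`, a sum of squares of smooth functions of the past.
* The smooth part is `∑ (E[Y_i | 𝒢_{i-1}] - E Y_i)`.

Thus only the conditional moments `D_f μ^{(κ)}_{f,i}(Z°_{i-1})` remain.  By Hölder's inequality,
replacing the innovation with index `i - k` by a copy changes all of them by at most `|D_f|` times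
one random variable whose `L²` norm is at most `Δ(k)` (`CompatAt.exists_coupling`).  The law of the
innovations is a product measure on `ℤ → E`, and the conditional expectation `avgPast` given the
innovations with index `≥ m` is an integral over the other coordinates.  A function `w_i` of the
innovations with index `< i` is the sum of its mean and of the increments `incr` at the lags
`k = 1, 2, …`.

* For a fixed lag the increments, read in decreasing order of `i`, are martingale differences.  The
  maximal inequality `integral_norm_sum_le`, obtained from the log-sum-exp function, has no loss in
  the size of the class beyond `√H` and only needs the maximum over the class in `L²`, so the lags
  larger than `q` contribute `√H √n 𝔻^∞_n β(q) ≤ √H √n σ`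
  (`IsShiftArray.integral_norm_sum_remVec_le`).
* The lags up to `q` give functions of `q` innovations.  Blocks of length `q` with the same parity
  are independent, and the variance of a block sum is bounded lag by lag, which produces the
  seminorm `V(f)` in place of a power of `q` (`IsShiftArray.integral_exp_sum_avgPast_le`).  A union
  bound over the class finishes the estimate.

The sum of the conditional second moments is treated in the same way
(`IsShiftArray.measureReal_sum_sq_ge_le`), and `tail_sum_le` collects the constants.
-/

namespace EmpProc

/-! ### Product spaces of i.i.d. innovations -/

section ProductSpace

theorem dependsOn_finsetProd {ι E κ : Type*} {g : κ → (ι → E) → ℝ} {S : κ → Set ι}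
    (s : Finset κ) (h : ∀ b ∈ s, DependsOn (g b) (S b)) :
    DependsOn (fun x => ∏ b ∈ s, g b x) (⋃ b ∈ s, S b) := fun _ _ hxy =>
  Finset.prod_congr rfl fun b hb => h b hb fun _ hi => hxy _ (Set.mem_biUnion hb hi)

theorem dependsOn_finsetSum {ι E κ : Type*} {g : κ → (ι → E) → ℝ} {S : Set ι} (s : Finset κ)
    (h : ∀ b ∈ s, DependsOn (g b) S) :
    DependsOn (fun x => ∑ b ∈ s, g b x) S := fun _ _ hxy =>
  Finset.sum_congr rfl fun b hb => h b hb hxy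

open Classical in
/-- The configuration that agrees with `x` on `S` and with `y` off `S`. -/
noncomputable def mix {ι E : Type*} (S : Set ι) (x y : ι → E) : ι → E := S.piecewise x y

theorem mix_of_mem {ι E : Type*} {S : Set ι} {i : ι} (h : i ∈ S) (x y : ι → E) :
    mix S x y i = x i := by simp [mix, h]

theorem mix_of_notMem {ι E : Type*} {S : Set ι} {i : ι} (h : i ∉ S) (x y : ι → E) :
    mix S x y i = y i := by simp [mix, h]

variable {ι E : Type*} [MeasurableSpace E]

/-- The law on `ι → E` of an i.i.d. family with marginal law `ν`. -/
noncomputable abbrev iidLaw (ι : Type*) (ν : Measure E) : Measure (ι → E) :=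
  Measure.infinitePi fun _ : ι => ν

variable (ν : Measure E) [IsProbabilityMeasure ν]

/-- Two independent i.i.d. families over `ι` form one i.i.d. family over `ι ⊕ ι`. -/
theorem measurePreserving_sumPi_symm :
    MeasurePreserving (MeasurableEquiv.sumPiEquivProdPi (fun _ : ι ⊕ ι => E)).symm
      ((iidLaw ι ν).prod (iidLaw ι ν)) (iidLaw (ι ⊕ ι) ν) := by
  refine ⟨MeasurableEquiv.measurable _, ?_⟩
  refine Measure.eq_infinitePi _ fun s t ht => ?_
  rw [MeasurableEquiv.map_apply]
  have : ((MeasurableEquiv.sumPiEquivProdPi (fun _ : ι ⊕ ι => E)).symm ⁻¹' ((s : Set (ι ⊕ ι)).pi t))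
      = ((s.toLeft : Set ι).pi fun i => t (Sum.inl i)) ×ˢ
        ((s.toRight : Set ι).pi fun i => t (Sum.inr i)) := by
    ext ⟨x, y⟩
    simp only [Set.mem_preimage, Set.mem_pi, Finset.mem_coe, Set.mem_prod, Finset.mem_toLeft,
      Finset.mem_toRight]
    exact ⟨fun h => ⟨fun i hi => h _ hi, fun i hi => h _ hi⟩,
      fun h a ha => by cases a with
        | inl i => exact h.1 i ha
        | inr i => exact h.2 i ha⟩
  rw [this, Measure.prod_prod, Measure.infinitePi_pi _ (fun i _ => ht _),
    Measure.infinitePi_pi _ (fun i _ => ht _)]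
  conv_rhs => rw [← Finset.toLeft_disjSum_toRight (u := s), Finset.prod_disjSum]

/-- Exchanging the coordinates outside `S` between two independent copies preserves their joint
law. -/
theorem measurePreserving_exchange (S : Set ι) :
    MeasurePreserving (fun z : (ι → E) × (ι → E) => (mix S z.1 z.2, mix S z.2 z.1))
      ((iidLaw ι ν).prod (iidLaw ι ν)) ((iidLaw ι ν).prod (iidLaw ι ν)) := by
  classical
  set τ : ι ⊕ ι → ι ⊕ ι := fun a => Sum.elim
    (fun i => if i ∈ S then Sum.inl i else Sum.inr i)
    (fun i => if i ∈ S then Sum.inr i else Sum.inl i) a with hτ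
  have hinj : Function.Injective τ := by
    rintro (i | i) (j | j) h <;> simp only [hτ, Sum.elim_inl, Sum.elim_inr] at h <;>
      split_ifs at h <;> simp_all
  have h2 : MeasurePreserving (fun (x : ι ⊕ ι → E) a => x (τ a)) (iidLaw (ι ⊕ ι) ν)
      (iidLaw (ι ⊕ ι) ν) :=
    ⟨by fun_prop, Measure.map_infinitePi_infinitePi_of_inj hinj⟩
  have h1 := measurePreserving_sumPi_symm (ι := ι) ν
  have h3 := (h1.symm.comp h2).comp h1
  convert h3 using 1
  funext z
  refine Prod.ext ?_ ?_ <;> funext i <;> by_cases hi : i ∈ S <;>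
    simp [mix, hτ, hi, MeasurableEquiv.sumPiEquivProdPi, Equiv.sumPiEquivProdPi]

/-- Resampling the coordinates outside `S` preserves the law of an i.i.d. family. -/
theorem measurePreserving_piecewise (S : Set ι) :
    MeasurePreserving (fun z : (ι → E) × (ι → E) => mix S z.1 z.2)
      ((iidLaw ι ν).prod (iidLaw ι ν)) (iidLaw ι ν) :=
  measurePreserving_fst.comp (measurePreserving_exchange ν S)

theorem integral_mul_of_dependsOn_disjoint {g h : (ι → E) → ℝ} (hg : Measurable g)
    (hh : Measurable h) {S T : Set ι} (hgS : DependsOn g S) (hhT : DependsOn h T)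
    (hST : Disjoint S T) :
    ∫ x, g x * h x ∂(iidLaw ι ν) = (∫ x, g x ∂(iidLaw ι ν)) * ∫ x, h x ∂(iidLaw ι ν) := by
  have hmp := measurePreserving_piecewise (E := E) ν S
  rw [← integral_prod_mul]
  conv_lhs => rw [← hmp.map_eq]
  rw [integral_map hmp.measurable.aemeasurable (f := fun x => g x * h x)
    (hg.mul hh).aestronglyMeasurable]
  refine integral_congr_ae (ae_of_all _ fun z => ?_)
  have e1 : g (mix S z.1 z.2) = g z.1 := hgS fun i hi => mix_of_mem hi _ _
  have e2 : h (mix S z.1 z.2) = h z.2 := hhT fun i hi =>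
    mix_of_notMem (Set.disjoint_right.1 hST hi) _ _
  simp only [e1, e2]

theorem integral_prod_of_dependsOn_disjoint {κ : Type*} {g : κ → (ι → E) → ℝ} {S : κ → Set ι}
    (s : Finset κ) (hg : ∀ b ∈ s, Measurable (g b)) (h : ∀ b ∈ s, DependsOn (g b) (S b))
    (hS : (s : Set κ).PairwiseDisjoint S) :
    ∫ x, ∏ b ∈ s, g b x ∂(iidLaw ι ν) = ∏ b ∈ s, ∫ x, g b x ∂(iidLaw ι ν) := by
  classical
  induction s using Finset.induction_on with
  | empty => simp
  | insert a s ha ih =>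
    simp only [Finset.prod_insert ha]
    rw [integral_mul_of_dependsOn_disjoint ν (hg a (by simp))
      (Finset.measurable_prod _ fun b hb => hg b (by simp [hb])) (h a (by simp))
      (dependsOn_finsetProd s fun b hb => h b (by simp [hb])),
      ih (fun b hb => hg b (by simp [hb])) (fun b hb => h b (by simp [hb]))
        (hS.subset (by simp))]
    refine Set.disjoint_iUnion₂_right.2 fun b hb => hS (by simp) (by simp [hb]) ?_
    rintro rfl
    exact ha hb

end ProductSpace

/-! ### Averaging out the remote past -/

section AvgPast

variable {E : Type*} [MeasurableSpace E]

/-- Integrate out all coordinates with index `< m`: the conditional expectation of `w` given the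
coordinates with index `≥ m`, in the version defined everywhere. -/
noncomputable def avgPast (ν : Measure E) (m : ℤ) (w : (ℤ → E) → ℝ) (x : ℤ → E) : ℝ :=
  ∫ y, w (mix (Set.Ici m) x y) ∂(iidLaw ℤ ν)

theorem dependsOn_avgPast (ν : Measure E) {w : (ℤ → E) → ℝ} {i : ℤ}
    (hw : DependsOn w (Set.Iio i)) (m : ℤ) : DependsOn (avgPast ν m w) (Set.Ico m i) := fun x y hxy => by
  refine integral_congr_ae (ae_of_all _ fun z => hw fun j hj => ?_)
  by_cases h : j ∈ Set.Ici m
  · rw [mix_of_mem h, mix_of_mem h, hxy j ⟨h, hj⟩]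
  · rw [mix_of_notMem h, mix_of_notMem h]

theorem avgPast_eq_integral (ν : Measure E) {w : (ℤ → E) → ℝ} {i : ℤ}
    (hw : DependsOn w (Set.Iio i)) {m : ℤ} (hm : i ≤ m) (x : ℤ → E) : avgPast ν m w x = ∫ y, w y ∂(iidLaw ℤ ν) := by
  refine integral_congr_ae (ae_of_all _ fun z => hw fun j hj => ?_)
  exact mix_of_notMem (fun h => by have := Set.mem_Iio.1 hj; have := Set.mem_Ici.1 h; omega) _ _

variable (ν : Measure E) [IsProbabilityMeasure ν]

theorem measurable_avgPast {w : (ℤ → E) → ℝ} (hw : Measurable w) (m : ℤ) :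
    Measurable (avgPast ν m w) := by
  have h : StronglyMeasurable (Function.uncurry fun x y : ℤ → E =>
      w (mix (Set.Ici m) x y)) :=
    Measurable.stronglyMeasurable
      (hw.comp (measurePreserving_piecewise ν (Set.Ici m)).measurable : Measurable _)
  exact h.integral_prod_right.measurable

theorem abs_avgPast_le {w : (ℤ → E) → ℝ} {M : ℝ} (hM : ∀ x, |w x| ≤ M) (m : ℤ) (x : ℤ → E) :
    |avgPast ν m w x| ≤ M := by
  have := norm_integral_le_of_norm_le_const (μ := iidLaw ℤ ν)
    (ae_of_all _ fun y => (Real.norm_eq_abs _).trans_le (hM (mix (Set.Ici m) x y)))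
  simpa [avgPast] using this

/-- The defining property of the conditional expectation. -/
theorem integral_avgPast_mul {w g : (ℤ → E) → ℝ} {M C : ℝ} (hw : Measurable w)
    (hM : ∀ x, |w x| ≤ M) (hg : Measurable g) (hC : ∀ x, |g x| ≤ C) {m : ℤ}
    (hgm : DependsOn g (Set.Ici m)) :
    ∫ x, avgPast ν m w x * g x ∂(iidLaw ℤ ν) = ∫ x, w x * g x ∂(iidLaw ℤ ν) := by
  have hmp := measurePreserving_piecewise ν (Set.Ici m) (E := E)
  conv_rhs => rw [← hmp.map_eq]
  rw [integral_map hmp.measurable.aemeasurable (f := fun x => w x * g x)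
    (hw.mul hg).aestronglyMeasurable]
  have e : ∀ z : (ℤ → E) × (ℤ → E), w (mix (Set.Ici m) z.1 z.2) *
      g (mix (Set.Ici m) z.1 z.2) = w (mix (Set.Ici m) z.1 z.2) * g z.1 :=
    fun z => by
      congr 1
      exact hgm fun j hj => mix_of_mem hj _ _
  simp only [e]
  rw [integral_prod]
  · simp only [avgPast, integral_mul_const]
  · refine Integrable.of_bound (C := M * C) ?_ (ae_of_all _ fun z => ?_)
    · exact ((hw.comp hmp.measurable).mul (hg.comp measurable_fst)).aestronglyMeasurable
    · rw [norm_mul, Real.norm_eq_abs, Real.norm_eq_abs]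
      exact mul_le_mul (hM _) (hC _) (abs_nonneg _) ((abs_nonneg _).trans (hM z.1))

theorem integral_avgPast {w : (ℤ → E) → ℝ} {M : ℝ} (hw : Measurable w)
    (hM : ∀ x, |w x| ≤ M) (m : ℤ) :
    ∫ x, avgPast ν m w x ∂(iidLaw ℤ ν) = ∫ x, w x ∂(iidLaw ℤ ν) := by
  simpa using integral_avgPast_mul ν (g := fun _ => 1) (C := 1) hw hM measurable_const (by simp)
    (m := m) ((dependsOn_const _).mono (by simp))

end AvgPast

section Increment

/-- Moving from `m` to `m + 1` replaces one coordinate of the mixed configuration, by that of the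
configuration with the two roles exchanged. -/
theorem mix_Ici_succ {E : Type*} (m : ℤ) (x y : ℤ → E) :
    mix (Set.Ici (m + 1)) x y
      = Function.update (mix (Set.Ici m) x y) m (mix (Set.Ici m) y x m) := by
  funext j
  rcases lt_trichotomy j m with h | h | h
  · rw [Function.update_of_ne h.ne, mix_of_notMem (by simp; omega), mix_of_notMem (by simp; omega)]
  · subst h
    rw [Function.update_self, mix_of_notMem (by simp), mix_of_mem (by simp)]
  · rw [Function.update_of_ne h.ne', mix_of_mem (by simp; omega), mix_of_mem (by simp; omega)]

variable {E : Type*} [MeasurableSpace E]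

theorem lintegral_sq_le {α : Type*} [MeasurableSpace α] (μ : Measure α) [IsProbabilityMeasure μ]
    {f : α → ℝ≥0∞} (hf : AEMeasurable f μ) : (∫⁻ x, f x ∂μ) ^ 2 ≤ ∫⁻ x, f x ^ 2 ∂μ := by
  have h := ENNReal.lintegral_mul_le_Lp_mul_Lq μ Real.HolderConjugate.two_two hf
    (aemeasurable_const (b := (1 : ℝ≥0∞)))
  simp only [Pi.mul_apply, mul_one, ENNReal.one_rpow, lintegral_one, measure_univ] at h
  calc (∫⁻ x, f x ∂μ) ^ 2 ≤ ((∫⁻ x, f x ^ (2 : ℝ) ∂μ) ^ (1 / 2 : ℝ)) ^ 2 := by gcongr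
    _ = ∫⁻ x, f x ^ 2 ∂μ := by
      rw [← ENNReal.rpow_natCast, ← ENNReal.rpow_mul]
      simp

/-- The increment of `w` due to the coordinate `m`: the difference of the conditional expectations
given the coordinates `≥ m` and `≥ m + 1`. -/
noncomputable def incr (ν : Measure E) (m : ℤ) (w : (ℤ → E) → ℝ) (x : ℤ → E) : ℝ :=
  avgPast ν m w x - avgPast ν (m + 1) w x

theorem dependsOn_incr (ν : Measure E) {w : (ℤ → E) → ℝ} {i : ℤ} (hw : DependsOn w (Set.Iio i))
    (m : ℤ) : DependsOn (incr ν m w) (Set.Ico m i) := fun _ _ hxy => by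
  rw [incr, incr, dependsOn_avgPast ν hw m hxy,
    dependsOn_avgPast ν hw (m + 1) fun j hj => hxy j ⟨by have := hj.1; omega, hj.2⟩]

variable (ν : Measure E) [IsProbabilityMeasure ν]

theorem measurable_incr {w : (ℤ → E) → ℝ} (hw : Measurable w) (m : ℤ) :
    Measurable (incr ν m w) :=
  (measurable_avgPast ν hw m).sub (measurable_avgPast ν hw (m + 1))

theorem abs_incr_le {w : (ℤ → E) → ℝ} {M : ℝ} (hM : ∀ x, |w x| ≤ M) (m : ℤ) (x : ℤ → E) :
    |incr ν m w x| ≤ 2 * M := by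
  have h1 := abs_avgPast_le ν hM m x
  have h2 := abs_avgPast_le ν hM (m + 1) x
  have := abs_sub (avgPast ν m w x) (avgPast ν (m + 1) w x)
  unfold incr
  linarith

theorem integrable_of_abs_le {α : Type*} [MeasurableSpace α] {μ : Measure α} [IsFiniteMeasure μ]
    {f : α → ℝ} (hf : Measurable f) {C : ℝ} (hC : ∀ x, |f x| ≤ C) : Integrable f μ :=
  Integrable.of_bound hf.aestronglyMeasurable C (ae_of_all _ fun x => hC x)

theorem abs_mul_le_mul {a b A B : ℝ} (ha : |a| ≤ A) (hb : |b| ≤ B) : |a * b| ≤ A * B := by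
  rw [abs_mul]
  exact mul_le_mul ha hb (abs_nonneg _) ((abs_nonneg _).trans ha)

/-- The increment at `m` is orthogonal to all functions of the later coordinates, so that increments
with decreasing `m` are martingale differences. -/
theorem integral_incr_mul {w g : (ℤ → E) → ℝ} {M C : ℝ} (hw : Measurable w)
    (hM : ∀ x, |w x| ≤ M) (hg : Measurable g) (hC : ∀ x, |g x| ≤ C) {m : ℤ}
    (hgm : DependsOn g (Set.Ici (m + 1))) :
    ∫ x, incr ν m w x * g x ∂(iidLaw ℤ ν) = 0 := by
  simp only [incr, sub_mul]
  rw [integral_sub]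
  · rw [integral_avgPast_mul ν hw hM hg hC (hgm.mono (Set.Ici_subset_Ici.2 (by omega))),
      integral_avgPast_mul ν hw hM hg hC hgm, sub_self]
  · exact integrable_of_abs_le ((measurable_avgPast ν hw m).mul hg)
      fun x => abs_mul_le_mul (abs_avgPast_le ν hM m x) (hC x)
  · exact integrable_of_abs_le ((measurable_avgPast ν hw (m + 1)).mul hg)
      fun x => abs_mul_le_mul (abs_avgPast_le ν hM (m + 1) x) (hC x)

theorem dependsOn_avgPast_Ici (ν : Measure E) (w : (ℤ → E) → ℝ) (m : ℤ) :
    DependsOn (avgPast ν m w) (Set.Ici m) := fun x y hxy => by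
  refine integral_congr_ae (ae_of_all _ fun z => ?_)
  have : mix (Set.Ici m) x z = mix (Set.Ici m) y z := by
    funext j
    by_cases h : j ∈ Set.Ici m
    · rw [mix_of_mem h, mix_of_mem h, hxy j h]
    · rw [mix_of_notMem h, mix_of_notMem h]
  simp only [this]

/-- The contraction property of the conditional expectation in `L²`. -/
theorem integral_avgPast_sq_le {w : (ℤ → E) → ℝ} {M : ℝ} (hw : Measurable w)
    (hM : ∀ x, |w x| ≤ M) (m : ℤ) :
    ∫ x, avgPast ν m w x ^ 2 ∂(iidLaw ℤ ν) ≤ ∫ x, w x ^ 2 ∂(iidLaw ℤ ν) := by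
  set A := avgPast ν m w
  have hA : Measurable A := measurable_avgPast ν hw m
  have hAM : ∀ x, |A x| ≤ M := abs_avgPast_le ν hM m
  have h1 := integral_avgPast_mul ν hw hM hA hAM (dependsOn_avgPast_Ici ν w m)
  have i1 : Integrable (fun x => w x ^ 2) (iidLaw ℤ ν) :=
    integrable_of_abs_le (hw.pow_const 2) (C := M * M)
      fun x => by rw [sq]; exact abs_mul_le_mul (hM x) (hM x)
  have i2 : Integrable (fun x => w x * A x) (iidLaw ℤ ν) :=
    integrable_of_abs_le (hw.mul hA) (C := M * M) fun x => abs_mul_le_mul (hM x) (hAM x)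
  have i3 : Integrable (fun x => A x ^ 2) (iidLaw ℤ ν) :=
    integrable_of_abs_le (hA.pow_const 2) (C := M * M)
      fun x => by rw [sq]; exact abs_mul_le_mul (hAM x) (hAM x)
  have h2 : 0 ≤ ∫ x, (w x ^ 2 - 2 * (w x * A x) + A x ^ 2) ∂(iidLaw ℤ ν) :=
    integral_nonneg fun x => by
      have := sq_nonneg (w x - A x)
      simp only [Pi.zero_apply]
      nlinarith
  rw [integral_add (f := fun x => w x ^ 2 - 2 * (w x * A x)) (i1.sub (i2.const_mul 2)) i3,
    integral_sub i1 (i2.const_mul 2), integral_const_mul] at h2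
  have h3 : ∫ x, A x ^ 2 ∂(iidLaw ℤ ν) = ∫ x, w x * A x ∂(iidLaw ℤ ν) := by
    rw [← h1]; simp only [sq]; rfl
  linarith

theorem integral_incr_sq_le {w : (ℤ → E) → ℝ} {M : ℝ} (hw : Measurable w)
    (hM : ∀ x, |w x| ≤ M) (m : ℤ) :
    ∫ x, incr ν m w x ^ 2 ∂(iidLaw ℤ ν) ≤ ∫ x, w x ^ 2 ∂(iidLaw ℤ ν) := by
  refine le_trans ?_ (integral_avgPast_sq_le ν hw hM m)
  set A := avgPast ν m w
  set B := avgPast ν (m + 1) w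
  have hA : Measurable A := measurable_avgPast ν hw m
  have hB : Measurable B := measurable_avgPast ν hw (m + 1)
  have hAM : ∀ x, |A x| ≤ M := abs_avgPast_le ν hM m
  have hBM : ∀ x, |B x| ≤ M := abs_avgPast_le ν hM (m + 1)
  have h1 := integral_incr_mul ν hw hM hB hBM (dependsOn_avgPast_Ici ν w (m + 1))
  have hD : Measurable (incr ν m w) := measurable_incr ν hw m
  have hDM : ∀ x, |incr ν m w x| ≤ 2 * M := abs_incr_le ν hM m
  have i2 : Integrable (fun x => incr ν m w x * B x) (iidLaw ℤ ν) :=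
    integrable_of_abs_le (hD.mul hB) fun x => abs_mul_le_mul (hDM x) (hBM x)
  have i3 : Integrable (fun x => A x ^ 2) (iidLaw ℤ ν) :=
    integrable_of_abs_le (hA.pow_const 2) (C := M * M)
      fun x => by rw [sq]; exact abs_mul_le_mul (hAM x) (hAM x)
  have i4 : Integrable (fun x => incr ν m w x ^ 2) (iidLaw ℤ ν) :=
    integrable_of_abs_le (hD.pow_const 2)
      fun x => by rw [sq]; exact abs_mul_le_mul (hDM x) (hDM x)
  have h2 : ∫ x, (incr ν m w x ^ 2 + 2 * (incr ν m w x * B x)) ∂(iidLaw ℤ ν)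
      ≤ ∫ x, A x ^ 2 ∂(iidLaw ℤ ν) :=
    integral_mono (i4.add (i2.const_mul 2)) i3 fun x => by
      have : A x = incr ν m w x + B x := by simp [incr, A, B]
      simp only [this]
      nlinarith [sq_nonneg (B x)]
  rw [integral_add i4 (i2.const_mul 2), integral_const_mul, h1] at h2
  linarith

/-- The average of `U` over the coordinates `< m`, applied to the pair of configurations that
differ by an exchange of these coordinates. -/
noncomputable def avgPair (ν : Measure E) (m : ℤ) (U : (ℤ → E) × (ℤ → E) → ℝ≥0∞) (x : ℤ → E) :
    ℝ≥0∞ :=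
  ∫⁻ y, U (mix (Set.Ici m) x y, mix (Set.Ici m) y x) ∂(iidLaw ℤ ν)

theorem measurable_avgPair {U : (ℤ → E) × (ℤ → E) → ℝ≥0∞} (hU : Measurable U) (m : ℤ) :
    Measurable (avgPair ν m U) :=
  Measurable.lintegral_prod_right' (f := fun z : (ℤ → E) × (ℤ → E) =>
    U (mix (Set.Ici m) z.1 z.2, mix (Set.Ici m) z.2 z.1))
    (hU.comp (measurePreserving_exchange ν (Set.Ici m)).measurable)

theorem lintegral_avgPair_sq_le {U : (ℤ → E) × (ℤ → E) → ℝ≥0∞} (hU : Measurable U) (m : ℤ) :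
    ∫⁻ x, avgPair ν m U x ^ 2 ∂(iidLaw ℤ ν)
      ≤ ∫⁻ z, U z ^ 2 ∂((iidLaw ℤ ν).prod (iidLaw ℤ ν)) := by
  have hmp := measurePreserving_exchange ν (Set.Ici m) (E := E)
  have hm : Measurable fun z : (ℤ → E) × (ℤ → E) =>
    U (mix (Set.Ici m) z.1 z.2, mix (Set.Ici m) z.2 z.1) := hU.comp hmp.measurable
  rw [← hmp.lintegral_comp (hU.pow_const 2), lintegral_prod _ (hm.pow_const 2).aemeasurable]
  refine lintegral_mono fun x => lintegral_sq_le _ ?_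
  exact (hm.comp measurable_prodMk_left).aemeasurable

/-- Exchanging the coordinate `m` for an independent copy dominates the increment at `m`. -/
theorem enorm_incr_le {w : (ℤ → E) → ℝ} {M : ℝ} (hw : Measurable w) (hM : ∀ x, |w x| ≤ M)
    {m : ℤ} {c : ℝ≥0∞} {U : (ℤ → E) × (ℤ → E) → ℝ≥0∞} (hU : Measurable U)
    (h : ∀ x y, ‖w x - w (Function.update x m (y m))‖ₑ ≤ c * U (x, y)) (x : ℤ → E) :
    ‖incr ν m w x‖ₑ ≤ c * avgPair ν m U x := by
  have hmp : ∀ m : ℤ, Measurable fun y : ℤ → E => w (mix (Set.Ici m) x y) := fun m =>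
    hw.comp ((measurePreserving_piecewise ν (Set.Ici m)).measurable.comp measurable_prodMk_left)
  have hm : Measurable fun z : (ℤ → E) × (ℤ → E) =>
    U (mix (Set.Ici m) z.1 z.2, mix (Set.Ici m) z.2 z.1) :=
    hU.comp (measurePreserving_exchange ν (Set.Ici m)).measurable
  rw [incr, avgPast, avgPast, ← integral_sub (integrable_of_abs_le (hmp m) fun y => hM _)
    (integrable_of_abs_le (hmp (m + 1)) fun y => hM _), avgPair,
    ← lintegral_const_mul _ (show Measurable fun y => U (mix (Set.Ici m) x y, mix (Set.Ici m) y x)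
      from hm.comp (measurable_prodMk_left (x := x)))]
  refine (enorm_integral_le_lintegral_enorm _).trans (lintegral_mono fun y => ?_)
  have := h (mix (Set.Ici m) x y) (mix (Set.Ici m) y x)
  rwa [← mix_Ici_succ] at this

/-- As the averaged past recedes, the averages converge to the function itself. -/
theorem tendsto_avgPast {w : (ℤ → E) → ℝ} {M : ℝ} (hw : Measurable w) (hM : ∀ x, |w x| ≤ M)
    (a : ℤ) :
    ∀ᵐ x ∂(iidLaw ℤ ν), Filter.Tendsto (fun K : ℕ => avgPast ν (a - K) w x) Filter.atTop
      (nhds (w x)) := by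
  have hle : ∀ m : ℤ, MeasurableSpace.comap (fun (x : ℤ → E) (j : Set.Ici m) => x j)
      inferInstance ≤ MeasurableSpace.pi := fun m =>
    Measurable.comap_le (by fun_prop)
  have hcoord : ∀ m j : ℤ, m ≤ j → Measurable[MeasurableSpace.comap
      (fun (x : ℤ → E) (j : Set.Ici m) => x j) inferInstance] fun x : ℤ → E => x j := by
    intro m j hmj
    exact (measurable_pi_apply (⟨j, hmj⟩ : Set.Ici m)).comp
      (comap_measurable fun (x : ℤ → E) (j : Set.Ici m) => x j)
  let ℱ : Filtration ℕ (MeasurableSpace.pi : MeasurableSpace (ℤ → E)) :=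
    { seq := fun K => MeasurableSpace.comap (fun (x : ℤ → E) (j : Set.Ici (a - K : ℤ)) => x j)
        inferInstance
      mono' := fun K K' hK => by
        refine Measurable.comap_le ?_
        refine @measurable_pi_lambda _ _ _ (_) _ _ fun j => hcoord _ _ ?_
        have := j.2
        simp only [Set.mem_Ici] at this
        have : (K : ℤ) ≤ K' := by exact_mod_cast hK
        omega
      le' := fun K => hle _ }
  have hsup : ⨆ K, ℱ K = (MeasurableSpace.pi : MeasurableSpace (ℤ → E)) := by
    refine le_antisymm (iSup_le fun K => ℱ.le K) ?_
    refine iSup_le fun j => ?_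
    refine le_trans ?_ (le_iSup _ (a - j).toNat)
    exact Measurable.comap_le (hcoord _ _ (by omega))
  have hint : Integrable w (iidLaw ℤ ν) := integrable_of_abs_le hw hM
  have hce : ∀ K : ℕ, avgPast ν (a - K) w =ᵐ[iidLaw ℤ ν] (iidLaw ℤ ν)[w | ℱ K] := by
    intro K
    refine ae_eq_condExp_of_forall_setIntegral_eq (ℱ.le K) hint
      (fun s _ _ => (integrable_of_abs_le (measurable_avgPast ν hw _)
        (abs_avgPast_le ν hM _)).integrableOn) ?_ ?_
    · intro s hs _
      have hs' : MeasurableSet s := ℱ.le K s hs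
      have hd : DependsOn (s.indicator fun _ => (1 : ℝ)) (Set.Ici (a - K : ℤ)) := by
        obtain ⟨t, -, rfl⟩ := hs
        intro x y hxy
        have : (fun j : Set.Ici (a - K : ℤ) => x j) = fun j : Set.Ici (a - K : ℤ) => y j :=
          funext fun j => hxy j j.2
        have hiff : x ∈ (fun (x : ℤ → E) (j : Set.Ici (a - K : ℤ)) => x j) ⁻¹' t ↔
            y ∈ (fun (x : ℤ → E) (j : Set.Ici (a - K : ℤ)) => x j) ⁻¹' t := by
          rw [Set.mem_preimage, Set.mem_preimage, this]
        by_cases hx : x ∈ (fun (x : ℤ → E) (j : Set.Ici (a - K : ℤ)) => x j) ⁻¹' t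
        · rw [Set.indicator_of_mem hx, Set.indicator_of_mem (hiff.1 hx)]
        · rw [Set.indicator_of_notMem hx, Set.indicator_of_notMem (hiff.not.1 hx)]
      have := integral_avgPast_mul ν hw hM (measurable_const.indicator hs')
        (C := 1) (fun x => by by_cases h : x ∈ s <;> simp [h]) hd
      rw [← integral_indicator hs', ← integral_indicator hs']
      convert this using 2 <;> funext x <;> by_cases h : x ∈ s <;> simp [h]
    · obtain ⟨x₀⟩ : Nonempty (ℤ → E) := (iidLaw ℤ ν).nonempty_of_neZero
      have hmeas : Measurable[ℱ K] fun x : ℤ → E => mix (Set.Ici (a - K : ℤ)) x x₀ := by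
        refine @measurable_pi_lambda _ _ _ (_) _ _ fun j => ?_
        by_cases h : j ∈ Set.Ici (a - K : ℤ)
        · simp only [mix_of_mem h]
          exact hcoord _ _ h
        · simp only [mix_of_notMem h]
          exact measurable_const
      have heq : avgPast ν (a - K) w
          = fun x => avgPast ν (a - K) w (mix (Set.Ici (a - K : ℤ)) x x₀) := by
        funext x
        exact dependsOn_avgPast_Ici ν w _ fun j hj => (mix_of_mem hj _ _).symm
      rw [heq]
      exact (((measurable_avgPast ν hw _).comp hmeas).stronglyMeasurable).aestronglyMeasurable
  have hlim := tendsto_ae_condExp (μ := iidLaw ℤ ν) (ℱ := ℱ) w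
  filter_upwards [hlim, ae_all_iff.2 hce] with x hx hx'
  rw [hsup, condExp_of_stronglyMeasurable le_rfl hw.stronglyMeasurable hint] at hx
  exact hx.congr fun K => (hx' K).symm

end Increment

/-! ### A maximal inequality for finite families of martingales -/

section SoftMax

variable {ι : Type*} [Fintype ι]

/-- The logarithm of `∑ exp (l s_f)`, a smooth proxy of `l max_f s_f`. -/
noncomputable def logSumExp (l : ℝ) (s : ι → ℝ) : ℝ := Real.log (∑ f, Real.exp (l * s f))

/-- The gradient of `l⁻¹ logSumExp l`: a probability vector. -/
noncomputable def softMax (l : ℝ) (s : ι → ℝ) (f : ι) : ℝ :=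
  Real.exp (l * s f) / ∑ g, Real.exp (l * s g)

theorem measurable_logSumExp (l : ℝ) : Measurable (logSumExp l : (ι → ℝ) → ℝ) := by
  unfold logSumExp; fun_prop

theorem measurable_softMax (l : ℝ) (f : ι) : Measurable fun s : ι → ℝ => softMax l s f := by
  unfold softMax; fun_prop

theorem softMax_nonneg (l : ℝ) (s : ι → ℝ) (f : ι) : 0 ≤ softMax l s f := by
  unfold softMax; positivity

theorem softMax_le_one (l : ℝ) (s : ι → ℝ) (f : ι) : softMax l s f ≤ 1 := by
  refine div_le_one_of_le₀ ?_ (by positivity)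
  exact Finset.single_le_sum (f := fun g => Real.exp (l * s g)) (fun g _ => (Real.exp_pos _).le)
    (Finset.mem_univ f)

variable [Nonempty ι]

theorem sum_exp_pos (l : ℝ) (s : ι → ℝ) : 0 < ∑ f, Real.exp (l * s f) :=
  Finset.sum_pos (fun _ _ => Real.exp_pos _) Finset.univ_nonempty

theorem sum_softMax (l : ℝ) (s : ι → ℝ) : ∑ f, softMax l s f = 1 := by
  simp only [softMax, ← Finset.sum_div]
  exact div_self (sum_exp_pos l s).ne'

theorem mul_le_logSumExp (l : ℝ) (s : ι → ℝ) (f : ι) : l * s f ≤ logSumExp l s := by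
  rw [logSumExp, Real.le_log_iff_exp_le (sum_exp_pos l s)]
  exact Finset.single_le_sum (f := fun g => Real.exp (l * s g)) (fun g _ => (Real.exp_pos _).le)
    (Finset.mem_univ f)

theorem logSumExp_le {l : ℝ} (hl : 0 ≤ l) (s : ι → ℝ) :
    logSumExp l s ≤ Real.log (Fintype.card ι) + l * ‖s‖ := by
  rw [logSumExp, Real.log_le_iff_le_exp (sum_exp_pos l s), Real.exp_add,
    Real.exp_log (by exact_mod_cast Fintype.card_pos)]
  calc ∑ f, Real.exp (l * s f) ≤ ∑ _f : ι, Real.exp (l * ‖s‖) := by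
        gcongr with f
        exact (le_abs_self _).trans (norm_le_pi_norm s f)
    _ = _ := by simp

/-- The second order term of `logSumExp` is quadratic in the maximum norm of the increment,
irrespective of the size of the family. -/
theorem logSumExp_add_le {l : ℝ} (hl : 0 ≤ l) (s d : ι → ℝ) :
    logSumExp l (s + d) ≤ logSumExp l s + l * ∑ f, softMax l s f * d f + 2 * l ^ 2 * ‖d‖ ^ 2 := by
  set D := ‖d‖
  have hD : 0 ≤ D := norm_nonneg d
  have hd : ∀ f, |d f| ≤ D := fun f => norm_le_pi_norm d f
  have hp := softMax_nonneg l s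
  have hfac : ∑ f, Real.exp (l * (s + d) f)
      = (∑ f, Real.exp (l * s f)) * ∑ f, softMax l s f * Real.exp (l * d f) := by
    rw [Finset.mul_sum]
    refine Finset.sum_congr rfl fun f _ => ?_
    rw [Pi.add_apply, mul_add, Real.exp_add, softMax]
    field_simp [(sum_exp_pos l s).ne']
  have hpos : 0 < ∑ f, softMax l s f * Real.exp (l * d f) :=
    Finset.sum_pos (fun f _ => mul_pos (div_pos (Real.exp_pos _) (sum_exp_pos l s))
      (Real.exp_pos _)) Finset.univ_nonempty
  rw [logSumExp, hfac, Real.log_mul (sum_exp_pos l s).ne' hpos.ne', add_assoc]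
  refine add_le_add le_rfl ?_
  have hld : ∀ f, |l * d f| ≤ l * D := fun f => by
    rw [abs_mul, abs_of_nonneg hl]; exact mul_le_mul_of_nonneg_left (hd f) hl
  -- a second order expansion for small increments; for `1 ≤ l D` the linear growth is enough
  rcases le_total (l * D) 1 with h | h
  · have h1 : ∑ f, softMax l s f * Real.exp (l * d f)
        ≤ ∑ f, softMax l s f * (1 + l * d f + (l * D) ^ 2) := by
      refine Finset.sum_le_sum fun f _ => mul_le_mul_of_nonneg_left ?_ (hp f)
      have h2 := (abs_le.1 (Real.abs_exp_sub_one_sub_id_le ((hld f).trans h))).2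
      have h3 : (l * d f) ^ 2 ≤ (l * D) ^ 2 := sq_le_sq' (by linarith [neg_le_of_abs_le (hld f)])
        (le_of_abs_le (hld f))
      linarith
    have h2 : ∑ f, softMax l s f * (1 + l * d f + (l * D) ^ 2)
        = 1 + l * ∑ f, softMax l s f * d f + (l * D) ^ 2 := by
      have h3 : ∀ f, softMax l s f * (1 + l * d f + (l * D) ^ 2)
          = softMax l s f + l * (softMax l s f * d f) + softMax l s f * (l * D) ^ 2 :=
        fun f => by ring
      simp only [h3, Finset.sum_add_distrib, ← Finset.sum_mul, ← Finset.mul_sum, sum_softMax,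
        one_mul]
    have h3 := Real.log_le_sub_one_of_pos hpos
    nlinarith [sq_nonneg (l * D)]
  · have h1 : ∑ f, softMax l s f * Real.exp (l * d f) ≤ Real.exp (l * D) := by
      calc _ ≤ ∑ f, softMax l s f * Real.exp (l * D) := by
            refine Finset.sum_le_sum fun f _ => mul_le_mul_of_nonneg_left ?_ (hp f)
            exact Real.exp_le_exp.2 (le_of_abs_le (hld f))
        _ = _ := by rw [← Finset.sum_mul, sum_softMax, one_mul]
    have h2 : Real.log (∑ f, softMax l s f * Real.exp (l * d f)) ≤ l * D := by
      rwa [Real.log_le_iff_le_exp hpos]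
    have h3 : -D ≤ ∑ f, softMax l s f * d f := by
      calc -D = ∑ f, softMax l s f * (-D) := by rw [← Finset.sum_mul, sum_softMax, one_mul]
        _ ≤ _ := Finset.sum_le_sum fun f _ =>
            mul_le_mul_of_nonneg_left (neg_le_of_abs_le (hd f)) (hp f)
    nlinarith

variable {α : Type*} [MeasurableSpace α] (μ : Measure α) [IsProbabilityMeasure μ]

/-- The first order terms of `logSumExp` vanish in the mean, by orthogonality. -/
theorem integral_logSumExp_le {l : ℝ} (hl : 0 ≤ l) {d : ℕ → α → ι → ℝ}
    (hd : ∀ m, Measurable (d m)) {C : ℝ} (hC : ∀ m x, ‖d m x‖ ≤ C)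
    (horth : ∀ m f (h : (ι → ℝ) → ℝ), Measurable h → (∀ s, |h s| ≤ 1) →
      ∫ x, d m x f * h (∑ j ∈ Finset.range m, d j x) ∂μ = 0) (N : ℕ) :
    ∫ x, logSumExp l (∑ j ∈ Finset.range N, d j x) ∂μ
      ≤ Real.log (Fintype.card ι) + 2 * l ^ 2 * ∑ j ∈ Finset.range N, ∫ x, ‖d j x‖ ^ 2 ∂μ := by
  have hS : ∀ m, Measurable fun x => ∑ j ∈ Finset.range m, d j x := fun m =>
    Finset.measurable_fun_sum _ fun j _ => hd j
  have hSn : ∀ m x, ‖∑ j ∈ Finset.range m, d j x‖ ≤ m * C := fun m x => by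
    refine (norm_sum_le _ _).trans ((Finset.sum_le_sum fun j _ => hC j x).trans ?_)
    simp
  have hlint : ∀ m, Integrable (fun x => logSumExp l (∑ j ∈ Finset.range m, d j x)) μ := by
    intro m
    refine integrable_of_abs_le ((measurable_logSumExp l).comp (hS m))
      (C := Real.log (Fintype.card ι) + l * (m * C)) fun x => ?_
    have h0 : 0 ≤ Real.log (Fintype.card ι) :=
      Real.log_nonneg (by exact_mod_cast Fintype.card_pos)
    have h1 := mul_le_mul_of_nonneg_left (hSn m x) hl
    have f := Classical.arbitrary ι
    have h2 := mul_le_logSumExp l (∑ j ∈ Finset.range m, d j x) f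
    have h3 : |(∑ j ∈ Finset.range m, d j x) f| ≤ ‖∑ j ∈ Finset.range m, d j x‖ :=
      norm_le_pi_norm (∑ j ∈ Finset.range m, d j x) f
    have h4 := mul_le_mul_of_nonneg_left (neg_le_of_abs_le h3) hl
    have h5 := logSumExp_le hl (∑ j ∈ Finset.range m, d j x)
    exact abs_le.2 ⟨by nlinarith, by linarith⟩
  have hdf : ∀ m f, Measurable fun x => d m x f := fun m f => (measurable_pi_apply f).comp (hd m)
  have hsm : ∀ m f, Measurable fun x => softMax l (∑ j ∈ Finset.range m, d j x) f := fun m f =>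
    (measurable_softMax l f).comp (hS m)
  have habs : ∀ (s : ι → ℝ) (f : ι), |softMax l s f| ≤ 1 := fun s f => by
    rw [abs_of_nonneg (softMax_nonneg l s f)]; exact softMax_le_one l s f
  induction N with
  | zero => simp [logSumExp]
  | succ N ih =>
    have i1 : ∀ f, Integrable (fun x => softMax l (∑ j ∈ Finset.range N, d j x) f * d N x f) μ :=
      fun f => integrable_of_abs_le ((hsm N f).mul (hdf N f)) fun x =>
        abs_mul_le_mul (habs _ f) ((norm_le_pi_norm (d N x) f).trans (hC N x))
    have i2 : Integrable (fun x => ‖d N x‖ ^ 2) μ :=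
      integrable_of_abs_le ((hd N).norm.pow_const 2) (C := C ^ 2) fun x => by
        rw [abs_of_nonneg (by positivity)]
        exact pow_le_pow_left₀ (norm_nonneg _) (hC N x) 2
    have i3 : Integrable (fun x => ∑ f, softMax l (∑ j ∈ Finset.range N, d j x) f * d N x f) μ :=
      integrable_finsetSum _ fun f _ => i1 f
    have hz : ∫ x, ∑ f, softMax l (∑ j ∈ Finset.range N, d j x) f * d N x f ∂μ = 0 := by
      rw [integral_finsetSum _ fun f _ => i1 f]
      refine Finset.sum_eq_zero fun f _ => ?_
      rw [← horth N f (fun s => softMax l s f) (measurable_softMax l f) fun s => habs s f]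
      simp only [mul_comm]
    calc ∫ x, logSumExp l (∑ j ∈ Finset.range (N + 1), d j x) ∂μ
        ≤ ∫ x, (logSumExp l (∑ j ∈ Finset.range N, d j x)
          + l * ∑ f, softMax l (∑ j ∈ Finset.range N, d j x) f * d N x f
          + 2 * l ^ 2 * ‖d N x‖ ^ 2) ∂μ := by
          refine integral_mono (hlint (N + 1))
            (((hlint N).add (i3.const_mul l)).add (i2.const_mul _)) fun x => ?_
          simp only [Finset.sum_range_succ]
          exact logSumExp_add_le hl _ _
      _ = ∫ x, logSumExp l (∑ j ∈ Finset.range N, d j x) ∂μ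
          + 2 * l ^ 2 * ∫ x, ‖d N x‖ ^ 2 ∂μ := by
          rw [integral_add (f := fun x => logSumExp l (∑ j ∈ Finset.range N, d j x)
            + l * ∑ f, softMax l (∑ j ∈ Finset.range N, d j x) f * d N x f)
            ((hlint N).add (i3.const_mul l)) (i2.const_mul _),
            integral_add (hlint N) (i3.const_mul l), integral_const_mul, integral_const_mul, hz]
          ring
      _ ≤ _ := by
          rw [Finset.sum_range_succ]
          nlinarith

/-- If the increments `d m` are orthogonal to all functions of the preceding partial sum, the
expected maximum norm of the sum is of order `√(log |ι| ∑ E ‖d m‖²)`. -/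
theorem integral_norm_sum_le {d : ℕ → α → ι → ℝ}
    (hd : ∀ m, Measurable (d m)) {C : ℝ} (hC : ∀ m x, ‖d m x‖ ≤ C)
    (horth : ∀ m f (h : (ι → ℝ) → ℝ), Measurable h → (∀ s, |h s| ≤ 1) →
      ∫ x, d m x f * h (∑ j ∈ Finset.range m, d j x) ∂μ = 0) (N : ℕ) {H v : ℝ} (hH : 1 ≤ H)
    (hHι : Real.log (Fintype.card ι) ≤ H) (hv : 0 ≤ v)
    (hvar : ∑ j ∈ Finset.range N, ∫ x, ‖d j x‖ ^ 2 ∂μ ≤ v ^ 2) :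
    ∫ x, ‖∑ j ∈ Finset.range N, d j x‖ ∂μ ≤ 4 * Real.sqrt H * v := by
  -- the signed family has the sums and their negatives as coordinates
  let e : (ι → ℝ) → (ι × Bool → ℝ) := fun s a => if a.2 then s a.1 else -s a.1
  have he : Measurable e := measurable_pi_lambda _ fun a => by
    rcases a with ⟨f, _ | _⟩ <;> simp only [e] <;> simp <;> fun_prop
  have hesum : ∀ m x, ∑ j ∈ Finset.range m, e (d j x) = e (∑ j ∈ Finset.range m, d j x) := by
    intro m x
    funext a
    rcases a with ⟨f, _ | _⟩ <;> simp [e]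
  have hen : ∀ s, ‖e s‖ = ‖s‖ := by
    intro s
    refine le_antisymm ?_ ?_
    · refine (pi_norm_le_iff_of_nonneg (norm_nonneg _)).2 fun a => ?_
      rcases a with ⟨f, _ | _⟩ <;> simpa [e] using norm_le_pi_norm s f
    · refine (pi_norm_le_iff_of_nonneg (norm_nonneg _)).2 fun f => ?_
      simpa [e] using norm_le_pi_norm (e s) (f, true)
  -- the optimal parameter `√H / v` is not available for `v = 0`, hence the detour through `u`
  have key : ∀ u : ℝ, 0 < u → v ≤ u →
      ∫ x, ‖∑ j ∈ Finset.range N, d j x‖ ∂μ ≤ 4 * Real.sqrt H * u := by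
    intro u hu hvu
    have hsH : 0 < Real.sqrt H := Real.sqrt_pos.2 (by linarith)
    set l := Real.sqrt H / u with hl
    have hl0 : 0 < l := div_pos hsH hu
    have h1 := integral_logSumExp_le μ hl0.le (d := fun m x => e (d m x))
      (fun m => he.comp (hd m)) (C := C) (fun m x => (hen _).trans_le (hC m x)) (by
        intro m a h hh hb
        simp only [hesum]
        have h2 := horth m a.1 (fun s => h (e s)) (hh.comp he) fun s => hb _
        rcases a with ⟨f, _ | _⟩
        · simp only [e] at h2 ⊢
          simp only [Bool.false_eq_true, if_false, neg_mul, integral_neg, neg_eq_zero]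
          exact h2
        · simp only [e] at h2 ⊢
          simp only [if_true]
          exact h2) N
    simp only [hesum, hen] at h1
    have hpt : ∀ x, ‖∑ j ∈ Finset.range N, d j x‖
        ≤ l⁻¹ * logSumExp l (e (∑ j ∈ Finset.range N, d j x)) := by
      intro x
      have hb : ∀ f, ‖(∑ j ∈ Finset.range N, d j x) f‖
          ≤ l⁻¹ * logSumExp l (e (∑ j ∈ Finset.range N, d j x)) := by
        intro f
        rw [le_inv_mul_iff₀ hl0, Real.norm_eq_abs]
        have h2 := mul_le_logSumExp l (e (∑ j ∈ Finset.range N, d j x)) (f, true)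
        have h3 := mul_le_logSumExp l (e (∑ j ∈ Finset.range N, d j x)) (f, false)
        simp only [e, if_true, Bool.false_eq_true, if_false] at h2 h3
        rcases abs_cases ((∑ j ∈ Finset.range N, d j x) f) with ⟨h, -⟩ | ⟨h, -⟩ <;> rw [h]
        · exact h2
        · exact h3
      obtain ⟨f₀⟩ := ‹Nonempty ι›
      exact (pi_norm_le_iff_of_nonneg ((norm_nonneg _).trans (hb f₀))).2 hb
    have hSn : ∀ x, ‖∑ j ∈ Finset.range N, d j x‖ ≤ N * C := fun x => by
      refine (norm_sum_le _ _).trans ((Finset.sum_le_sum fun j _ => hC j x).trans ?_)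
      simp
    have hSm : Measurable fun x => ∑ j ∈ Finset.range N, d j x :=
      Finset.measurable_fun_sum _ fun j _ => hd j
    have hint2 : Integrable (fun x => logSumExp l (e (∑ j ∈ Finset.range N, d j x))) μ := by
      refine integrable_of_abs_le ((measurable_logSumExp l).comp (he.comp hSm))
        (C := Real.log (Fintype.card (ι × Bool)) + l * (N * C)) fun x => ?_
      have h5 := logSumExp_le hl0.le (e (∑ j ∈ Finset.range N, d j x))
      have h6 := (norm_nonneg _).trans (hpt x)
      rw [hen] at h5
      rw [abs_of_nonneg (by
        have := mul_nonneg hl0.le h6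
        rwa [mul_inv_cancel_left₀ hl0.ne'] at this)]
      nlinarith [hSn x]
    have h2 : ∫ x, ‖∑ j ∈ Finset.range N, d j x‖ ∂μ
        ≤ l⁻¹ * ∫ x, logSumExp l (e (∑ j ∈ Finset.range N, d j x)) ∂μ := by
      rw [← integral_const_mul]
      exact integral_mono (integrable_of_abs_le hSm.norm fun x => by
        rw [abs_of_nonneg (norm_nonneg _)]; exact hSn x) (hint2.const_mul _) hpt
    have hcard : Real.log (Fintype.card (ι × Bool)) ≤ 2 * H := by
      rw [Fintype.card_prod, Fintype.card_bool, Nat.cast_mul, Real.log_mul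
        (by exact_mod_cast Fintype.card_ne_zero) (by norm_num)]
      have : Real.log ((2 : ℕ) : ℝ) ≤ 1 := by
        have := Real.log_le_sub_one_of_pos (x := ((2 : ℕ) : ℝ)) (by norm_num)
        norm_num at this ⊢
        linarith
      linarith
    have h3 : ∫ x, logSumExp l (e (∑ j ∈ Finset.range N, d j x)) ∂μ ≤ 4 * H := by
      have h4 : 2 * l ^ 2 * ∑ j ∈ Finset.range N, ∫ x, ‖d j x‖ ^ 2 ∂μ ≤ 2 * l ^ 2 * u ^ 2 := by
        refine mul_le_mul_of_nonneg_left (hvar.trans ?_) (by positivity)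
        exact pow_le_pow_left₀ hv hvu 2
      have h5 : 2 * l ^ 2 * u ^ 2 = 2 * H := by
        rw [hl, div_pow, Real.sq_sqrt (by linarith)]
        field_simp
      linarith
    calc _ ≤ l⁻¹ * (4 * H) := h2.trans (mul_le_mul_of_nonneg_left h3 (by positivity))
      _ = 4 * Real.sqrt H * u := by
        rw [hl, inv_div, show u / Real.sqrt H * (4 * H) = 4 * u * (H / Real.sqrt H) by ring,
          Real.div_sqrt]
        ring
  refine le_of_forall_pos_le_add fun δ hδ => ?_
  have hsH : 0 < Real.sqrt H := Real.sqrt_pos.2 (by linarith)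
  have := key (v + δ / (4 * Real.sqrt H)) (by positivity) (by
    have : 0 ≤ δ / (4 * Real.sqrt H) := by positivity
    linarith)
  rw [mul_add, mul_div_cancel₀ _ (by positivity)] at this
  exact this

end SoftMax

/-! ### Arrays of functions of i.i.d. innovations with a dependence bound -/

theorem eLpNorm_two_le_ofReal_iff {α F : Type*} [MeasurableSpace α] [NormedAddCommGroup F]
    {μ : Measure α} {g : α → F} (hg : MemLp g 2 μ) {a : ℝ} (ha : 0 ≤ a) :
    eLpNorm g 2 μ ≤ ENNReal.ofReal a ↔ ∫ x, ‖g x‖ ^ 2 ∂μ ≤ a ^ 2 := by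
  rw [hg.eLpNorm_eq_integral_rpow_norm (by norm_num) (by norm_num),
    ENNReal.ofReal_le_ofReal_iff ha]
  simp only [ENNReal.toReal_ofNat, Real.rpow_ofNat]
  rw [← one_div, ← Real.sqrt_eq_rpow, Real.sqrt_le_left ha]

theorem memLp_two_of_norm_le {α F : Type*} [MeasurableSpace α] [NormedAddCommGroup F]
    {μ : Measure α} [IsFiniteMeasure μ] {g : α → F} (hg : AEStronglyMeasurable g μ) {C : ℝ}
    (hC : ∀ x, ‖g x‖ ≤ C) : MemLp g 2 μ :=
  MemLp.of_bound hg C (ae_of_all _ hC)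

theorem pi_enorm_le {ι : Type*} [Fintype ι] {g : ι → ℝ} {a : ℝ≥0∞} (h : ∀ f, ‖g f‖ₑ ≤ a) :
    ‖g‖ₑ ≤ a := by
  rcases eq_or_ne a ∞ with rfl | ha
  · exact le_top
  · lift a to NNReal using ha
    rw [enorm_eq_nnnorm, ENNReal.coe_le_coe]
    exact pi_nnnorm_le_iff.2 fun f => by simpa [enorm_eq_nnnorm] using h f

/-- Reversal of the order of summation. -/
theorem sum_Icc_one_eq_sum_range_sub {A : Type*} [AddCommMonoid A] (n : ℕ) (g : ℕ → A) :
    ∑ i ∈ Finset.Icc 1 n, g i = ∑ m ∈ Finset.range n, g (n - m) :=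
  Finset.sum_nbij' (fun i => n - i) (fun m => n - m)
    (by intro i hi; simp only [Finset.mem_Icc] at hi; simp only [Finset.mem_range]; omega)
    (by intro i hi; simp only [Finset.mem_range] at hi; simp only [Finset.mem_Icc]; omega)
    (by intro i hi; simp only [Finset.mem_Icc] at hi; omega)
    (by intro i hi; simp only [Finset.mem_range] at hi; omega)
    (by
      intro i hi
      simp only [Finset.mem_Icc] at hi
      rw [show n - (n - i) = i by omega])

section ShiftArray

variable {E ι : Type*} [MeasurableSpace E]

/-- `w i f`, for `i = 1, …, n`, are functions of the innovations with index `< i`, bounded by `M`.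
Replacing the innovation with index `i - k` by a copy changes `w i f` by at most `c i f` times a
random variable, the same for all `f`, whose `L²` norm is at most `Δ k`. -/
structure IsShiftArray (ν : Measure E) (n : ℕ) (M : ℝ) (Δ : ℕ → ℝ) (c : ℕ → ι → ℝ)
    (w : ℕ → ι → (ℤ → E) → ℝ) : Prop where
  measurable : ∀ i f, Measurable (w i f)
  abs_le : ∀ i f x, |w i f x| ≤ M
  dependsOn : ∀ i f, DependsOn (w i f) (Set.Iio (i : ℤ))
  nonneg : ∀ i f, 0 ≤ c i f
  coupling : ∀ i ∈ Finset.Icc 1 n, ∀ k : ℕ, 1 ≤ k → ∃ U : (ℤ → E) × (ℤ → E) → ℝ≥0∞, Measurable U ∧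
    ∫⁻ z, U z ^ 2 ∂((iidLaw ℤ ν).prod (iidLaw ℤ ν)) ≤ ENNReal.ofReal (Δ k) ^ 2 ∧
    ∀ f x y, ‖w i f x - w i f (Function.update x ((i : ℤ) - k) (y ((i : ℤ) - k)))‖ₑ
      ≤ ENNReal.ofReal (c i f) * U (x, y)

/-- The vector, over the index `f`, of the increments at lag `k`. -/
noncomputable def incrVec (ν : Measure E) (w : ℕ → ι → (ℤ → E) → ℝ) (i k : ℕ) (x : ℤ → E) (f : ι) :
    ℝ :=
  incr ν ((i : ℤ) - k) (w i f) x

theorem IsShiftArray.dependsOn_incrVec {ν : Measure E} {n : ℕ} {M : ℝ} {Δ : ℕ → ℝ}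
    {c : ℕ → ι → ℝ} {w : ℕ → ι → (ℤ → E) → ℝ} (hw : IsShiftArray ν n M Δ c w) (i k : ℕ) :
    DependsOn (incrVec ν w i k) (Set.Ici ((i : ℤ) - k)) := fun _ _ hxy => by
  funext f
  exact dependsOn_incr ν (hw.dependsOn i f) _ fun j hj => hxy j hj.1

variable {ν : Measure E} [IsProbabilityMeasure ν] {n : ℕ} {M : ℝ} {Δ : ℕ → ℝ} {c : ℕ → ι → ℝ}
  {w : ℕ → ι → (ℤ → E) → ℝ}

/-- Averaging the coupling variable `U` does not increase its `L²` norm. -/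
theorem eLpNorm_le_of_enorm_le_avgPair {F : Type*} [NormedAddCommGroup F] {g : (ℤ → E) → F}
    {m : ℤ} {U : (ℤ → E) × (ℤ → E) → ℝ≥0∞} (hU : Measurable U) {δ : ℝ}
    (hU2 : ∫⁻ z, U z ^ 2 ∂((iidLaw ℤ ν).prod (iidLaw ℤ ν)) ≤ ENNReal.ofReal δ ^ 2) {C : ℝ}
    (hC : 0 ≤ C) (hb : ∀ x, ‖g x‖ₑ ≤ ENNReal.ofReal C * avgPair ν m U x) :
    eLpNorm g 2 (iidLaw ℤ ν) ≤ ENNReal.ofReal (C * δ) := by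
  rw [eLpNorm_eq_lintegral_rpow_enorm_toReal (by norm_num) (by norm_num)]
  simp only [ENNReal.toReal_ofNat, ENNReal.rpow_ofNat]
  rw [one_div, ENNReal.rpow_inv_le_iff (by norm_num), ENNReal.rpow_ofNat]
  calc ∫⁻ x, ‖g x‖ₑ ^ 2 ∂(iidLaw ℤ ν)
      ≤ ∫⁻ x, ENNReal.ofReal C ^ 2 * avgPair ν m U x ^ 2 ∂(iidLaw ℤ ν) := by
        refine lintegral_mono fun x => ?_
        rw [← mul_pow]
        gcongr
        exact hb x
    _ = ENNReal.ofReal C ^ 2 * ∫⁻ x, avgPair ν m U x ^ 2 ∂(iidLaw ℤ ν) :=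
        lintegral_const_mul _ ((measurable_avgPair ν hU _).pow_const 2)
    _ ≤ ENNReal.ofReal C ^ 2 * ENNReal.ofReal δ ^ 2 := by
        gcongr
        exact (lintegral_avgPair_sq_le ν hU _).trans hU2
    _ = _ := by rw [← mul_pow, ENNReal.ofReal_mul hC]

namespace IsShiftArray

theorem measurable_incrVec (hw : IsShiftArray ν n M Δ c w) (i k : ℕ) :
    Measurable (incrVec ν w i k) :=
  measurable_pi_lambda _ fun f => measurable_incr ν (hw.measurable i f) _

theorem integral_incr_sq_le_coupling (hw : IsShiftArray ν n M Δ c w) (hΔ : ∀ k, 0 ≤ Δ k) {i k : ℕ}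
    (hi : i ∈ Finset.Icc 1 n) (hk : 1 ≤ k) (f : ι) :
    ∫ x, incr ν ((i : ℤ) - k) (w i f) x ^ 2 ∂(iidLaw ℤ ν) ≤ (c i f * Δ k) ^ 2 := by
  obtain ⟨U, hU, hU2, hUw⟩ := hw.coupling i hi k hk
  have hb := enorm_incr_le ν (hw.measurable i f) (hw.abs_le i f) hU (hUw f)
  have hm := measurable_incr ν (hw.measurable i f) ((i : ℤ) - k)
  have hLp : MemLp (incr ν ((i : ℤ) - k) (w i f)) 2 (iidLaw ℤ ν) :=
    memLp_two_of_norm_le hm.aestronglyMeasurable (abs_incr_le ν (hw.abs_le i f) _)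
  have h2 := (eLpNorm_two_le_ofReal_iff hLp (mul_nonneg (hw.nonneg i f) (hΔ k))).1 ?_
  · simpa only [Real.norm_eq_abs, sq_abs] using h2
  · exact eLpNorm_le_of_enorm_le_avgPair hU hU2 (hw.nonneg i f) hb

variable [Fintype ι]

theorem norm_incrVec_le (hw : IsShiftArray ν n M Δ c w) (hM : 0 ≤ M) (i k : ℕ) (x : ℤ → E) :
    ‖incrVec ν w i k x‖ ≤ 2 * M :=
  (pi_norm_le_iff_of_nonneg (by positivity)).2 fun f => abs_incr_le ν (hw.abs_le i f) _ x

/-- The maximum over the family obeys the same `L²` bound as a single increment, since the coupling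
variable is common to the whole family. -/
theorem eLpNorm_incrVec_le (hw : IsShiftArray ν n M Δ c w) {i k : ℕ}
    (hi : i ∈ Finset.Icc 1 n) (hk : 1 ≤ k) {C : ℝ} (hC : 0 ≤ C) (hcC : ∀ f, c i f ≤ C) :
    eLpNorm (incrVec ν w i k) 2 (iidLaw ℤ ν) ≤ ENNReal.ofReal (C * Δ k) := by
  obtain ⟨U, hU, hU2, hUw⟩ := hw.coupling i hi k hk
  have hb : ∀ x, ‖incrVec ν w i k x‖ₑ ≤ ENNReal.ofReal C * avgPair ν ((i : ℤ) - k) U x := by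
    intro x
    refine pi_enorm_le fun f => ?_
    refine (enorm_incr_le ν (hw.measurable i f) (hw.abs_le i f) hU (hUw f) x).trans ?_
    gcongr
    exact hcC f
  exact eLpNorm_le_of_enorm_le_avgPair hU hU2 hC hb

theorem memLp_incrVec (hw : IsShiftArray ν n M Δ c w) (hM : 0 ≤ M) (i k : ℕ) :
    MemLp (incrVec ν w i k) 2 (iidLaw ℤ ν) :=
  memLp_two_of_norm_le (hw.measurable_incrVec i k).aestronglyMeasurable (hw.norm_incrVec_le hM i k)

variable [Nonempty ι]

/-- For a fixed lag, the increments, taken in decreasing order of `i`, form a martingale difference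
sequence. -/
theorem integral_norm_sum_incrVec_le (hw : IsShiftArray ν n M Δ c w) (hM : 0 ≤ M)
    (hΔ : ∀ k, 0 ≤ Δ k) {k : ℕ} (hk : 1 ≤ k) {C : ℕ → ℝ} (hC : ∀ i, 0 ≤ C i)
    (hcC : ∀ i f, c i f ≤ C i) {S : ℝ} (hS : 0 ≤ S) (hCS : ∑ i ∈ Finset.Icc 1 n, C i ^ 2 ≤ S ^ 2)
    {H : ℝ} (hH : 1 ≤ H) (hHι : Real.log (Fintype.card ι) ≤ H) :
    ∫ x, ‖∑ i ∈ Finset.Icc 1 n, incrVec ν w i k x‖ ∂(iidLaw ℤ ν)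
      ≤ 4 * Real.sqrt H * (S * Δ k) := by
  -- time reversal: `d m` depends only on the innovations with index `≥ n - m - k`
  let d : ℕ → (ℤ → E) → ι → ℝ := fun m x => if m < n then incrVec ν w (n - m) k x else 0
  have hdlt : ∀ m, m < n → d m = incrVec ν w (n - m) k := fun m hm => by
    funext x; simp [d, hm]
  have hdge : ∀ m, ¬ m < n → d m = fun _ => 0 := fun m hm => by
    funext x; simp [d, hm]
  have hd : ∀ m, Measurable (d m) := fun m => by
    by_cases hm : m < n
    · rw [hdlt m hm]; exact hw.measurable_incrVec _ _
    · rw [hdge m hm]; exact measurable_const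
  have hdC : ∀ m x, ‖d m x‖ ≤ 2 * M := fun m x => by
    by_cases hm : m < n
    · rw [hdlt m hm]; exact hw.norm_incrVec_le hM _ _ x
    · rw [hdge m hm]; simpa using hM
  have hdeq : ∀ x, ∑ i ∈ Finset.Icc 1 n, incrVec ν w i k x = ∑ m ∈ Finset.range n, d m x := by
    intro x
    rw [sum_Icc_one_eq_sum_range_sub]
    refine Finset.sum_congr rfl fun m hm => ?_
    rw [hdlt m (Finset.mem_range.1 hm)]
  simp only [hdeq]
  refine integral_norm_sum_le (iidLaw ℤ ν) hd hdC ?_ n hH hHι (mul_nonneg hS (hΔ k)) ?_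
  · intro m f h hh hb
    by_cases hm : m < n
    · rw [hdlt m hm]
      refine integral_incr_mul ν (hw.measurable _ f) (hw.abs_le _ f)
        (hh.comp (Finset.measurable_fun_sum _ fun j _ => hd j)) (fun x => hb _) fun x y hxy => ?_
      refine congrArg h (Finset.sum_congr (M := ι → ℝ) rfl fun j hj => ?_)
      have hjm := Finset.mem_range.1 hj
      rw [hdlt j (by omega)]
      refine hw.dependsOn_incrVec _ _ fun a ha => hxy a ?_
      simp only [Set.mem_Ici] at ha ⊢
      omega
    · rw [hdge m hm]; simp
  · rw [mul_pow]
    refine le_trans ?_ (mul_le_mul_of_nonneg_right hCS (sq_nonneg _))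
    rw [sum_Icc_one_eq_sum_range_sub, Finset.sum_mul]
    refine Finset.sum_le_sum fun m hm => ?_
    have hm' := Finset.mem_range.1 hm
    rw [hdlt m hm', ← mul_pow]
    exact (eLpNorm_two_le_ofReal_iff (hw.memLp_incrVec hM _ _) (mul_nonneg (hC _) (hΔ k))).1
      (hw.eLpNorm_incrVec_le (by simp only [Finset.mem_Icc]; omega) hk (hC _) (hcC _))

end IsShiftArray

end ShiftArray

theorem sum_Ico_succ_le_betaTail {Δ : ℕ → ℝ} (hΔ : ∀ k, 0 ≤ Δ k) (hanti : Antitone Δ)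
    (hsum : Summable Δ) (q K : ℕ) :
    ∑ k ∈ Finset.Ico q K, Δ (k + 1) ≤ betaTail Δ q := by
  calc ∑ k ∈ Finset.Ico q K, Δ (k + 1) ≤ ∑ k ∈ Finset.Ico q K, Δ k :=
        Finset.sum_le_sum fun k _ => hanti (Nat.le_succ k)
    _ = ∑ j ∈ Finset.range (K - q), Δ (q + j) := Finset.sum_Ico_eq_sum_range _ _ _
    _ ≤ betaTail Δ q := by
        refine Summable.sum_le_tsum _ (fun j _ => hΔ _) ?_
        simpa only [add_comm] using (summable_nat_add_iff q).2 hsum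

section Remainder

variable {E ι : Type*} [MeasurableSpace E]

/-- Telescoping over the lags `q + 1, …, K`. -/
theorem avgPast_sub_avgPast (ν : Measure E) (v : (ℤ → E) → ℝ) (a : ℤ) {q K : ℕ} (hqK : q ≤ K)
    (x : ℤ → E) : avgPast ν (a - K) v x - avgPast ν (a - q) v x
      = ∑ k ∈ Finset.Ico q K, incr ν (a - (k + 1 : ℕ)) v x := by
  induction K, hqK using Nat.le_induction with
  | base => simp
  | succ K hK ih =>
    rw [Finset.sum_Ico_succ_top hK, ← ih, incr,
      show a - ((K + 1 : ℕ) : ℤ) + 1 = a - K by push_cast; ring]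
    ring

/-- The vector, over `f`, of the differences between `w i f` and its average over the innovations
with index `< i - q`. -/
noncomputable def remVec (ν : Measure E) (w : ℕ → ι → (ℤ → E) → ℝ) (q i : ℕ) (x : ℤ → E) (f : ι) :
    ℝ :=
  w i f x - avgPast ν ((i : ℤ) - q) (w i f) x

variable {ν : Measure E} [IsProbabilityMeasure ν] {n : ℕ} {M : ℝ} {Δ : ℕ → ℝ} {c : ℕ → ι → ℝ}
  {w : ℕ → ι → (ℤ → E) → ℝ}

namespace IsShiftArray

theorem measurable_remVec (hw : IsShiftArray ν n M Δ c w) (q i : ℕ) :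
    Measurable (remVec ν w q i) :=
  measurable_pi_lambda _ fun f =>
    (hw.measurable i f).sub (measurable_avgPast ν (hw.measurable i f) _)

variable [Fintype ι]

theorem norm_remVec_le (hw : IsShiftArray ν n M Δ c w) (hM : 0 ≤ M) (q i : ℕ) (x : ℤ → E) :
    ‖remVec ν w q i x‖ ≤ 2 * M :=
  (pi_norm_le_iff_of_nonneg (by positivity)).2 fun f => by
    have h1 := hw.abs_le i f x
    have h2 := abs_avgPast_le ν (hw.abs_le i f) ((i : ℤ) - q) x
    have := abs_sub (w i f x) (avgPast ν ((i : ℤ) - q) (w i f) x)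
    rw [Real.norm_eq_abs, remVec]
    linarith

theorem norm_sum_incrVec_le (hw : IsShiftArray ν n M Δ c w) (hM : 0 ≤ M) {q K : ℕ}
    (hqK : q ≤ K) (i : ℕ) (x : ℤ → E) :
    ‖∑ k ∈ Finset.Ico q K, incrVec ν w i (k + 1) x‖ ≤ 2 * M :=
  (pi_norm_le_iff_of_nonneg (by positivity)).2 fun f => by
    have h1 := abs_avgPast_le ν (hw.abs_le i f) ((i : ℤ) - K) x
    have h2 := abs_avgPast_le ν (hw.abs_le i f) ((i : ℤ) - q) x
    have := abs_sub (avgPast ν ((i : ℤ) - K) (w i f) x) (avgPast ν ((i : ℤ) - q) (w i f) x)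
    simp only [Finset.sum_apply, incrVec]
    rw [← avgPast_sub_avgPast ν (w i f) i hqK, Real.norm_eq_abs]
    linarith

theorem tendsto_sum_incrVec (hw : IsShiftArray ν n M Δ c w) (q i : ℕ) :
    ∀ᵐ x ∂(iidLaw ℤ ν), Filter.Tendsto
      (fun K : ℕ => ∑ k ∈ Finset.Ico q K, incrVec ν w i (k + 1) x) Filter.atTop
      (nhds (remVec ν w q i x)) := by
  have h : ∀ f, ∀ᵐ x ∂(iidLaw ℤ ν), Filter.Tendsto
      (fun K : ℕ => avgPast ν ((i : ℤ) - K) (w i f) x) Filter.atTop (nhds (w i f x)) :=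
    fun f => tendsto_avgPast ν (hw.measurable i f) (hw.abs_le i f) i
  filter_upwards [ae_all_iff.2 h] with x hx
  refine tendsto_pi_nhds.2 fun f => ?_
  refine ((hx f).sub_const (avgPast ν ((i : ℤ) - q) (w i f) x)).congr' ?_
  filter_upwards [Filter.eventually_ge_atTop q] with K hK
  simp only [Finset.sum_apply, incrVec]
  exact avgPast_sub_avgPast ν (w i f) i hK x

/-- The lags beyond `q` contribute to the sum over `i`, uniformly in `f`, a term of order
`√H S β(q)`: each lag is a martingale. -/
theorem integral_norm_sum_remVec_le [Nonempty ι] (hw : IsShiftArray ν n M Δ c w) (hM : 0 ≤ M)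
    (hΔ : ∀ k, 0 ≤ Δ k) (hanti : Antitone Δ) (hsum : Summable Δ) (q : ℕ)
    {C : ℕ → ℝ} (hC : ∀ i, 0 ≤ C i)
    (hcC : ∀ i f, c i f ≤ C i) {S : ℝ} (hS : 0 ≤ S) (hCS : ∑ i ∈ Finset.Icc 1 n, C i ^ 2 ≤ S ^ 2)
    {H : ℝ} (hH : 1 ≤ H) (hHι : Real.log (Fintype.card ι) ≤ H) :
    ∫ x, ‖∑ i ∈ Finset.Icc 1 n, remVec ν w q i x‖ ∂(iidLaw ℤ ν)
      ≤ 4 * Real.sqrt H * (S * betaTail Δ q) := by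
  have hmeas : ∀ K, Measurable fun x => ∑ i ∈ Finset.Icc 1 n,
      ∑ k ∈ Finset.Ico q K, incrVec ν w i (k + 1) x := fun K =>
    Finset.measurable_fun_sum _ fun i _ => Finset.measurable_fun_sum _ fun k _ =>
      hw.measurable_incrVec i (k + 1)
  have hlim := tendsto_integral_of_dominated_convergence (μ := iidLaw ℤ ν)
    (F := fun K x => ‖∑ i ∈ Finset.Icc 1 n, ∑ k ∈ Finset.Ico q K, incrVec ν w i (k + 1) x‖)
    (f := fun x => ‖∑ i ∈ Finset.Icc 1 n, remVec ν w q i x‖)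
    (fun _ => n * (2 * M)) (fun K => (hmeas K).norm.aestronglyMeasurable) (integrable_const _)
    (fun K => ae_of_all _ fun x => by
      rw [norm_norm]
      refine (norm_sum_le _ _).trans ?_
      calc _ ≤ ∑ i ∈ Finset.Icc 1 n, 2 * M := by
            refine Finset.sum_le_sum fun i _ => ?_
            rcases le_total q K with h | h
            · exact hw.norm_sum_incrVec_le hM h i x
            · rw [Finset.Ico_eq_empty_of_le h]; simpa using hM
        _ = _ := by simp)
    (by
      filter_upwards [ae_all_iff.2 fun i => hw.tendsto_sum_incrVec q i] with x hx
      exact (tendsto_finsetSum _ fun i _ => hx i).norm)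
  refine le_of_tendsto hlim ?_
  filter_upwards [Filter.eventually_ge_atTop q] with K hK
  have hint : ∀ k, Integrable (fun x => ‖∑ i ∈ Finset.Icc 1 n, incrVec ν w i k x‖)
      (iidLaw ℤ ν) := fun k => by
    have hm : Measurable fun x => ∑ i ∈ Finset.Icc 1 n, incrVec ν w i k x :=
      Finset.measurable_fun_sum _ fun i _ => hw.measurable_incrVec i k
    refine integrable_of_abs_le hm.norm (C := n * (2 * M)) fun x => ?_
    rw [abs_of_nonneg (norm_nonneg _)]
    refine (norm_sum_le _ _).trans ?_
    calc _ ≤ ∑ i ∈ Finset.Icc 1 n, 2 * M :=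
          Finset.sum_le_sum fun i _ => hw.norm_incrVec_le hM i k x
      _ = _ := by simp
  calc ∫ x, ‖∑ i ∈ Finset.Icc 1 n, ∑ k ∈ Finset.Ico q K, incrVec ν w i (k + 1) x‖ ∂(iidLaw ℤ ν)
      ≤ ∫ x, ∑ k ∈ Finset.Ico q K, ‖∑ i ∈ Finset.Icc 1 n, incrVec ν w i (k + 1) x‖
          ∂(iidLaw ℤ ν) := by
        refine integral_mono_of_nonneg (ae_of_all _ fun x => norm_nonneg _)
          (integrable_finsetSum _ fun k _ => hint (k + 1)) (ae_of_all _ fun x => ?_)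
        simp only
        rw [Finset.sum_comm]
        exact norm_sum_le _ _
    _ = ∑ k ∈ Finset.Ico q K, ∫ x, ‖∑ i ∈ Finset.Icc 1 n, incrVec ν w i (k + 1) x‖
          ∂(iidLaw ℤ ν) := integral_finsetSum _ fun k _ => hint (k + 1)
    _ ≤ ∑ k ∈ Finset.Ico q K, 4 * Real.sqrt H * (S * Δ (k + 1)) :=
        Finset.sum_le_sum fun k _ =>
          hw.integral_norm_sum_incrVec_le hM hΔ (by omega) hC hcC hS hCS hH hHι
    _ = 4 * Real.sqrt H * (S * ∑ k ∈ Finset.Ico q K, Δ (k + 1)) := by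
        rw [Finset.mul_sum, Finset.mul_sum]
    _ ≤ _ := by
        have := sum_Ico_succ_le_betaTail hΔ hanti hsum q K
        gcongr

/-- The `L²` norm of the remainder is bounded by the triangle inequality over the lags. -/
theorem integral_norm_remVec_sq_le (hw : IsShiftArray ν n M Δ c w) (hM : 0 ≤ M)
    (hΔ : ∀ k, 0 ≤ Δ k) (hanti : Antitone Δ) (hsum : Summable Δ) (q : ℕ) {i : ℕ}
    (hi : i ∈ Finset.Icc 1 n) {C : ℝ} (hC : 0 ≤ C) (hcC : ∀ f, c i f ≤ C) :
    ∫ x, ‖remVec ν w q i x‖ ^ 2 ∂(iidLaw ℤ ν) ≤ (C * betaTail Δ q) ^ 2 := by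
  have hmeas : ∀ K, Measurable fun x => ∑ k ∈ Finset.Ico q K, incrVec ν w i (k + 1) x := fun K =>
    Finset.measurable_fun_sum _ fun k _ => hw.measurable_incrVec i (k + 1)
  have hbd : ∀ K x, ‖∑ k ∈ Finset.Ico q K, incrVec ν w i (k + 1) x‖ ≤ 2 * M := fun K x => by
    rcases le_total q K with h | h
    · exact hw.norm_sum_incrVec_le hM h i x
    · rw [Finset.Ico_eq_empty_of_le h]; simpa using hM
  have hlim := tendsto_integral_of_dominated_convergence (μ := iidLaw ℤ ν)
    (F := fun K x => ‖∑ k ∈ Finset.Ico q K, incrVec ν w i (k + 1) x‖ ^ 2)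
    (f := fun x => ‖remVec ν w q i x‖ ^ 2)
    (fun _ => (2 * M) ^ 2) (fun K => ((hmeas K).norm.pow_const 2).aestronglyMeasurable)
    (integrable_const _)
    (fun K => ae_of_all _ fun x => by
      rw [norm_pow, norm_norm]
      exact pow_le_pow_left₀ (norm_nonneg _) (hbd K x) 2)
    (by
      filter_upwards [hw.tendsto_sum_incrVec q i] with x hx
      exact hx.norm.pow 2)
  refine le_of_tendsto hlim ?_
  filter_upwards [Filter.eventually_ge_atTop q] with K hK
  have hb0 : 0 ≤ betaTail Δ q := tsum_nonneg fun j => hΔ _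
  refine (eLpNorm_two_le_ofReal_iff (memLp_two_of_norm_le (hmeas K).aestronglyMeasurable (hbd K))
    (mul_nonneg hC hb0)).1 ?_
  have he : (fun x => ∑ k ∈ Finset.Ico q K, incrVec ν w i (k + 1) x)
      = ∑ k ∈ Finset.Ico q K, incrVec ν w i (k + 1) := by
    funext x; simp
  rw [he]
  calc _ ≤ ∑ k ∈ Finset.Ico q K, eLpNorm (incrVec ν w i (k + 1)) 2 (iidLaw ℤ ν) :=
        eLpNorm_sum_le (fun k _ => (hw.measurable_incrVec i (k + 1)).aestronglyMeasurable)
          (by norm_num)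
    _ ≤ ∑ k ∈ Finset.Ico q K, ENNReal.ofReal (C * Δ (k + 1)) :=
        Finset.sum_le_sum fun k _ => hw.eLpNorm_incrVec_le hi (by omega) hC hcC
    _ = ENNReal.ofReal (C * ∑ k ∈ Finset.Ico q K, Δ (k + 1)) := by
        rw [Finset.mul_sum, ENNReal.ofReal_sum_of_nonneg fun k _ => mul_nonneg hC (hΔ _)]
    _ ≤ _ := ENNReal.ofReal_le_ofReal
        (mul_le_mul_of_nonneg_left (sum_Ico_succ_le_betaTail hΔ hanti hsum q K) hC)

end IsShiftArray

end Remainder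

/-! ### Exponential bounds for sums of functions of finitely many innovations -/

section Blocks

/-- The `b`-th block of length `q` of the indices `1, …, n`, counted from `b = 0`. -/
def block (n q b : ℕ) : Finset ℕ := (Finset.Icc 1 n).filter fun i => (i - 1) / q = b

theorem mem_block_bounds {n q b i : ℕ} (hq : 1 ≤ q) (hi : i ∈ block n q b) :
    b * q + 1 ≤ i ∧ i ≤ b * q + q := by
  simp only [block, Finset.mem_filter, Finset.mem_Icc] at hi
  obtain ⟨⟨h1, -⟩, rfl⟩ := hi
  have h2 := Nat.div_mul_le_self (i - 1) q
  have h3 := Nat.lt_div_mul_add (a := i - 1) (b := q) (by omega)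
  omega

theorem card_block_le {n q : ℕ} (hq : 1 ≤ q) (b : ℕ) : (block n q b).card ≤ q := by
  have h : block n q b ⊆ Finset.Icc (b * q + 1) (b * q + q) := fun i hi =>
    Finset.mem_Icc.2 (mem_block_bounds hq hi)
  refine (Finset.card_le_card h).trans ?_
  rw [Nat.card_Icc]
  omega

theorem sum_block {A : Type*} [AddCommMonoid A] (n q : ℕ) (g : ℕ → A) :
    ∑ b ∈ Finset.range n, ∑ i ∈ block n q b, g i = ∑ i ∈ Finset.Icc 1 n, g i := by
  refine Finset.sum_fiberwise_of_maps_to (fun i hi => ?_) g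
  simp only [Finset.mem_Icc] at hi
  rw [Finset.mem_range]
  exact (Nat.div_le_self _ _).trans_lt (by omega)

variable {E : Type*} [MeasurableSpace E] (ν : Measure E) [IsProbabilityMeasure ν]

theorem abs_sum_block_le {α : Type*} {n q : ℕ} (hq : 1 ≤ q) {v : ℕ → α → ℝ} {C : ℝ} (hC : 0 ≤ C)
    (hv : ∀ i x, |v i x| ≤ C) (b : ℕ) (x : α) : |∑ i ∈ block n q b, v i x| ≤ q * C := by
  calc |∑ i ∈ block n q b, v i x| ≤ ∑ i ∈ block n q b, |v i x| := Finset.abs_sum_le_sum_abs _ _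
    _ ≤ (block n q b).card • C := Finset.sum_le_card_nsmul _ _ _ fun i _ => hv i x
    _ ≤ q * C := by
        rw [nsmul_eq_mul]
        have : ((block n q b).card : ℝ) ≤ q := by exact_mod_cast card_block_le hq b
        gcongr

theorem integrable_exp_of_abs_le {α : Type*} [MeasurableSpace α] {μ : Measure α}
    [IsFiniteMeasure μ] {f : α → ℝ} (hf : Measurable f) {C : ℝ} (hC : ∀ x, |f x| ≤ C) :
    Integrable (fun x => Real.exp (f x)) μ :=
  integrable_of_abs_le (Real.measurable_exp.comp hf) (C := Real.exp C) fun x => by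
    rw [abs_of_pos (Real.exp_pos _)]
    exact Real.exp_le_exp.2 (le_of_abs_le (hC x))

/-- Blocks whose indices have the same parity depend on disjoint sets of innovations, so that
their exponential moments multiply. -/
theorem integral_exp_sum_block_eq {n q : ℕ} (hq : 1 ≤ q) {v : ℕ → (ℤ → E) → ℝ}
    (hv : ∀ i, Measurable (v i))
    (hdep : ∀ i, DependsOn (v i) (Set.Ico ((i : ℤ) - q) i)) (l : ℝ) (s : Finset ℕ)
    (hs : ∀ b ∈ s, ∀ b' ∈ s, b < b' → b + 2 ≤ b') :
    ∫ x, Real.exp (l * ∑ b ∈ s, ∑ i ∈ block n q b, v i x) ∂(iidLaw ℤ ν)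
      = ∏ b ∈ s, ∫ x, Real.exp (l * ∑ i ∈ block n q b, v i x) ∂(iidLaw ℤ ν) := by
  have hprod : ∀ x, Real.exp (l * ∑ b ∈ s, ∑ i ∈ block n q b, v i x)
      = ∏ b ∈ s, Real.exp (l * ∑ i ∈ block n q b, v i x) := fun x => by
    rw [Finset.mul_sum, Real.exp_sum]
  simp only [hprod]
  refine integral_prod_of_dependsOn_disjoint ν
    (g := fun b x => Real.exp (l * ∑ i ∈ block n q b, v i x))
    (S := fun b : ℕ => Set.Ico ((b : ℤ) * q + 1 - q) ((b : ℤ) * q + q)) s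
    (fun b _ => Real.measurable_exp.comp
      ((Finset.measurable_fun_sum _ fun i _ => hv i).const_mul l)) (fun b _ => ?_) ?_
  · intro x y hxy
    have h : ∑ i ∈ block n q b, v i x = ∑ i ∈ block n q b, v i y :=
      Finset.sum_congr rfl fun i hi => hdep i fun j hj => hxy j ?_
    · simp only [h]
    · have h1 := mem_block_bounds hq hi
      have h2 : ((b * q + 1 : ℕ) : ℤ) ≤ i := by exact_mod_cast h1.1
      have h3 : (i : ℤ) ≤ ((b * q + q : ℕ) : ℤ) := by exact_mod_cast h1.2
      push_cast at h2 h3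
      simp only [Set.mem_Ico] at hj ⊢
      omega
  · have key : ∀ b ∈ s, ∀ b' ∈ s, b < b' → Disjoint
        (Set.Ico ((b : ℤ) * q + 1 - q) ((b : ℤ) * q + q))
        (Set.Ico ((b' : ℤ) * q + 1 - q) ((b' : ℤ) * q + q)) := by
      intro b hb b' hb' hlt
      have h1 : ((b : ℤ) + 2) * q ≤ b' * q :=
        mul_le_mul_of_nonneg_right (by exact_mod_cast hs b hb b' hb' hlt) (by positivity)
      rw [Set.Ico_disjoint_Ico]
      refine (min_le_left _ _).trans (le_trans ?_ (le_max_right _ _))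
      linarith
    intro b hb b' hb' hne
    rcases lt_or_gt_of_ne hne with h | h
    · exact key b hb b' hb' h
    · exact (key b' hb' b hb h).symm

/-- The even and the odd blocks are separated by `exp (a + b) ≤ (exp (2 a) + exp (2 b)) / 2`; this is
where the factor `2` in the assumption on the blocks comes from. -/
theorem integral_exp_sum_le_of_block {n q : ℕ} (hq : 1 ≤ q) {v : ℕ → (ℤ → E) → ℝ}
    (hv : ∀ i, Measurable (v i)) {C : ℝ} (hC : 0 ≤ C) (hvC : ∀ i x, |v i x| ≤ C)
    (hdep : ∀ i, DependsOn (v i) (Set.Ico ((i : ℤ) - q) i)) (l : ℝ) {κ : ℕ → ℝ}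
    (hκ : ∀ b, 0 ≤ κ b)
    (hexp : ∀ b, ∫ x, Real.exp (2 * l * ∑ i ∈ block n q b, v i x) ∂(iidLaw ℤ ν)
      ≤ Real.exp (κ b)) :
    ∫ x, Real.exp (l * ∑ i ∈ Finset.Icc 1 n, v i x) ∂(iidLaw ℤ ν)
      ≤ Real.exp (∑ b ∈ Finset.range n, κ b) := by
  have half : ∀ p : ℕ → Prop, ∀ [DecidablePred p],
      (∀ b b', p b → p b' → b < b' → b + 2 ≤ b') →
      ∫ x, Real.exp (2 * l * ∑ b ∈ (Finset.range n).filter p, ∑ i ∈ block n q b, v i x)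
        ∂(iidLaw ℤ ν) ≤ Real.exp (∑ b ∈ Finset.range n, κ b) := by
    intro p _ hp
    rw [integral_exp_sum_block_eq ν hq hv hdep _ _ fun b hb b' hb' =>
      hp b b' (Finset.mem_filter.1 hb).2 (Finset.mem_filter.1 hb').2]
    calc _ ≤ ∏ b ∈ (Finset.range n).filter p, Real.exp (κ b) :=
          Finset.prod_le_prod (fun b _ => integral_nonneg fun x => (Real.exp_pos _).le)
            fun b _ => hexp b
      _ = Real.exp (∑ b ∈ (Finset.range n).filter p, κ b) := (Real.exp_sum _ _).symm
      _ ≤ _ := Real.exp_le_exp.2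
          (Finset.sum_le_sum_of_subset_of_nonneg (Finset.filter_subset _ _) fun b _ _ => hκ b)
  have he := half (fun b => b % 2 = 0) fun b b' h h' hlt => by omega
  have ho := half (fun b => ¬ b % 2 = 0) fun b b' h h' hlt => by omega
  have hmeas : ∀ s : Finset ℕ, Measurable fun x => ∑ b ∈ s, ∑ i ∈ block n q b, v i x := fun s =>
    Finset.measurable_fun_sum _ fun b _ => Finset.measurable_fun_sum _ fun i _ => hv i
  have hint : ∀ s : Finset ℕ, Integrable
      (fun x => Real.exp (2 * l * ∑ b ∈ s, ∑ i ∈ block n q b, v i x)) (iidLaw ℤ ν) := by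
    intro s
    refine integrable_exp_of_abs_le ((hmeas s).const_mul _) (C := |2 * l| * (s.card * (q * C)))
      fun x => ?_
    rw [abs_mul]
    refine mul_le_mul_of_nonneg_left ?_ (abs_nonneg _)
    calc _ ≤ ∑ b ∈ s, |∑ i ∈ block n q b, v i x| := Finset.abs_sum_le_sum_abs _ _
      _ ≤ s.card • (q * C) := Finset.sum_le_card_nsmul _ _ _ fun b _ =>
          abs_sum_block_le hq hC hvC b x
      _ = _ := nsmul_eq_mul _ _
  calc ∫ x, Real.exp (l * ∑ i ∈ Finset.Icc 1 n, v i x) ∂(iidLaw ℤ ν)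
      ≤ ∫ x, (2⁻¹ * Real.exp (2 * l * ∑ b ∈ (Finset.range n).filter (fun b => b % 2 = 0),
            ∑ i ∈ block n q b, v i x)
          + 2⁻¹ * Real.exp (2 * l * ∑ b ∈ (Finset.range n).filter (fun b => ¬ b % 2 = 0),
            ∑ i ∈ block n q b, v i x)) ∂(iidLaw ℤ ν) := by
        refine integral_mono_of_nonneg (ae_of_all _ fun x => (Real.exp_pos _).le)
          (((hint _).const_mul _).add ((hint _).const_mul _)) (ae_of_all _ fun x => ?_)
        simp only
        rw [← sum_block n q, ← Finset.sum_filter_add_sum_filter_not (Finset.range n)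
          (fun b => b % 2 = 0)]
        set A := ∑ b ∈ (Finset.range n).filter (fun b => b % 2 = 0), ∑ i ∈ block n q b, v i x
        set B := ∑ b ∈ (Finset.range n).filter (fun b => ¬ b % 2 = 0), ∑ i ∈ block n q b, v i x
        have h1 : Real.exp (2 * l * A) = Real.exp (l * A) ^ 2 := by
          rw [← Real.exp_nat_mul]; congr 1; push_cast; ring
        have h2 : Real.exp (2 * l * B) = Real.exp (l * B) ^ 2 := by
          rw [← Real.exp_nat_mul]; congr 1; push_cast; ring
        rw [h1, h2, mul_add, Real.exp_add]
        nlinarith [sq_nonneg (Real.exp (l * A) - Real.exp (l * B))]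
    _ ≤ _ := by
        rw [integral_add ((hint _).const_mul _) ((hint _).const_mul _), integral_const_mul,
          integral_const_mul]
        linarith

/-- A Bernstein bound for a bounded centred random variable. -/
theorem integral_exp_le_of_centered {α : Type*} [MeasurableSpace α] {μ : Measure α}
    [IsProbabilityMeasure μ] {T : α → ℝ} (hT : Measurable T) {l : ℝ} (hl : ∀ x, |l * T x| ≤ 1)
    (h0 : ∫ x, l * T x ∂μ = 0) :
    ∫ x, Real.exp (l * T x) ∂μ ≤ Real.exp (l ^ 2 * ∫ x, T x ^ 2 ∂μ) := by
  have i1 : Integrable (fun x => l * T x) μ := integrable_of_abs_le (hT.const_mul l) hl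
  have i2 : Integrable (fun x => (l * T x) ^ 2) μ :=
    integrable_of_abs_le ((hT.const_mul l).pow_const 2) (C := 1 * 1) fun x => by
      rw [sq]; exact abs_mul_le_mul (hl x) (hl x)
  calc ∫ x, Real.exp (l * T x) ∂μ ≤ ∫ x, (1 + l * T x + (l * T x) ^ 2) ∂μ := by
        refine integral_mono (integrable_exp_of_abs_le (hT.const_mul l) hl)
          (((integrable_const 1).add i1).add i2) fun x => ?_
        have := (abs_le.1 (Real.abs_exp_sub_one_sub_id_le (hl x))).2
        simp only
        linarith
    _ = 1 + l ^ 2 * ∫ x, T x ^ 2 ∂μ := by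
        rw [integral_add (f := fun x => 1 + l * T x) ((integrable_const 1).add i1) i2,
          integral_add (integrable_const 1) i1, h0]
        simp [mul_pow, integral_const_mul]
    _ ≤ _ := by linarith [Real.add_one_le_exp (l ^ 2 * ∫ x, T x ^ 2 ∂μ)]

/-- A Chernoff bound with the mean in the exponent, for a random variable with values in `[0, 1]`. -/
theorem integral_exp_le_of_nonneg {α : Type*} [MeasurableSpace α] {μ : Measure α}
    [IsProbabilityMeasure μ] {T : α → ℝ} (hT : Measurable T) (h0 : ∀ x, 0 ≤ T x)
    (h1 : ∀ x, T x ≤ 1) : ∫ x, Real.exp (T x) ∂μ ≤ Real.exp (2 * ∫ x, T x ∂μ) := by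
  have hb : ∀ x, |T x| ≤ 1 := fun x => by rw [abs_of_nonneg (h0 x)]; exact h1 x
  have i1 : Integrable T μ := integrable_of_abs_le hT hb
  calc ∫ x, Real.exp (T x) ∂μ ≤ ∫ x, (1 + 2 * T x) ∂μ := by
        refine integral_mono (integrable_exp_of_abs_le hT hb)
          ((integrable_const 1).add (i1.const_mul 2)) fun x => ?_
        have := (abs_le.1 (Real.abs_exp_sub_one_sub_id_le (hb x))).2
        simp only
        nlinarith [h0 x, h1 x]
    _ = 1 + 2 * ∫ x, T x ∂μ := by
        rw [integral_add (integrable_const 1) (i1.const_mul 2), integral_const_mul]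
        simp
    _ ≤ _ := by linarith [Real.add_one_le_exp (2 * ∫ x, T x ∂μ)]

end Blocks

section Exponential

variable {E ι : Type*} [MeasurableSpace E] {ν : Measure E} [IsProbabilityMeasure ν] {n : ℕ} {M : ℝ}
  {Δ : ℕ → ℝ} {c : ℕ → ι → ℝ} {w : ℕ → ι → (ℤ → E) → ℝ}

namespace IsShiftArray

/-- For a fixed lag the increments are orthogonal. -/
theorem integral_sum_incr_sq_le (hw : IsShiftArray ν n M Δ c w) (k : ℕ) (f : ι) (B : Finset ℕ) :
    ∫ x, (∑ i ∈ B, incr ν ((i : ℤ) - k) (w i f) x) ^ 2 ∂(iidLaw ℤ ν)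
      ≤ ∑ i ∈ B, ∫ x, incr ν ((i : ℤ) - k) (w i f) x ^ 2 ∂(iidLaw ℤ ν) := by
  have hm : ∀ i : ℕ, Measurable (incr ν ((i : ℤ) - k) (w i f)) := fun i =>
    measurable_incr ν (hw.measurable i f) _
  have hb : ∀ (i : ℕ) x, |incr ν ((i : ℤ) - k) (w i f) x| ≤ 2 * M := fun i x =>
    abs_incr_le ν (hw.abs_le i f) _ x
  induction B using Finset.induction_on_min with
  | empty => simp
  | insert a s has ih =>
    have ha : a ∉ s := fun h => (has a h).false
    have hSm : Measurable fun x => ∑ i ∈ s, incr ν ((i : ℤ) - k) (w i f) x :=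
      Finset.measurable_fun_sum _ fun i _ => hm i
    have hSb : ∀ x, |∑ i ∈ s, incr ν ((i : ℤ) - k) (w i f) x| ≤ s.card • (2 * M) := fun x =>
      (Finset.abs_sum_le_sum_abs _ _).trans (Finset.sum_le_card_nsmul _ _ _ fun i _ => hb i x)
    have hz := integral_incr_mul ν (hw.measurable a f) (hw.abs_le a f) hSm hSb
      (m := (a : ℤ) - k) (dependsOn_finsetSum s fun i hi =>
        (dependsOn_incr ν (hw.dependsOn i f) _).mono fun j hj => by
          have := has i hi
          simp only [Set.mem_Ico, Set.mem_Ici] at hj ⊢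
          omega)
    have i1 : Integrable (fun x => incr ν ((a : ℤ) - k) (w a f) x ^ 2) (iidLaw ℤ ν) :=
      integrable_of_abs_le ((hm a).pow_const 2) fun x => by
        rw [sq]; exact abs_mul_le_mul (hb a x) (hb a x)
    have i2 : Integrable (fun x => incr ν ((a : ℤ) - k) (w a f) x *
        ∑ i ∈ s, incr ν ((i : ℤ) - k) (w i f) x) (iidLaw ℤ ν) :=
      integrable_of_abs_le ((hm a).mul hSm) fun x => abs_mul_le_mul (hb a x) (hSb x)
    have i3 : Integrable (fun x => (∑ i ∈ s, incr ν ((i : ℤ) - k) (w i f) x) ^ 2)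
        (iidLaw ℤ ν) := integrable_of_abs_le (hSm.pow_const 2) fun x => by
        rw [sq]; exact abs_mul_le_mul (hSb x) (hSb x)
    simp only [Finset.sum_insert ha]
    have hsq : ∀ x, (incr ν ((a : ℤ) - k) (w a f) x + ∑ i ∈ s, incr ν ((i : ℤ) - k) (w i f) x) ^ 2
        = incr ν ((a : ℤ) - k) (w a f) x ^ 2 + 2 * (incr ν ((a : ℤ) - k) (w a f) x *
          ∑ i ∈ s, incr ν ((i : ℤ) - k) (w i f) x)
          + (∑ i ∈ s, incr ν ((i : ℤ) - k) (w i f) x) ^ 2 := fun x => by ring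
    simp only [hsq]
    rw [integral_add (f := fun x => incr ν ((a : ℤ) - k) (w a f) x ^ 2 +
      2 * (incr ν ((a : ℤ) - k) (w a f) x * ∑ i ∈ s, incr ν ((i : ℤ) - k) (w i f) x))
      (i1.add (i2.const_mul 2)) i3, integral_add i1 (i2.const_mul 2), integral_const_mul, hz]
    linarith

/-- The exponential inequality for the lags up to `q`.  The variance of the block sums is bounded
lag by lag, which gives `(∑ α)²` in place of a bound that grows with the block length. -/
theorem integral_exp_sum_avgPast_le (hw : IsShiftArray ν n M Δ c w) (hM : 0 ≤ M) {q : ℕ}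
    (hq : 1 ≤ q) (f : ι) {α : ℕ → ℝ} (hα : ∀ k, 0 < α k)
    (hvar : ∀ k, ∑ i ∈ Finset.Icc 1 n, ∫ x, incr ν ((i : ℤ) - (k + 1 : ℕ)) (w i f) x ^ 2
      ∂(iidLaw ℤ ν) ≤ n * α k ^ 2) {l : ℝ} (hl : |l| * (4 * q * M) ≤ 1) :
    ∫ x, Real.exp (l * ∑ i ∈ Finset.Icc 1 n,
        (avgPast ν ((i : ℤ) - q) (w i f) x - ∫ y, w i f y ∂(iidLaw ℤ ν))) ∂(iidLaw ℤ ν)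
      ≤ Real.exp (4 * l ^ 2 * (n * (∑ k ∈ Finset.range q, α k) ^ 2)) := by
  set v : ℕ → (ℤ → E) → ℝ := fun i x =>
    avgPast ν ((i : ℤ) - q) (w i f) x - ∫ y, w i f y ∂(iidLaw ℤ ν) with hv
  have hvm : ∀ i, Measurable (v i) := fun i =>
    (measurable_avgPast ν (hw.measurable i f) _).sub_const _
  have hvsum : ∀ i x, v i x = ∑ k ∈ Finset.range q, incr ν ((i : ℤ) - (k + 1 : ℕ)) (w i f) x := by
    intro i x
    rw [Finset.range_eq_Ico, ← avgPast_sub_avgPast ν (w i f) i (Nat.zero_le q),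
      avgPast_eq_integral ν (hw.dependsOn i f) (m := (i : ℤ) - (0 : ℕ)) (by simp)]
  have hvb : ∀ i x, |v i x| ≤ 2 * M := fun i x => by
    have h1 := abs_avgPast_le ν (hw.abs_le i f) ((i : ℤ) - q) x
    have h2 := abs_avgPast_le ν (hw.abs_le i f) (i : ℤ) x
    rw [avgPast_eq_integral ν (hw.dependsOn i f) le_rfl] at h2
    have := abs_sub (avgPast ν ((i : ℤ) - q) (w i f) x) (∫ y, w i f y ∂(iidLaw ℤ ν))
    simp only [hv]
    linarith
  have hv0 : ∀ i, ∫ x, v i x ∂(iidLaw ℤ ν) = 0 := fun i => by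
    simp only [hv]
    rw [integral_sub (integrable_of_abs_le (measurable_avgPast ν (hw.measurable i f) _)
      (abs_avgPast_le ν (hw.abs_le i f) _)) (integrable_const _),
      integral_avgPast ν (hw.measurable i f) (hw.abs_le i f)]
    simp
  have hvint : ∀ i, Integrable (v i) (iidLaw ℤ ν) := fun i => integrable_of_abs_le (hvm i) (hvb i)
  have hvdep : ∀ i, DependsOn (v i) (Set.Ico ((i : ℤ) - q) i) := fun i x y hxy => by
    simp only [hv]
    rw [dependsOn_avgPast ν (hw.dependsOn i f) _ hxy]
  have hTb : ∀ b x, |2 * l * ∑ i ∈ block n q b, v i x| ≤ 1 := fun b x => by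
    have := abs_sum_block_le hq (by positivity) hvb b x (n := n)
    rw [abs_mul, abs_mul, abs_two]
    refine le_trans ?_ hl
    calc 2 * |l| * |∑ i ∈ block n q b, v i x| ≤ 2 * |l| * (q * (2 * M)) := by gcongr
      _ = _ := by ring
  have hTm : ∀ b, Measurable fun x => ∑ i ∈ block n q b, v i x := fun b =>
    Finset.measurable_fun_sum _ fun i _ => hvm i
  refine (integral_exp_sum_le_of_block ν hq hvm (by positivity) hvb hvdep l
    (κ := fun b => (2 * l) ^ 2 * ∫ x, (∑ i ∈ block n q b, v i x) ^ 2 ∂(iidLaw ℤ ν))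
    (fun b => mul_nonneg (sq_nonneg _) (integral_nonneg fun x => sq_nonneg _)) fun b =>
      integral_exp_le_of_centered (hTm b) (hTb b) ?_).trans ?_
  · rw [integral_const_mul, integral_finsetSum _ fun i _ => hvint i]
    simp [hv0]
  rw [Real.exp_le_exp, ← Finset.mul_sum, mul_pow, show (2 : ℝ) ^ 2 = 4 by norm_num]
  refine mul_le_mul_of_nonneg_left ?_ (by positivity)
  set A := ∑ k ∈ Finset.range q, α k with hA
  have hApos : 0 < A := Finset.sum_pos (fun k _ => hα k) ⟨0, Finset.mem_range.2 (by omega)⟩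
  have hincm : ∀ k (B : Finset ℕ), Measurable
      fun x => ∑ i ∈ B, incr ν ((i : ℤ) - (k + 1 : ℕ)) (w i f) x := fun k B =>
    Finset.measurable_fun_sum _ fun i _ => measurable_incr ν (hw.measurable i f) _
  have hblock : ∀ b, ∫ x, (∑ i ∈ block n q b, v i x) ^ 2 ∂(iidLaw ℤ ν)
      ≤ ∑ k ∈ Finset.range q, A / α k * ∑ i ∈ block n q b,
        ∫ x, incr ν ((i : ℤ) - (k + 1 : ℕ)) (w i f) x ^ 2 ∂(iidLaw ℤ ν) := by
    intro b
    have hint : ∀ k, Integrable (fun x => A / α k *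
        (∑ i ∈ block n q b, incr ν ((i : ℤ) - (k + 1 : ℕ)) (w i f) x) ^ 2) (iidLaw ℤ ν) := by
      intro k
      refine Integrable.const_mul ?_ _
      have hb := abs_sum_block_le (n := n) hq (C := 2 * M) (by positivity)
        (fun i x => abs_incr_le ν (hw.abs_le i f) ((i : ℤ) - (k + 1 : ℕ)) x) b
      exact integrable_of_abs_le ((hincm k _).pow_const 2) fun x => by
        rw [sq]; exact abs_mul_le_mul (hb x) (hb x)
    calc ∫ x, (∑ i ∈ block n q b, v i x) ^ 2 ∂(iidLaw ℤ ν)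
        ≤ ∫ x, ∑ k ∈ Finset.range q, A / α k *
          (∑ i ∈ block n q b, incr ν ((i : ℤ) - (k + 1 : ℕ)) (w i f) x) ^ 2 ∂(iidLaw ℤ ν) := by
          refine integral_mono_of_nonneg (ae_of_all _ fun x => sq_nonneg _)
            (integrable_finsetSum _ fun k _ => hint k) (ae_of_all _ fun x => ?_)
          simp only [hvsum]
          rw [Finset.sum_comm]
          -- the Cauchy–Schwarz inequality with the weights `α k`
          have hcs := Finset.sq_sum_div_le_sum_sq_div (Finset.range q)
            (fun k => ∑ i ∈ block n q b, incr ν ((i : ℤ) - (k + 1 : ℕ)) (w i f) x)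
            (g := α) fun k _ => hα k
          rw [div_le_iff₀ hApos, Finset.sum_mul] at hcs
          refine hcs.trans_eq (Finset.sum_congr rfl fun k _ => ?_)
          ring
      _ = ∑ k ∈ Finset.range q, A / α k * ∫ x,
          (∑ i ∈ block n q b, incr ν ((i : ℤ) - (k + 1 : ℕ)) (w i f) x) ^ 2 ∂(iidLaw ℤ ν) := by
          rw [integral_finsetSum _ fun k _ => hint k]
          simp only [integral_const_mul]
      _ ≤ _ := Finset.sum_le_sum fun k _ => mul_le_mul_of_nonneg_left
          (hw.integral_sum_incr_sq_le (k + 1) f _) (div_nonneg hApos.le (hα k).le)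
  calc _ ≤ ∑ b ∈ Finset.range n, ∑ k ∈ Finset.range q, A / α k * ∑ i ∈ block n q b,
        ∫ x, incr ν ((i : ℤ) - (k + 1 : ℕ)) (w i f) x ^ 2 ∂(iidLaw ℤ ν) :=
        Finset.sum_le_sum fun b _ => hblock b
    _ = ∑ k ∈ Finset.range q, A / α k * ∑ i ∈ Finset.Icc 1 n,
        ∫ x, incr ν ((i : ℤ) - (k + 1 : ℕ)) (w i f) x ^ 2 ∂(iidLaw ℤ ν) := by
        rw [Finset.sum_comm]
        simp only [← Finset.mul_sum, sum_block]
    _ ≤ ∑ k ∈ Finset.range q, A / α k * (n * α k ^ 2) :=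
        Finset.sum_le_sum fun k _ => mul_le_mul_of_nonneg_left (hvar k)
          (div_nonneg hApos.le (hα k).le)
    _ = ∑ k ∈ Finset.range q, (n * A) * α k :=
        Finset.sum_congr rfl fun k _ => by
          have := (hα k).ne'
          field_simp
    _ = n * A ^ 2 := by rw [← Finset.mul_sum, ← hA]; ring

/-- The exponential inequality for the squares of the averaged functions.  They are nonnegative, so
the exponent is linear in `l`. -/
theorem integral_exp_sum_avgPast_sq_le (hw : IsShiftArray ν n M Δ c w) {q : ℕ}
    (hq : 1 ≤ q) (f : ι) {l : ℝ} (hl0 : 0 ≤ l) (hl : 2 * l * (q * M ^ 2) ≤ 1) {V : ℝ}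
    (hV : ∑ i ∈ Finset.Icc 1 n, ∫ x, w i f x ^ 2 ∂(iidLaw ℤ ν) ≤ V) :
    ∫ x, Real.exp (l * ∑ i ∈ Finset.Icc 1 n, avgPast ν ((i : ℤ) - q) (w i f) x ^ 2) ∂(iidLaw ℤ ν)
      ≤ Real.exp (4 * l * V) := by
  set v : ℕ → (ℤ → E) → ℝ := fun i x => avgPast ν ((i : ℤ) - q) (w i f) x ^ 2 with hv
  have hvm : ∀ i, Measurable (v i) := fun i =>
    (measurable_avgPast ν (hw.measurable i f) _).pow_const 2
  have hvb : ∀ i x, |v i x| ≤ M ^ 2 := fun i x => by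
    simp only [hv]
    rw [sq, sq]
    exact abs_mul_le_mul (abs_avgPast_le ν (hw.abs_le i f) _ x)
      (abs_avgPast_le ν (hw.abs_le i f) _ x)
  have hv0 : ∀ i x, 0 ≤ v i x := fun i x => sq_nonneg _
  have hvint : ∀ i, Integrable (v i) (iidLaw ℤ ν) := fun i => integrable_of_abs_le (hvm i) (hvb i)
  have hvdep : ∀ i, DependsOn (v i) (Set.Ico ((i : ℤ) - q) i) := fun i x y hxy => by
    simp only [hv]
    rw [dependsOn_avgPast ν (hw.dependsOn i f) _ hxy]
  have hTm : ∀ b, Measurable fun x => 2 * l * ∑ i ∈ block n q b, v i x := fun b =>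
    (Finset.measurable_fun_sum _ fun i _ => hvm i).const_mul _
  have hT0 : ∀ b x, 0 ≤ 2 * l * ∑ i ∈ block n q b, v i x := fun b x =>
    mul_nonneg (by positivity) (Finset.sum_nonneg fun i _ => hv0 i x)
  refine (integral_exp_sum_le_of_block ν hq hvm (sq_nonneg M) hvb hvdep l
    (κ := fun b => 2 * ∫ x, 2 * l * ∑ i ∈ block n q b, v i x ∂(iidLaw ℤ ν))
    (fun b => mul_nonneg zero_le_two (integral_nonneg fun x => hT0 b x)) fun b =>
      integral_exp_le_of_nonneg (hTm b) (hT0 b) fun x => ?_).trans ?_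
  · refine le_trans ?_ hl
    exact mul_le_mul_of_nonneg_left
      ((le_abs_self _).trans (abs_sum_block_le hq (sq_nonneg M) hvb b x)) (by positivity)
  · rw [Real.exp_le_exp]
    simp only [integral_const_mul]
    have h1 : ∀ b, ∫ x, ∑ i ∈ block n q b, v i x ∂(iidLaw ℤ ν)
        = ∑ i ∈ block n q b, ∫ x, v i x ∂(iidLaw ℤ ν) := fun b =>
      integral_finsetSum _ fun i _ => hvint i
    simp only [h1, ← Finset.mul_sum, sum_block]
    have h2 : ∑ i ∈ Finset.Icc 1 n, ∫ x, v i x ∂(iidLaw ℤ ν) ≤ V :=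
      (Finset.sum_le_sum fun i _ =>
        integral_avgPast_sq_le ν (hw.measurable i f) (hw.abs_le i f) _).trans hV
    nlinarith

end IsShiftArray

end Exponential

/-! ### Deviation inequalities -/

section Tail

variable {α ι : Type*} [MeasurableSpace α] {μ : Measure α}

theorem measureReal_ge_le_div {X : α → ℝ} (h0 : 0 ≤ᵐ[μ] X) (hX : Integrable X μ) {t a : ℝ}
    (ht : 0 < t) (ha : ∫ x, X x ∂μ ≤ a) : μ.real {x | t ≤ X x} ≤ a / t := by
  rw [le_div_iff₀ ht, mul_comm]
  exact (mul_meas_ge_le_integral_of_nonneg h0 hX t).trans ha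

theorem measureReal_exists_le [Fintype ι] {A : ι → Set α} {p : ℝ} (h : ∀ f, μ.real (A f) ≤ p) :
    μ.real {x | ∃ f, x ∈ A f} ≤ Fintype.card ι * p := by
  have : {x | ∃ f, x ∈ A f} = ⋃ f, A f := by ext; simp
  rw [this]
  refine (measureReal_iUnion_fintype_le _).trans ((Finset.sum_le_sum fun f _ => h f).trans ?_)
  simp

/-- If `exp (l X - l² v)` and `exp (-l X - l² v)` have mean at most one, then `|X|` exceeds `t`
while `v` stays below `T` with probability at most `2 exp (l² T - l t)`. -/
theorem measureReal_abs_ge_le [IsFiniteMeasure μ] {X v : α → ℝ} {l t T K : ℝ} (hl : 0 ≤ l)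
    (hint : ∀ s : ℝ, Integrable (fun x => Real.exp (s * X x - l ^ 2 * v x)) μ)
    (hp : ∀ s : ℝ, |s| = l → ∫ x, Real.exp (s * X x - l ^ 2 * v x) ∂μ ≤ K) :
    μ.real {x | t ≤ |X x| ∧ v x ≤ T} ≤ 2 * (K * Real.exp (l ^ 2 * T - l * t)) := by
  have one : ∀ s : ℝ, |s| = l → μ.real {x | l * t - l ^ 2 * T ≤ s * X x - l ^ 2 * v x}
      ≤ K * Real.exp (l ^ 2 * T - l * t) := by
    intro s hs
    have h1 := measureReal_ge_le_div (μ := μ) (X := fun x => Real.exp (s * X x - l ^ 2 * v x))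
      (ae_of_all _ fun x => (Real.exp_pos _).le) (hint s) (Real.exp_pos (l * t - l ^ 2 * T)) (hp s hs)
    simp only [Real.exp_le_exp] at h1
    refine h1.trans_eq ?_
    rw [div_eq_mul_inv, ← Real.exp_neg, neg_sub]
  have hsub : {x | t ≤ |X x| ∧ v x ≤ T} ⊆
      {x | l * t - l ^ 2 * T ≤ l * X x - l ^ 2 * v x} ∪
      {x | l * t - l ^ 2 * T ≤ (-l) * X x - l ^ 2 * v x} := by
    rintro x ⟨h1, h2⟩
    have h3 : l ^ 2 * v x ≤ l ^ 2 * T := mul_le_mul_of_nonneg_left h2 (sq_nonneg l)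
    have h4 := mul_le_mul_of_nonneg_left h1 hl
    rcases abs_cases (X x) with ⟨h, -⟩ | ⟨h, -⟩ <;> rw [h] at h4
    · exact Or.inl (show l * t - l ^ 2 * T ≤ l * X x - l ^ 2 * v x by linarith)
    · exact Or.inr (show l * t - l ^ 2 * T ≤ (-l) * X x - l ^ 2 * v x by linarith)
  calc _ ≤ _ := measureReal_mono hsub
    _ ≤ _ := measureReal_union_le _ _
    _ ≤ _ := by
      have h1 := one l (abs_of_nonneg hl)
      have h2 := one (-l) (by rw [abs_neg, abs_of_nonneg hl])
      linarith

end Tail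

section Freedman

variable {Ω : Type*} [mΩ : MeasurableSpace Ω] {P : Measure Ω} [IsProbabilityMeasure P]

/-- The exponential supermartingale of bounded martingale differences `X i - m i`, where `m i` and
`v i` are the conditional mean and the conditional second moment of `X i`.  All variables are
bounded everywhere, and the conditional moments enter only through their integrals against bounded
weights. -/
theorem integral_exp_martingale_le {𝒢 : ℕ → MeasurableSpace Ω} (hmono : ∀ i, 𝒢 i ≤ 𝒢 (i + 1))
    (hle : ∀ i, 𝒢 i ≤ mΩ) {X m v : ℕ → Ω → ℝ} {M : ℝ}
    (hX : ∀ i, Measurable[𝒢 (i + 1)] (X i)) (hm : ∀ i, Measurable[𝒢 i] (m i))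
    (hv : ∀ i, Measurable[𝒢 i] (v i)) (hXM : ∀ i x, |X i x| ≤ M) (hmM : ∀ i x, |m i x| ≤ M)
    (hv0 : ∀ i x, 0 ≤ v i x) (hvM : ∀ i x, v i x ≤ M ^ 2)
    (hmX : ∀ i (W : Ω → ℝ) (C : ℝ), Measurable[𝒢 i] W → (∀ x, |W x| ≤ C) →
      ∫ x, W x * X i x ∂P = ∫ x, W x * m i x ∂P)
    (hvX : ∀ i (W : Ω → ℝ) (C : ℝ), Measurable[𝒢 i] W → (∀ x, |W x| ≤ C) →
      ∫ x, W x * X i x ^ 2 ∂P = ∫ x, W x * v i x ∂P)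
    {l : ℝ} (hl : |l| * (2 * M) ≤ 1) (N : ℕ) :
    ∫ x, Real.exp (l * ∑ i ∈ Finset.range N, (X i x - m i x)
      - l ^ 2 * ∑ i ∈ Finset.range N, v i x) ∂P ≤ 1 := by
  have hXb : ∀ i, Measurable (X i) := fun i => (hX i).mono (hle _) le_rfl
  have hmb : ∀ i, Measurable (m i) := fun i => (hm i).mono (hle _) le_rfl
  have hvb : ∀ i, Measurable (v i) := fun i => (hv i).mono (hle _) le_rfl
  have hvabs : ∀ i x, |v i x| ≤ M ^ 2 := fun i x => by
    rw [abs_of_nonneg (hv0 i x)]; exact hvM i x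
  have h𝒢 : ∀ {i j}, i ≤ j → 𝒢 i ≤ 𝒢 j := fun h => monotone_nat_of_le_succ hmono h
  induction N with
  | zero => simp
  | succ N ih =>
    -- the weight is predictable: it contains `v N` but not `X N`
    set W : Ω → ℝ := fun x => Real.exp (l * ∑ i ∈ Finset.range N, (X i x - m i x)
      - l ^ 2 * ∑ i ∈ Finset.range (N + 1), v i x) with hW
    have hWm : Measurable[𝒢 N] W := by
      refine Real.measurable_exp.comp (Measurable.sub (Measurable.const_mul ?_ _)
        (Measurable.const_mul ?_ _))
      · refine Finset.measurable_fun_sum _ fun i hi => Measurable.sub ?_ ?_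
        · exact (hX i).mono (h𝒢 (by have := Finset.mem_range.1 hi; omega)) le_rfl
        · exact (hm i).mono (h𝒢 (by have := Finset.mem_range.1 hi; omega)) le_rfl
      · exact Finset.measurable_fun_sum _ fun i hi =>
          (hv i).mono (h𝒢 (by have := Finset.mem_range.1 hi; omega)) le_rfl
    have hWb : Measurable W := hWm.mono (hle _) le_rfl
    have hW0 : ∀ x, 0 ≤ W x := fun x => (Real.exp_pos _).le
    have hWC : ∀ x, |W x| ≤ Real.exp (|l| * (N * (2 * M))) := fun x => by
      rw [abs_of_nonneg (hW0 x), Real.exp_le_exp]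
      have h1 : |∑ i ∈ Finset.range N, (X i x - m i x)| ≤ N * (2 * M) := by
        calc _ ≤ ∑ i ∈ Finset.range N, |X i x - m i x| := Finset.abs_sum_le_sum_abs _ _
          _ ≤ ∑ i ∈ Finset.range N, 2 * M := Finset.sum_le_sum fun i _ => by
              have := abs_sub (X i x) (m i x)
              linarith [hXM i x, hmM i x]
          _ = _ := by simp
      have h2 : l * ∑ i ∈ Finset.range N, (X i x - m i x) ≤ |l| * (N * (2 * M)) := by
        refine (le_abs_self _).trans ?_
        rw [abs_mul]
        exact mul_le_mul_of_nonneg_left h1 (abs_nonneg _)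
      have h3 : 0 ≤ l ^ 2 * ∑ i ∈ Finset.range (N + 1), v i x :=
        mul_nonneg (sq_nonneg _) (Finset.sum_nonneg fun i _ => hv0 i x)
      linarith
    have hξ : ∀ x, |l * (X N x - m N x)| ≤ 1 := fun x => by
      rw [abs_mul]
      refine le_trans (mul_le_mul_of_nonneg_left ?_ (abs_nonneg _)) hl
      have := abs_sub (X N x) (m N x)
      linarith [hXM N x, hmM N x]
    have e1 : ∀ x, Real.exp (l * ∑ i ∈ Finset.range (N + 1), (X i x - m i x)
        - l ^ 2 * ∑ i ∈ Finset.range (N + 1), v i x)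
        = W x * Real.exp (l * (X N x - m N x)) := fun x => by
      rw [hW, ← Real.exp_add, Finset.sum_range_succ (fun i => X i x - m i x)]
      congr 1
      ring
    have e2 : ∀ x, W x * (1 + l ^ 2 * v N x) ≤
        Real.exp (l * ∑ i ∈ Finset.range N, (X i x - m i x)
        - l ^ 2 * ∑ i ∈ Finset.range N, v i x) := fun x => by
      have : Real.exp (l * ∑ i ∈ Finset.range N, (X i x - m i x)
        - l ^ 2 * ∑ i ∈ Finset.range N, v i x) = W x * Real.exp (l ^ 2 * v N x) := by
        rw [hW, ← Real.exp_add, Finset.sum_range_succ (fun i => v i x)]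
        congr 1
        ring
      rw [this]
      refine mul_le_mul_of_nonneg_left ?_ (hW0 x)
      linarith [Real.add_one_le_exp (l ^ 2 * v N x)]
    have iW : Integrable W P := integrable_of_abs_le hWb hWC
    have iWX : Integrable (fun x => W x * X N x) P :=
      integrable_of_abs_le (hWb.mul (hXb N)) fun x => abs_mul_le_mul (hWC x) (hXM N x)
    have iWm : Integrable (fun x => W x * m N x) P :=
      integrable_of_abs_le (hWb.mul (hmb N)) fun x => abs_mul_le_mul (hWC x) (hmM N x)
    have iWv : Integrable (fun x => W x * v N x) P :=
      integrable_of_abs_le (hWb.mul (hvb N)) fun x => abs_mul_le_mul (hWC x) (hvabs N x)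
    have iWX2 : Integrable (fun x => W x * X N x ^ 2) P :=
      integrable_of_abs_le (hWb.mul ((hXb N).pow_const 2)) fun x => abs_mul_le_mul (hWC x) (by
        rw [sq]; exact abs_mul_le_mul (hXM N x) (hXM N x))
    have iWmX : Integrable (fun x => W x * m N x * X N x) P :=
      integrable_of_abs_le ((hWb.mul (hmb N)).mul (hXb N)) fun x =>
        abs_mul_le_mul (abs_mul_le_mul (hWC x) (hmM N x)) (hXM N x)
    have iWmm : Integrable (fun x => W x * m N x * m N x) P :=
      integrable_of_abs_le ((hWb.mul (hmb N)).mul (hmb N)) fun x =>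
        abs_mul_le_mul (abs_mul_le_mul (hWC x) (hmM N x)) (hmM N x)
    have z1 := hmX N W _ hWm hWC
    have z2 := hvX N W _ hWm hWC
    have z3 := hmX N (fun x => W x * m N x) _ (hWm.mul (hm N))
      fun x => abs_mul_le_mul (hWC x) (hmM N x)
    have z4 : 0 ≤ ∫ x, W x * m N x * m N x ∂P := integral_nonneg fun x => by
      simp only [Pi.zero_apply, mul_assoc]
      exact mul_nonneg (hW0 x) (mul_self_nonneg _)
    have iexp : ∀ K : ℕ, Integrable (fun x => Real.exp (l * ∑ i ∈ Finset.range K, (X i x - m i x)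
        - l ^ 2 * ∑ i ∈ Finset.range K, v i x)) P := by
      intro K
      refine integrable_exp_of_abs_le (((Finset.measurable_fun_sum _ fun i _ =>
        (hXb i).sub (hmb i)).const_mul _).sub ((Finset.measurable_fun_sum _ fun i _ =>
          hvb i).const_mul _)) (C := |l| * (K * (2 * M)) + l ^ 2 * (K * M ^ 2)) fun x => ?_
      refine (abs_sub _ _).trans (add_le_add ?_ ?_)
      · rw [abs_mul]
        refine mul_le_mul_of_nonneg_left ?_ (abs_nonneg _)
        calc _ ≤ ∑ i ∈ Finset.range K, |X i x - m i x| := Finset.abs_sum_le_sum_abs _ _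
          _ ≤ ∑ i ∈ Finset.range K, 2 * M := Finset.sum_le_sum fun i _ => by
              have := abs_sub (X i x) (m i x)
              linarith [hXM i x, hmM i x]
          _ = _ := by simp
      · rw [abs_mul, abs_of_nonneg (sq_nonneg l)]
        refine mul_le_mul_of_nonneg_left ?_ (sq_nonneg _)
        calc _ ≤ ∑ i ∈ Finset.range K, |v i x| := Finset.abs_sum_le_sum_abs _ _
          _ ≤ ∑ i ∈ Finset.range K, M ^ 2 := Finset.sum_le_sum fun i _ => hvabs i x
          _ = _ := by simp
    have iA : Integrable (fun x => W x + l * (W x * X N x) - l * (W x * m N x)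
        + l ^ 2 * (W x * X N x ^ 2)) P :=
      ((iW.add (iWX.const_mul l)).sub (iWm.const_mul l)).add (iWX2.const_mul _)
    have iB : Integrable (fun x => l ^ 2 * (-2 * (W x * m N x * X N x) + W x * m N x * m N x)) P :=
      (((iWmX.const_mul (-2)).add iWmm).const_mul _)
    calc ∫ x, Real.exp (l * ∑ i ∈ Finset.range (N + 1), (X i x - m i x)
          - l ^ 2 * ∑ i ∈ Finset.range (N + 1), v i x) ∂P
        ≤ ∫ x, ((W x + l * (W x * X N x) - l * (W x * m N x) + l ^ 2 * (W x * X N x ^ 2))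
          + l ^ 2 * (-2 * (W x * m N x * X N x) + W x * m N x * m N x)) ∂P := by
          refine integral_mono (iexp (N + 1)) (iA.add iB) fun x => ?_
          simp only
          rw [e1]
          have h1 := (abs_le.1 (Real.abs_exp_sub_one_sub_id_le (hξ x))).2
          have h2 : Real.exp (l * (X N x - m N x)) ≤ 1 + l * (X N x - m N x)
            + (l * (X N x - m N x)) ^ 2 := by linarith
          refine (mul_le_mul_of_nonneg_left h2 (hW0 x)).trans_eq ?_
          ring
      _ = ∫ x, W x ∂P + l ^ 2 * ∫ x, W x * v N x ∂P - l ^ 2 * ∫ x, W x * m N x * m N x ∂P := by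
          rw [integral_add iA iB, integral_add (f := fun x => W x + l * (W x * X N x)
            - l * (W x * m N x)) ((iW.add (iWX.const_mul l)).sub (iWm.const_mul l))
            (iWX2.const_mul _), integral_sub (f := fun x => W x + l * (W x * X N x))
            (iW.add (iWX.const_mul l)) (iWm.const_mul l),
            integral_add iW (iWX.const_mul l)]
          simp only [integral_const_mul]
          rw [integral_add (iWmX.const_mul (-2)) iWmm]
          simp only [integral_const_mul]
          rw [z1, z2, z3]
          ring
      _ ≤ ∫ x, W x * (1 + l ^ 2 * v N x) ∂P := by
          have : ∫ x, W x * (1 + l ^ 2 * v N x) ∂P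
              = ∫ x, W x ∂P + l ^ 2 * ∫ x, W x * v N x ∂P := by
            rw [← integral_const_mul, ← integral_add iW (iWv.const_mul _)]
            refine integral_congr_ae (ae_of_all _ fun x => ?_)
            simp only
            ring
          rw [this]
          have := mul_nonneg (sq_nonneg l) z4
          linarith
      _ ≤ ∫ x, Real.exp (l * ∑ i ∈ Finset.range N, (X i x - m i x)
          - l ^ 2 * ∑ i ∈ Finset.range N, v i x) ∂P := by
          refine integral_mono_of_nonneg (ae_of_all _ fun x => ?_) (iexp N) (ae_of_all _ e2)
          exact mul_nonneg (hW0 x) (by have := mul_nonneg (sq_nonneg l) (hv0 N x); linarith)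
      _ ≤ 1 := ih

end Freedman

section Deviation

variable {E ι : Type*} [MeasurableSpace E] {ν : Measure E} [IsProbabilityMeasure ν] {n : ℕ} {M : ℝ}
  {Δ : ℕ → ℝ} {c : ℕ → ι → ℝ} {w : ℕ → ι → (ℤ → E) → ℝ} [Fintype ι]

namespace IsShiftArray

/-- Tail bound for the smooth part.  The first term comes from the lags up to `q`, by a union bound,
and the second from the lags beyond `q`. -/
theorem measureReal_abs_sum_ge_le [Nonempty ι] (hw : IsShiftArray ν n M Δ c w) (hM : 0 ≤ M)
    (hΔ : ∀ k, 0 ≤ Δ k) (hanti : Antitone Δ) (hsum : Summable Δ) {q : ℕ} (hq : 1 ≤ q)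
    {C : ℕ → ℝ} (hC : ∀ i, 0 ≤ C i) (hcC : ∀ i f, c i f ≤ C i) {S : ℝ} (hS : 0 ≤ S)
    (hCS : ∑ i ∈ Finset.Icc 1 n, C i ^ 2 ≤ S ^ 2) {H : ℝ} (hH : 1 ≤ H)
    (hHι : Real.log (Fintype.card ι) ≤ H) {α : ι → ℕ → ℝ} (hα : ∀ f k, 0 < α f k) {A : ℝ}
    (hαA : ∀ f, ∑ k ∈ Finset.range q, α f k ≤ A)
    (hvar : ∀ f k, ∑ i ∈ Finset.Icc 1 n, ∫ x, incr ν ((i : ℤ) - (k + 1 : ℕ)) (w i f) x ^ 2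
      ∂(iidLaw ℤ ν) ≤ n * α f k ^ 2) {l : ℝ} (hl0 : 0 ≤ l) (hl : l * (4 * q * M) ≤ 1)
    {t : ℝ} (ht : 0 < t) :
    (iidLaw ℤ ν).real
        {x | ∃ f, 2 * t ≤ |∑ i ∈ Finset.Icc 1 n, (w i f x - ∫ y, w i f y ∂(iidLaw ℤ ν))|}
      ≤ Fintype.card ι * (2 * Real.exp (4 * l ^ 2 * (n * A ^ 2) - l * t))
        + 4 * Real.sqrt H * (S * betaTail Δ q) / t := by
  set v : ℕ → ι → (ℤ → E) → ℝ := fun i f x =>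
    avgPast ν ((i : ℤ) - q) (w i f) x - ∫ y, w i f y ∂(iidLaw ℤ ν) with hv
  have hvm : ∀ f, Measurable fun x => ∑ i ∈ Finset.Icc 1 n, v i f x := fun f =>
    Finset.measurable_fun_sum _ fun i _ =>
      (measurable_avgPast ν (hw.measurable i f) _).sub_const _
  have hvb : ∀ f x, |∑ i ∈ Finset.Icc 1 n, v i f x| ≤ n * (2 * M) := fun f x => by
    calc _ ≤ ∑ i ∈ Finset.Icc 1 n, |v i f x| := Finset.abs_sum_le_sum_abs _ _
      _ ≤ ∑ i ∈ Finset.Icc 1 n, 2 * M := by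
          refine Finset.sum_le_sum fun i _ => ?_
          have h1 := abs_avgPast_le ν (hw.abs_le i f) ((i : ℤ) - q) x
          have h2 := abs_avgPast_le ν (hw.abs_le i f) (i : ℤ) x
          rw [avgPast_eq_integral ν (hw.dependsOn i f) le_rfl] at h2
          have := abs_sub (avgPast ν ((i : ℤ) - q) (w i f) x) (∫ y, w i f y ∂(iidLaw ℤ ν))
          simp only [hv]
          linarith
      _ = _ := by simp
  have hrm : Measurable fun x => ∑ i ∈ Finset.Icc 1 n, remVec ν w q i x :=
    Finset.measurable_fun_sum _ fun i _ => hw.measurable_remVec q i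
  have hsub : {x | ∃ f, 2 * t ≤ |∑ i ∈ Finset.Icc 1 n, (w i f x - ∫ y, w i f y ∂(iidLaw ℤ ν))|}
      ⊆ {x | ∃ f, x ∈ {x | t ≤ |∑ i ∈ Finset.Icc 1 n, v i f x| ∧ (0 : ℝ) ≤ 0}}
        ∪ {x | t ≤ ‖∑ i ∈ Finset.Icc 1 n, remVec ν w q i x‖} := by
    rintro x ⟨f, hf⟩
    by_contra hcon
    have h1 : ¬ t ≤ |∑ i ∈ Finset.Icc 1 n, v i f x| := fun h => hcon (Or.inl ⟨f, h, le_rfl⟩)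
    have h2 : ¬ t ≤ ‖∑ i ∈ Finset.Icc 1 n, remVec ν w q i x‖ := fun h => hcon (Or.inr h)
    have h3 := norm_le_pi_norm (∑ i ∈ Finset.Icc 1 n, remVec ν w q i x) f
    rw [Finset.sum_apply, Real.norm_eq_abs] at h3
    have h4 : ∑ i ∈ Finset.Icc 1 n, (w i f x - ∫ y, w i f y ∂(iidLaw ℤ ν))
        = ∑ i ∈ Finset.Icc 1 n, v i f x + ∑ i ∈ Finset.Icc 1 n, remVec ν w q i x f := by
      rw [← Finset.sum_add_distrib]
      refine Finset.sum_congr rfl fun i _ => ?_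
      simp only [hv, remVec]
      ring
    rw [h4] at hf
    have := abs_add_le (∑ i ∈ Finset.Icc 1 n, v i f x) (∑ i ∈ Finset.Icc 1 n, remVec ν w q i x f)
    push Not at h1 h2
    linarith
  refine (measureReal_mono hsub).trans ((measureReal_union_le _ _).trans (add_le_add ?_ ?_))
  · refine measureReal_exists_le fun f => ?_
    have hA0 : 0 ≤ ∑ k ∈ Finset.range q, α f k := Finset.sum_nonneg fun k _ => (hα f k).le
    have h1 := measureReal_abs_ge_le (μ := iidLaw ℤ ν)
      (X := fun x => ∑ i ∈ Finset.Icc 1 n, v i f x) (v := fun _ => 0) (l := l) (t := t) (T := 0)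
      (K := Real.exp (4 * l ^ 2 * (n * A ^ 2))) hl0
      (fun s => by
        simp only [mul_zero, sub_zero]
        exact integrable_exp_of_abs_le ((hvm f).const_mul s) (C := |s| * (n * (2 * M))) fun x => by
          rw [abs_mul]; exact mul_le_mul_of_nonneg_left (hvb f x) (abs_nonneg _))
      (fun s hs => by
        simp only [mul_zero, sub_zero]
        refine (hw.integral_exp_sum_avgPast_le hM hq f (hα f) (hvar f)
          (by rw [hs]; exact hl)).trans ?_
        rw [Real.exp_le_exp, ← sq_abs s, hs]
        have := pow_le_pow_left₀ hA0 (hαA f) 2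
        gcongr)
    refine h1.trans_eq ?_
    rw [← Real.exp_add]
    congr 3
    ring
  · refine measureReal_ge_le_div (ae_of_all _ fun x => norm_nonneg _) ?_ ht
      (hw.integral_norm_sum_remVec_le hM hΔ hanti hsum q hC hcC hS hCS hH hHι)
    refine integrable_of_abs_le hrm.norm (C := n * (2 * M)) fun x => ?_
    rw [abs_of_nonneg (norm_nonneg _)]
    refine (norm_sum_le _ _).trans ?_
    calc _ ≤ ∑ i ∈ Finset.Icc 1 n, 2 * M :=
          Finset.sum_le_sum fun i _ => hw.norm_remVec_le hM q i x
      _ = _ := by simp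

/-- Tail bound for the sum of squares, split into the averages over the innovations with index
`< i - q` and the remainders. -/
theorem measureReal_sum_sq_ge_le (hw : IsShiftArray ν n M Δ c w) (hM : 0 ≤ M)
    (hΔ : ∀ k, 0 ≤ Δ k) (hanti : Antitone Δ) (hsum : Summable Δ) {q : ℕ} (hq : 1 ≤ q)
    {C : ℕ → ℝ} (hC : ∀ i, 0 ≤ C i) (hcC : ∀ i f, c i f ≤ C i) {S : ℝ}
    (hCS : ∑ i ∈ Finset.Icc 1 n, C i ^ 2 ≤ S ^ 2) {V : ℝ}
    (hV : ∀ f, ∑ i ∈ Finset.Icc 1 n, ∫ x, w i f x ^ 2 ∂(iidLaw ℤ ν) ≤ V)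
    {l : ℝ} (hl0 : 0 ≤ l) (hl : 2 * l * (q * M ^ 2) ≤ 1) {T : ℝ} (hT : 0 < T) :
    (iidLaw ℤ ν).real {x | ∃ f, 4 * T ≤ ∑ i ∈ Finset.Icc 1 n, w i f x ^ 2}
      ≤ Fintype.card ι * Real.exp (4 * l * V - l * T) + (S * betaTail Δ q) ^ 2 / T := by
  have hsub : {x | ∃ f, 4 * T ≤ ∑ i ∈ Finset.Icc 1 n, w i f x ^ 2}
      ⊆ {x | ∃ f, x ∈ {x | T ≤ ∑ i ∈ Finset.Icc 1 n, avgPast ν ((i : ℤ) - q) (w i f) x ^ 2}}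
        ∪ {x | T ≤ ∑ i ∈ Finset.Icc 1 n, ‖remVec ν w q i x‖ ^ 2} := by
    rintro x ⟨f, hf⟩
    by_contra hcon
    have h1 : ¬ T ≤ ∑ i ∈ Finset.Icc 1 n, avgPast ν ((i : ℤ) - q) (w i f) x ^ 2 :=
      fun h => hcon (Or.inl ⟨f, h⟩)
    have h2 : ¬ T ≤ ∑ i ∈ Finset.Icc 1 n, ‖remVec ν w q i x‖ ^ 2 := fun h => hcon (Or.inr h)
    have h3 : ∑ i ∈ Finset.Icc 1 n, w i f x ^ 2
        ≤ 2 * ∑ i ∈ Finset.Icc 1 n, avgPast ν ((i : ℤ) - q) (w i f) x ^ 2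
          + 2 * ∑ i ∈ Finset.Icc 1 n, ‖remVec ν w q i x‖ ^ 2 := by
      rw [Finset.mul_sum, Finset.mul_sum, ← Finset.sum_add_distrib]
      refine Finset.sum_le_sum fun i _ => ?_
      have h4 := pow_le_pow_left₀ (norm_nonneg _) (norm_le_pi_norm (remVec ν w q i x) f) 2
      rw [Real.norm_eq_abs, sq_abs, remVec] at h4
      nlinarith [sq_nonneg (w i f x - 2 * avgPast ν ((i : ℤ) - q) (w i f) x)]
    push Not at h1 h2
    linarith
  refine (measureReal_mono hsub).trans ((measureReal_union_le _ _).trans (add_le_add ?_ ?_))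
  · refine measureReal_exists_le fun f => ?_
    set X : (ℤ → E) → ℝ := fun x => ∑ i ∈ Finset.Icc 1 n, avgPast ν ((i : ℤ) - q) (w i f) x ^ 2
    have hXm : Measurable X := Finset.measurable_fun_sum _ fun i _ =>
      (measurable_avgPast ν (hw.measurable i f) _).pow_const 2
    have hXb : ∀ x, |l * X x| ≤ |l| * (n * M ^ 2) := fun x => by
      rw [abs_mul]
      refine mul_le_mul_of_nonneg_left ?_ (abs_nonneg _)
      calc _ ≤ ∑ i ∈ Finset.Icc 1 n, |avgPast ν ((i : ℤ) - q) (w i f) x ^ 2| :=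
            Finset.abs_sum_le_sum_abs _ _
        _ ≤ ∑ i ∈ Finset.Icc 1 n, M ^ 2 := Finset.sum_le_sum fun i _ => by
            rw [sq, sq]
            exact abs_mul_le_mul (abs_avgPast_le ν (hw.abs_le i f) _ x)
              (abs_avgPast_le ν (hw.abs_le i f) _ x)
        _ = _ := by simp
    have h1 := measureReal_ge_le_div (X := fun x => Real.exp (l * X x))
      (ae_of_all _ fun x => (Real.exp_pos _).le) (integrable_exp_of_abs_le (hXm.const_mul l) hXb)
      (Real.exp_pos (l * T)) (hw.integral_exp_sum_avgPast_sq_le hq f hl0 hl (hV f))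
    rw [← Real.exp_sub] at h1
    refine le_trans (measureReal_mono fun x hx => ?_) h1
    exact Real.exp_le_exp.2 (mul_le_mul_of_nonneg_left hx hl0)
  · have hint : ∀ i, Integrable (fun x => ‖remVec ν w q i x‖ ^ 2) (iidLaw ℤ ν) := fun i =>
      integrable_of_abs_le ((hw.measurable_remVec q i).norm.pow_const 2) (C := (2 * M) ^ 2)
        fun x => by
          rw [abs_of_nonneg (by positivity)]
          exact pow_le_pow_left₀ (norm_nonneg _) (hw.norm_remVec_le hM q i x) 2
    refine measureReal_ge_le_div (ae_of_all _ fun x => Finset.sum_nonneg fun i _ => by positivity)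
      (integrable_finsetSum _ fun i _ => hint i) hT ?_
    rw [integral_finsetSum _ fun i _ => hint i, mul_pow]
    refine le_trans ?_ (mul_le_mul_of_nonneg_right hCS (sq_nonneg _))
    rw [Finset.sum_mul]
    refine Finset.sum_le_sum fun i hi => ?_
    rw [← mul_pow]
    exact hw.integral_norm_remVec_sq_le hM hΔ hanti hsum q hi (hC i) (hcC i)

end IsShiftArray

end Deviation

/-! ### Transfer to the space of innovations -/

section Transfer

variable {Ω : Type*} [MeasurableSpace Ω] {P : Measure Ω} [IsProbabilityMeasure P] {e d : ℕ}
  {ε ε' : ℤ → Ω → Fin e → ℝ}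

/-- The innovations as coordinates of the canonical space. -/
def coords (e : ℕ) (j : ℤ) (x : ℤ → Fin e → ℝ) : Fin e → ℝ := x j

/-- The innovations and their copies are two independent samples of the canonical product law. -/
theorem IsIIDWithCopy.measurePreserving_pair (hε : IsIIDWithCopy P ε ε') :
    MeasurePreserving (fun ω => ((fun j => ε j ω), fun j => ε' j ω)) P
      ((iidLaw ℤ (P.map (ε 0))).prod (iidLaw ℤ (P.map (ε 0)))) := by
  have : IsProbabilityMeasure (P.map (ε 0)) :=
    Measure.isProbabilityMeasure_map (hε.measurable 0).aemeasurable
  have hm : ∀ a : ℤ ⊕ ℤ, Measurable (Sum.elim ε ε' a) := by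
    rintro (i | i)
    · exact hε.measurable i
    · exact hε.measurable_copy i
  have h1 := hε.indep.map_fun_eq_infinitePi_map hm
  have h2 : (fun a : ℤ ⊕ ℤ => P.map (Sum.elim ε ε' a)) = fun _ => P.map (ε 0) := by
    funext a
    rcases a with i | i
    · exact (hε.ident i).map_eq
    · exact (hε.ident_copy i).map_eq
  rw [h2] at h1
  have h3 : MeasurePreserving (fun ω (a : ℤ ⊕ ℤ) => Sum.elim ε ε' a ω) P
      (iidLaw (ℤ ⊕ ℤ) (P.map (ε 0))) := ⟨measurable_pi_lambda _ hm, h1⟩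
  exact (measurePreserving_sumPi_symm (ι := ℤ) (P.map (ε 0))).symm.comp h3

theorem IsIIDWithCopy.measurePreserving_innov (hε : IsIIDWithCopy P ε ε') :
    MeasurePreserving (fun ω j => ε j ω) P (iidLaw ℤ (P.map (ε 0))) := by
  have : IsProbabilityMeasure (P.map (ε 0)) :=
    Measure.isProbabilityMeasure_map (hε.measurable 0).aemeasurable
  exact measurePreserving_fst.comp hε.measurePreserving_pair

theorem measurable_proc_coords {J : ℤ → Hist e → Fin d → ℝ} (hJ : ∀ i, Measurable (J i)) (i : ℤ) :
    Measurable (proc (coords e) J i) :=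
  (hJ i).comp (measurable_pi_lambda _ fun _ => measurable_pi_apply _)

theorem measurable_hist_coords {J : ℤ → Hist e → Fin d → ℝ} (hJ : ∀ i, Measurable (J i)) (i : ℤ) :
    Measurable (hist (coords e) J i) :=
  measurable_pi_lambda _ fun _ => measurable_proc_coords hJ _

theorem dependsOn_proc_coords (J : ℤ → Hist e → Fin d → ℝ) (i : ℤ) :
    DependsOn (proc (coords e) J i) (Set.Iic i) := fun x y hxy => by
  have : innov (coords e) i x = innov (coords e) i y :=
    funext fun j => hxy _ (show i - j ≤ i by omega)
  simp only [proc, this]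

theorem dependsOn_hist_coords (J : ℤ → Hist e → Fin d → ℝ) (i : ℤ) :
    DependsOn (hist (coords e) J i) (Set.Iic i) := fun x y hxy =>
  funext fun j => dependsOn_proc_coords J (i - j) fun a ha => hxy a (by
    simp only [Set.mem_Iic] at ha ⊢
    omega)

/-- Replacing one coordinate by an independent copy preserves the law. -/
theorem measurePreserving_update {E : Type*} [MeasurableSpace E] (ν : Measure E)
    [IsProbabilityMeasure ν] (m : ℤ) :
    MeasurePreserving (fun z : (ℤ → E) × (ℤ → E) => Function.update z.1 m (z.2 m))
      ((iidLaw ℤ ν).prod (iidLaw ℤ ν)) (iidLaw ℤ ν) := by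
  have h := measurePreserving_piecewise ν ({m}ᶜ : Set ℤ)
  convert h using 1
  funext z j
  rcases eq_or_ne j m with rfl | hj
  · rw [Function.update_self, mix_of_notMem (by simp)]
  · rw [Function.update_of_ne hj, mix_of_mem (by simpa using hj)]

/-- The functional dependence measure bounds the effect, on the canonical space, of exchanging the
innovation with index `m = i - l`. -/
theorem IsIIDWithCopy.eLpNorm_update_le (hε : IsIIDWithCopy P ε ε') {J : ℤ → Hist e → Fin d → ℝ}
    (hJ : ∀ i, Measurable (J i)) {n : ℕ} (r : ℝ≥0∞) {i m : ℤ} (hi : i ≤ n) (l : ℕ)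
    (hl : m = i - l) (a : Fin d) :
    eLpNorm (fun z : (ℤ → Fin e → ℝ) × (ℤ → Fin e → ℝ) => proc (coords e) J i z.1 a
      - proc (coords e) J i (Function.update z.1 m (z.2 m)) a) r
      ((iidLaw ℤ (P.map (ε 0))).prod (iidLaw ℤ (P.map (ε 0)))) ≤ depMeasure P ε ε' J n r l := by
  have : IsProbabilityMeasure (P.map (ε 0)) :=
    Measure.isProbabilityMeasure_map (hε.measurable 0).aemeasurable
  have hm : Measurable fun z : (ℤ → Fin e → ℝ) × (ℤ → Fin e → ℝ) => proc (coords e) J i z.1 a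
      - proc (coords e) J i (Function.update z.1 m (z.2 m)) a :=
    ((measurable_pi_apply a).comp ((measurable_proc_coords hJ i).comp measurable_fst)).sub
      ((measurable_pi_apply a).comp ((measurable_proc_coords hJ i).comp
        (measurePreserving_update (P.map (ε 0)) m).measurable))
  rw [← eLpNorm_comp_measurePreserving hm.aestronglyMeasurable hε.measurePreserving_pair]
  refine le_trans (le_of_eq ?_) (le_iSup₂_of_le i hi (le_iSup_of_le a le_rfl))
  congr 1
  funext ω
  have : innov (coords e) i (Function.update (fun j => ε j ω) m (ε' m ω))
      = innovCoupled ε ε' i l ω := by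
    funext j
    simp only [innov, innovCoupled, coords, hl]
    rcases eq_or_ne j l with rfl | hj
    · simp
    · rw [Function.update_of_ne hj, Function.update_of_ne (by omega)]
      rfl
  simp only [Function.comp_def, proc, procCoupled, this]
  rfl

end Transfer

/-! ### Hölder continuous functions of the history inherit its dependence -/

section Coupling

/-- The exponents `ν p / (p - 1)` and `ν p` are conjugate relative to `ν`, also for `p = ∞`. -/
theorem holderTriple_mul_conj {ν : ℝ} (hν : 0 < ν) {p : ℝ≥0∞} (hp : 1 < p) :
    ENNReal.HolderTriple (ENNReal.ofReal ν * (1 - p⁻¹)⁻¹) (ENNReal.ofReal ν * p)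
      (ENNReal.ofReal ν) := by
  have h0 : ENNReal.ofReal ν ≠ 0 := by simpa using hν
  have h1 : ENNReal.ofReal ν ≠ ∞ := ENNReal.ofReal_ne_top
  have hp1 : p⁻¹ ≤ 1 := ENNReal.inv_le_one.2 hp.le
  refine ⟨?_⟩
  rw [ENNReal.mul_inv (Or.inl h0) (Or.inl h1), ENNReal.mul_inv (Or.inl h0) (Or.inl h1), inv_inv,
    ← mul_add, tsub_add_cancel_of_le hp1, mul_one]

theorem eLpNorm_mul_le_of_holderTriple {α : Type*} [MeasurableSpace α] {μ : Measure α}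
    {p q r : ℝ≥0∞} [ENNReal.HolderTriple p q r] {f g : α → ℝ} (hf : Measurable f)
    (hg : Measurable g) : eLpNorm (fun x => f x * g x) r μ ≤ eLpNorm f p μ * eLpNorm g q μ := by
  have h := eLpNorm_smul_le_mul_eLpNorm (p := p) (q := q) (r := r) (μ := μ) (f := g) (φ := f)
    hg.aestronglyMeasurable hf.aestronglyMeasurable
  exact h

/-- The maximum norm of a vector costs a factor `d`, the sum over the coordinates. -/
theorem eLpNorm_norm_rpow_le {α : Type*} [MeasurableSpace α] {μ : Measure α} {d : ℕ}
    {h : α → Fin d → ℝ} (hm : Measurable h) {s : ℝ} (hs : 0 < s) {r : ℝ≥0∞} (hr : 1 ≤ r)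
    {δ : ℝ≥0∞} (hδ : ∀ a, eLpNorm (fun x => h x a) (r * ENNReal.ofReal s) μ ≤ δ) :
    eLpNorm (fun x => ‖h x‖ ^ s) r μ ≤ d * δ ^ s := by
  have hma : ∀ a, Measurable fun x => ‖h x a‖ ^ s := fun a =>
    (((measurable_pi_apply a).comp hm).norm).pow_const s
  calc eLpNorm (fun x => ‖h x‖ ^ s) r μ
      ≤ eLpNorm (∑ a : Fin d, fun x => ‖h x a‖ ^ s) r μ := by
        refine eLpNorm_mono_real fun x => ?_
        rw [Real.norm_of_nonneg (by positivity), Finset.sum_apply]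
        rcases isEmpty_or_nonempty (Fin d) with hd | hd
        · simp [Subsingleton.elim (h x) 0, Real.zero_rpow hs.ne']
        · obtain ⟨a, -, ha⟩ := Finset.exists_mem_eq_sup' (Finset.univ_nonempty (α := Fin d))
            (fun a => ‖h x a‖)
          have : ‖h x‖ ≤ ‖h x a‖ := (pi_norm_le_iff_of_nonneg (norm_nonneg _)).2 fun b => by
            rw [← ha]; exact Finset.le_sup' (fun a => ‖h x a‖) (Finset.mem_univ b)
          calc ‖h x‖ ^ s ≤ ‖h x a‖ ^ s := by gcongr
            _ ≤ _ := Finset.single_le_sum (f := fun a => ‖h x a‖ ^ s)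
              (fun b _ => by positivity) (Finset.mem_univ a)
    _ ≤ ∑ a : Fin d, eLpNorm (fun x => ‖h x a‖ ^ s) r μ :=
        eLpNorm_sum_le (fun a _ => (hma a).aestronglyMeasurable) hr
    _ ≤ ∑ _a : Fin d, δ ^ s := by
        refine Finset.sum_le_sum fun a _ => ?_
        rw [eLpNorm_norm_rpow _ hs]
        exact ENNReal.rpow_le_rpow (hδ a) hs.le
    _ = _ := by simp

variable {Ω : Type*} [MeasurableSpace Ω] {P : Measure Ω} [IsProbabilityMeasure P] {e d d₀ : ℕ}
  {ε ε' : ℤ → Ω → Fin e → ℝ} {J : ℤ → Hist e → Fin d → ℝ} {𝓕 : Finset (Fn d)}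
  {D : Fn d → unitInterval → ℝ} {fbar : Fn d → Fn d} {ν : ℝ} {Δ : ℕ → ℝ} {𝔻n : ℝ} {n : ℕ}
  {J₀ : ℤ → Hist e → Fin d₀ → ℝ} {μ : ℕ → Fn d → ℕ → Fn d₀} {R : Fn d₀} {L : ℕ → ℝ} {s : ℝ}
  {p : ℝ≥0∞} {C_R C_f C_X : ℝ}

/-- Exchanging the innovation with index `i - l` changes all functions of the class, at the history
`Z°_{i-1}`, by at most one random variable with `L²` norm at most `Δ(l)`. -/
theorem CompatAt.exists_coupling
    (h : CompatAt P ε ε' J 𝓕 D fbar ν Δ 𝔻n n J₀ μ R L s p C_R C_f C_X)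
    (hε : IsIIDWithCopy P ε ε') (hν : 2 ≤ ν) (hp : 1 < p) {i : ℕ} (hi : i ∈ Finset.Icc 1 n)
    (l : ℕ) (u : unitInterval) :
    ∃ U : (ℤ → Fin e → ℝ) × (ℤ → Fin e → ℝ) → ℝ≥0∞, Measurable U ∧
      ∫⁻ z, U z ^ 2 ∂((iidLaw ℤ (P.map (ε 0))).prod (iidLaw ℤ (P.map (ε 0))))
        ≤ ENNReal.ofReal (Δ l) ^ 2 ∧
      ∀ κ ∈ ({1, 2} : Finset ℕ), ∀ f ∈ 𝓕, ∀ x y,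
        ‖μ κ f i (hist (coords e) J₀ ((i : ℤ) - 1) x) u
          - μ κ f i (hist (coords e) J₀ ((i : ℤ) - 1)
            (Function.update x ((i : ℤ) - l) (y ((i : ℤ) - l)))) u‖ₑ ≤ U (x, y) := by
  have : IsProbabilityMeasure (P.map (ε 0)) :=
    Measure.isProbabilityMeasure_map (hε.measurable 0).aemeasurable
  have hin := (Finset.mem_Icc.1 hi)
  have hL := h.isLClass 1 (by simp)
  have hs := hL.s_pos
  set m : ℤ := (i : ℤ) - l with hm
  set upd : (ℤ → Fin e → ℝ) × (ℤ → Fin e → ℝ) → ℤ → Fin e → ℝ :=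
    fun z => Function.update z.1 m (z.2 m) with hupd
  have hupdmp := measurePreserving_update (P.map (ε 0)) m
  set Z : (ℤ → Fin e → ℝ) → Hist d₀ := hist (coords e) J₀ ((i : ℤ) - 1) with hZ
  have hZm : Measurable Z := measurable_hist_coords h.measurable_J _
  set μ₂ := (iidLaw ℤ (P.map (ε 0))).prod (iidLaw ℤ (P.map (ε 0))) with hμ₂
  -- components with lag at least `l` do not involve the exchanged innovation
  have hZeq : ∀ z j, l ≤ j → Z z.1 j = Z (upd z) j := by
    intro z j hj
    refine dependsOn_proc_coords J₀ _ fun a ha => ?_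
    simp only [Set.mem_Iic] at ha
    exact (Function.update_of_ne (by omega) _ _).symm
  set A : (ℤ → Fin e → ℝ) × (ℤ → Fin e → ℝ) → ℝ := fun z =>
    ∑ j ∈ Finset.range l, L j * ‖Z z.1 j - Z (upd z) j‖ ^ s with hA
  set B : (ℤ → Fin e → ℝ) × (ℤ → Fin e → ℝ) → ℝ := fun z => R (Z z.1) u + R (Z (upd z)) u with hB
  have hZj : ∀ j, Measurable fun z : (ℤ → Fin e → ℝ) × (ℤ → Fin e → ℝ) =>
      Z z.1 j - Z (upd z) j := fun j =>
    ((measurable_pi_apply j).comp (hZm.comp measurable_fst)).sub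
      ((measurable_pi_apply j).comp (hZm.comp hupdmp.measurable))
  have hAm : Measurable A := Finset.measurable_fun_sum _ fun j _ =>
    ((hZj j).norm.pow_const s).const_mul (L j)
  have hR1 : Measurable fun z : (ℤ → Fin e → ℝ) × (ℤ → Fin e → ℝ) => R (Z z.1) u :=
    (h.measurable_R u).comp (hZm.comp measurable_fst)
  have hR2 : Measurable fun z : (ℤ → Fin e → ℝ) × (ℤ → Fin e → ℝ) => R (Z (upd z)) u :=
    (h.measurable_R u).comp (hZm.comp hupdmp.measurable)
  have hBm : Measurable B := hR1.add hR2
  have hν1 : (1 : ℝ≥0∞) ≤ ENNReal.ofReal ν := by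
    rw [ENNReal.one_le_ofReal]; linarith
  have hp' : (1 : ℝ≥0∞) ≤ (1 - p⁻¹)⁻¹ := ENNReal.one_le_inv.2 tsub_le_self
  set r : ℝ≥0∞ := ENNReal.ofReal ν * (1 - p⁻¹)⁻¹ with hr
  have hr1 : 1 ≤ r := one_le_mul hν1 hp'
  have hνp1 : 1 ≤ ENNReal.ofReal ν * p := one_le_mul hν1 hp.le
  have hrs : r * ENNReal.ofReal s = ENNReal.ofReal (ν * s) * (1 - p⁻¹)⁻¹ := by
    rw [hr, ENNReal.ofReal_mul (by linarith)]
    ring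
  have hRbound : eLpNorm B (ENNReal.ofReal ν * p) μ₂ ≤ 2 * ENNReal.ofReal C_R := by
    have hRm : Measurable fun x => R (Z x) u := (h.measurable_R u).comp hZm
    have h1 : eLpNorm (fun x => R (Z x) u) (ENNReal.ofReal ν * p) (iidLaw ℤ (P.map (ε 0)))
        ≤ ENNReal.ofReal C_R := by
      rw [← eLpNorm_comp_measurePreserving hRm.aestronglyMeasurable hε.measurePreserving_innov]
      exact h.moment_R i hi u
    have h2 := eLpNorm_comp_measurePreserving (p := ENNReal.ofReal ν * p)
      hRm.aestronglyMeasurable (measurePreserving_fst (μ := iidLaw ℤ (P.map (ε 0)))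
        (ν := iidLaw ℤ (P.map (ε 0))))
    have h3 := eLpNorm_comp_measurePreserving (p := ENNReal.ofReal ν * p)
      hRm.aestronglyMeasurable hupdmp
    rw [two_mul]
    refine (eLpNorm_add_le hR1.aestronglyMeasurable hR2.aestronglyMeasurable hνp1).trans
      (add_le_add ?_ ?_)
    · exact (le_of_eq h2).trans h1
    · exact (le_of_eq h3).trans h1
  have hAbound : eLpNorm A r μ₂ ≤ d₀ * ∑ j ∈ Finset.range l, ENNReal.ofReal (L j) *
      depMeasure P ε ε' J₀ n (ENNReal.ofReal (ν * s) * (1 - p⁻¹)⁻¹) (l - j - 1) ^ s := by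
    have hAsum : A = ∑ j ∈ Finset.range l, fun z => L j * ‖Z z.1 j - Z (upd z) j‖ ^ s := by
      funext z; simp [hA]
    rw [hAsum, Finset.mul_sum]
    refine (eLpNorm_sum_le (fun j _ =>
      (((hZj j).norm.pow_const s).const_mul (L j)).aestronglyMeasurable) hr1).trans
      (Finset.sum_le_sum fun j hj => ?_)
    have hjl := Finset.mem_range.1 hj
    have h1 := eLpNorm_const_smul (L j) (fun z => ‖Z z.1 j - Z (upd z) j‖ ^ s) r μ₂
    simp only [Pi.smul_def, smul_eq_mul] at h1
    rw [h1, Real.enorm_of_nonneg (hL.L_nonneg j), mul_left_comm]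
    refine mul_le_mul_right ?_ _
    refine eLpNorm_norm_rpow_le (hZj j) hs hr1 fun a => ?_
    rw [hrs]
    exact hε.eLpNorm_update_le h.measurable_J _ (i := (i : ℤ) - 1 - j) (by omega) (l - j - 1)
      (by omega) a
  have hprod : eLpNorm (fun z => A z * B z) 2 μ₂ ≤ ENNReal.ofReal (Δ l) := by
    have := holderTriple_mul_conj (ν := ν) (by linarith) hp
    calc eLpNorm (fun z => A z * B z) 2 μ₂ ≤ eLpNorm (fun z => A z * B z) (ENNReal.ofReal ν) μ₂ := by
          refine eLpNorm_le_eLpNorm_of_exponent_le ?_ (hAm.mul hBm).aestronglyMeasurable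
          rw [show (2 : ℝ≥0∞) = ENNReal.ofReal 2 by simp]
          exact ENNReal.ofReal_le_ofReal hν
      _ ≤ eLpNorm A r μ₂ * eLpNorm B (ENNReal.ofReal ν * p) μ₂ :=
          eLpNorm_mul_le_of_holderTriple hAm hBm
      _ ≤ (d₀ * ∑ j ∈ Finset.range l, ENNReal.ofReal (L j) *
          depMeasure P ε ε' J₀ n (ENNReal.ofReal (ν * s) * (1 - p⁻¹)⁻¹) (l - j - 1) ^ s)
            * (2 * ENNReal.ofReal C_R) := mul_le_mul' hAbound hRbound
      _ ≤ ENNReal.ofReal (Δ l) := by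
          refine le_trans (le_of_eq ?_) (h.dependence l)
          ring
  refine ⟨fun z => ‖A z * B z‖ₑ, (hAm.mul hBm).enorm, ?_, ?_⟩
  · rw [eLpNorm_eq_lintegral_rpow_enorm_toReal (by norm_num) (by norm_num)] at hprod
    simp only [ENNReal.toReal_ofNat, ENNReal.rpow_ofNat] at hprod
    rwa [one_div, ENNReal.rpow_inv_le_iff (by norm_num), ENNReal.rpow_ofNat] at hprod
  · intro κ hκ f hf x y
    have hz : ∀ j ∉ Finset.range l, L j * ‖Z x j - Z (upd (x, y)) j‖ ^ s = 0 := by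
      intro j hj
      rw [Finset.mem_range, not_lt] at hj
      rw [hZeq (x, y) j hj, sub_self, norm_zero, Real.zero_rpow hs.ne', mul_zero]
    have h1 := (h.isLClass κ hκ).holder (μ κ f i) ⟨f, hf, i, hi, rfl⟩ u (Z x) (Z (upd (x, y)))
      (summable_of_ne_finset_zero hz)
    rw [tsum_eq_sum hz] at h1
    exact enorm_le_iff_norm_le.2 (h1.trans (le_abs_self _))

end Coupling

/-! ### Truncation -/

section Clip

/-- Truncation of a real number to the interval `[-M, M]`. -/
def clip (M a : ℝ) : ℝ := max (-M) (min M a)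

theorem measurable_clip (M : ℝ) : Measurable (clip M) :=
  measurable_const.max (measurable_const.min measurable_id)

theorem abs_clip_le {M : ℝ} (hM : 0 ≤ M) (a : ℝ) : |clip M a| ≤ M :=
  abs_le.2 ⟨le_max_left _ _, max_le (by linarith) (min_le_left _ _)⟩

theorem abs_clip_sub_clip_le (M a b : ℝ) : |clip M a - clip M b| ≤ |a - b| := by
  unfold clip
  refine (abs_max_sub_max_le_max _ _ _ _).trans (max_le (by simp) ?_)
  exact (abs_min_sub_min_le_max _ _ _ _).trans (max_le (by simp) le_rfl)

theorem clip_of_abs_le {M a : ℝ} (h : |a| ≤ M) : clip M a = a := by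
  have := abs_le.1 h
  rw [clip, min_eq_right this.2, max_eq_right this.1]

theorem abs_clip_le_abs {M : ℝ} (hM : 0 ≤ M) (a : ℝ) : |clip M a| ≤ |a| := by
  have h := abs_clip_sub_clip_le M a 0
  rwa [clip_of_abs_le (a := 0) (by simpa using hM), sub_zero, sub_zero] at h

theorem clip_sq_le {M : ℝ} (hM : 0 ≤ M) (a : ℝ) : clip M a ^ 2 ≤ a ^ 2 :=
  sq_le_sq.2 (abs_clip_le_abs hM a)

theorem abs_clip {M : ℝ} (hM : 0 ≤ M) (a : ℝ) : |clip M a| = min M |a| := by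
  rcases le_total |a| M with h | h
  · rw [clip_of_abs_le h, min_eq_right h]
  · rw [min_eq_left h, clip]
    rcases abs_cases a with ⟨h1, h2⟩ | ⟨h1, h2⟩ <;> rw [h1] at h
    · rw [min_eq_left h, max_eq_right (by linarith), abs_of_nonneg hM]
    · rw [min_eq_right (by linarith), max_eq_left (by linarith), abs_neg, abs_of_nonneg hM]

theorem clip_sq {M : ℝ} (hM : 0 ≤ M) (a : ℝ) : clip M a ^ 2 = min (M ^ 2) (a ^ 2) := by
  rw [← sq_abs, abs_clip hM, ← sq_abs a]
  rcases le_total M |a| with h | h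
  · rw [min_eq_left h, min_eq_left (pow_le_pow_left₀ hM h 2)]
  · rw [min_eq_right h, min_eq_right (pow_le_pow_left₀ (abs_nonneg a) h 2)]

theorem abs_sub_clip_le {M a b : ℝ} (hM : 0 ≤ M) (hab : |a| ≤ b) :
    |a - clip M a| ≤ max (b - M) 0 := by
  have := abs_le.1 hab
  rcases le_total |a| M with h | h
  · rw [clip_of_abs_le h, sub_self, abs_zero]; exact le_max_right _ _
  · refine le_trans ?_ (le_max_left _ _)
    rcases le_total 0 a with h0 | h0
    · rw [abs_of_nonneg h0] at h hab
      rw [clip, min_eq_left h, max_eq_right (by linarith), abs_of_nonneg (by linarith)]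
      linarith
    · rw [abs_of_nonpos h0] at h hab
      rw [clip, min_eq_right (by linarith), max_eq_left (by linarith), abs_of_nonpos (by linarith)]
      linarith

end Clip

section EnvelopeTail

variable {Ω : Type*} [MeasurableSpace Ω] {P : Measure Ω}

theorem sum_sq_le_of_avgNorm_le {n : ℕ} (hn : 1 ≤ n) {b : ℕ → ℝ} (hb : ∀ i, 0 ≤ b i) {c : ℝ}
    (hc : 0 ≤ c) (h : avgNorm 2 n (fun i => ENNReal.ofReal (b i)) ≤ ENNReal.ofReal c) :
    ∑ i ∈ Finset.Icc 1 n, b i ^ 2 ≤ n * c ^ 2 := by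
  have hn0 : (0 : ℝ) < n := by exact_mod_cast hn
  simp only [avgNorm, ENNReal.ofNat_ne_top, if_false, ENNReal.toReal_ofNat, one_div] at h
  rw [ENNReal.rpow_inv_le_iff (by norm_num)] at h
  simp only [ENNReal.rpow_ofNat] at h
  rw [ENNReal.div_le_iff (by exact_mod_cast (by omega : n ≠ 0)) (by simp)] at h
  simp only [← ENNReal.ofReal_pow (hb _), ← ENNReal.ofReal_pow hc] at h
  rw [← ENNReal.ofReal_sum_of_nonneg fun i _ => by positivity, ← ENNReal.ofReal_natCast,
    ← ENNReal.ofReal_mul (by positivity), ENNReal.ofReal_le_ofReal_iff (by positivity)] at h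
  linarith

/-- With `n^{1/ν₂} C c ≤ M`, the excesses of the envelope over `M` are negligible: their expected
sum is at most `M`. -/
theorem sum_integral_excess_le {n : ℕ} (hn : 1 ≤ n) {ν₂ : ℝ≥0∞} (hν₂ : 2 ≤ ν₂) {F : ℕ → Ω → ℝ}
    (hF : ∀ i, Measurable (F i)) (hF0 : ∀ i ω, 0 ≤ F i ω) {b : ℕ → ℝ} (hb : ∀ i, 0 ≤ b i) {C c : ℝ}
    (hC : 0 ≤ C) (hc : 0 ≤ c)
    (hFb : ∀ i ∈ Finset.Icc 1 n, eLpNorm (F i) ν₂ P ≤ ENNReal.ofReal (b i * C))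
    (hbc : avgNorm ν₂ n (fun i => ENNReal.ofReal (b i)) ≤ ENNReal.ofReal c) {M : ℝ} (hM : 0 < M)
    (hMc : (n : ℝ) ^ (1 / ν₂).toReal * C * c ≤ M) :
    ∑ i ∈ Finset.Icc 1 n, ∫ ω, max (F i ω - M) 0 ∂P ≤ M := by
  have hn0 : (0 : ℝ) < n := by exact_mod_cast hn
  rcases eq_or_ne ν₂ ∞ with rfl | htop
  · rw [Finset.sum_eq_zero]
    · exact hM.le
    intro i hi
    simp only [avgNorm, if_true] at hbc
    have h1 : b i ≤ c := (ENNReal.ofReal_le_ofReal_iff hc).1 ((le_iSup₂_of_le i hi le_rfl).trans hbc)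
    have h2 : b i * C ≤ M := by
      refine le_trans ?_ hMc
      simp only [ENNReal.div_top, ENNReal.toReal_zero, Real.rpow_zero, one_mul]
      rw [mul_comm]
      exact mul_le_mul_of_nonneg_left h1 hC
    have h3 : ∀ᵐ ω ∂P, ‖F i ω‖ₑ ≤ ENNReal.ofReal (b i * C) := by
      have := hFb i hi
      rw [eLpNorm_exponent_top] at this
      filter_upwards [ae_le_eLpNormEssSup (f := F i) (μ := P)] with ω hω using hω.trans this
    rw [integral_eq_zero_of_ae]
    filter_upwards [h3] with ω hω
    rw [Real.enorm_of_nonneg (hF0 i ω), ENNReal.ofReal_le_ofReal_iff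
      (mul_nonneg (hb i) hC)] at hω
    simp only [Pi.zero_apply]
    exact max_eq_right (by linarith)
  · set q := ν₂.toReal with hq
    have hν0 : ν₂ ≠ 0 := (lt_of_lt_of_le (by norm_num) hν₂).ne'
    have hq2 : 2 ≤ q := by
      rw [hq, ← ENNReal.toReal_ofNat]
      exact ENNReal.toReal_mono htop hν₂
    have hq0 : 0 < q := by linarith
    have hexp : (1 / ν₂).toReal = 1 / q := by rw [ENNReal.toReal_div]; simp [hq]
    have hmom : ∀ i ∈ Finset.Icc 1 n, Integrable (fun ω => F i ω ^ q) P ∧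
        ∫ ω, F i ω ^ q ∂P ≤ (b i * C) ^ q := by
      intro i hi
      have hLp : MemLp (F i) ν₂ P :=
        ⟨(hF i).aestronglyMeasurable, (hFb i hi).trans_lt ENNReal.ofReal_lt_top⟩
      have h1 := hLp.integrable_norm_rpow hν0 htop
      have h2 := hFb i hi
      rw [hLp.eLpNorm_eq_integral_rpow_norm hν0 htop,
        ENNReal.ofReal_le_ofReal_iff (mul_nonneg (hb i) hC)] at h2
      simp only [Real.norm_of_nonneg (hF0 i _)] at h1 h2
      refine ⟨h1, ?_⟩
      have h3 : 0 ≤ ∫ ω, F i ω ^ q ∂P := integral_nonneg fun ω => Real.rpow_nonneg (hF0 i ω) _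
      have h4 := Real.rpow_le_rpow (Real.rpow_nonneg h3 _) h2 hq0.le
      rwa [← Real.rpow_mul h3, inv_mul_cancel₀ hq0.ne', Real.rpow_one] at h4
    have hsum : ∑ i ∈ Finset.Icc 1 n, b i ^ q ≤ n * c ^ q := by
      simp only [avgNorm, htop, if_false, one_div, ← hq] at hbc
      rw [ENNReal.rpow_inv_le_iff hq0, ENNReal.div_le_iff
        (by exact_mod_cast (by omega : n ≠ 0)) (by simp)] at hbc
      simp only [ENNReal.ofReal_rpow_of_nonneg (hb _) hq0.le,
        ENNReal.ofReal_rpow_of_nonneg hc hq0.le] at hbc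
      rw [← ENNReal.ofReal_sum_of_nonneg fun i _ => Real.rpow_nonneg (hb i) _,
        ← ENNReal.ofReal_natCast, ← ENNReal.ofReal_mul (by positivity),
        ENNReal.ofReal_le_ofReal_iff (by positivity)] at hbc
      linarith
    have hpt : ∀ i ω, max (F i ω - M) 0 ≤ M ^ (1 - q) * F i ω ^ q := by
      intro i ω
      refine max_le ?_ (mul_nonneg (Real.rpow_nonneg hM.le _) (Real.rpow_nonneg (hF0 i ω) _))
      rcases le_total (F i ω) M with h | h
      · have := mul_nonneg (Real.rpow_nonneg hM.le (1 - q)) (Real.rpow_nonneg (hF0 i ω) q)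
        linarith
      · have hFpos : 0 < F i ω := hM.trans_le h
        have h1 : F i ω ^ (1 - q) ≤ M ^ (1 - q) :=
          Real.rpow_le_rpow_of_nonpos hM h (by linarith)
        calc F i ω - M ≤ F i ω := by linarith
          _ = F i ω ^ (1 - q) * F i ω ^ q := by
              rw [← Real.rpow_add hFpos]; simp
          _ ≤ _ := mul_le_mul_of_nonneg_right h1 (Real.rpow_nonneg (hF0 i ω) _)
    calc ∑ i ∈ Finset.Icc 1 n, ∫ ω, max (F i ω - M) 0 ∂P
        ≤ ∑ i ∈ Finset.Icc 1 n, M ^ (1 - q) * (b i ^ q * C ^ q) := by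
          refine Finset.sum_le_sum fun i hi => ?_
          rw [← Real.mul_rpow (hb i) hC]
          refine le_trans ?_ (mul_le_mul_of_nonneg_left (hmom i hi).2 (Real.rpow_nonneg hM.le _))
          rw [← integral_const_mul]
          exact integral_mono_of_nonneg (ae_of_all _ fun ω => le_max_right _ _)
            ((hmom i hi).1.const_mul _) (ae_of_all _ (hpt i))
      _ = M ^ (1 - q) * C ^ q * ∑ i ∈ Finset.Icc 1 n, b i ^ q := by
          rw [Finset.mul_sum]
          exact Finset.sum_congr rfl fun i _ => by ring
      _ ≤ M ^ (1 - q) * C ^ q * (n * c ^ q) :=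
          mul_le_mul_of_nonneg_left hsum
            (mul_nonneg (Real.rpow_nonneg hM.le _) (Real.rpow_nonneg hC _))
      _ = M ^ (1 - q) * ((n : ℝ) ^ (1 / q) * C * c) ^ q := by
          rw [Real.mul_rpow (by positivity) hc, Real.mul_rpow (by positivity) hC,
            ← Real.rpow_mul hn0.le, one_div, inv_mul_cancel₀ hq0.ne', Real.rpow_one]
          ring
      _ ≤ M ^ (1 - q) * M ^ q := by
          rw [hexp] at hMc
          refine mul_le_mul_of_nonneg_left ?_ (Real.rpow_nonneg hM.le _)
          exact Real.rpow_le_rpow (by positivity) hMc hq0.le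
      _ = M := by rw [← Real.rpow_add hM]; simp

end EnvelopeTail

/-! ### The martingale part of the truncated sum -/

section Martingale

variable {Ω : Type*} [mΩ : MeasurableSpace Ω] {P : Measure Ω} [IsProbabilityMeasure P]

/-- The conditional expectation has the same integral against bounded weights. -/
theorem integral_mul_condExp_of_abs_le {m : MeasurableSpace Ω} (hm : m ≤ mΩ) {W g : Ω → ℝ} {C : ℝ}
    (hW : Measurable[m] W) (hC : ∀ x, |W x| ≤ C) (hg : Integrable g P) :
    ∫ x, W x * g x ∂P = ∫ x, W x * (P[g|m]) x ∂P := by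
  have hWg : Integrable (W * g) P :=
    hg.bdd_mul (hW.mono hm le_rfl).aestronglyMeasurable (ae_of_all _ hC)
  have h := condExp_mul_of_stronglyMeasurable_left hW.stronglyMeasurable hWg hg
  calc ∫ x, W x * g x ∂P = ∫ x, (P[W * g|m]) x ∂P := (integral_condExp hm).symm
    _ = _ := integral_congr_ae h

theorem integrable_clip_comp {g : Ω → ℝ} (hg : Measurable g) {M : ℝ} (hM : 0 ≤ M) :
    Integrable (fun x => clip M (g x)) P :=
  integrable_of_abs_le ((measurable_clip M).comp hg) fun x => abs_clip_le hM (g x)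

/-- Freedman's inequality for truncated variables, with the predictable quadratic variation
replaced by the larger sum of conditional second moments. -/
theorem measureReal_abs_sum_clip_sub_condExp_ge_le {𝒢 : ℕ → MeasurableSpace Ω}
    (hmono : ∀ i, 𝒢 i ≤ 𝒢 (i + 1)) (hle : ∀ i, 𝒢 i ≤ mΩ) {Y : ℕ → Ω → ℝ}
    (hY : ∀ i, Measurable[𝒢 (i + 1)] (Y i)) {M : ℝ} (hM : 0 ≤ M) {l : ℝ} (hl0 : 0 ≤ l)
    (hl : l * (2 * M) ≤ 1) (t T : ℝ) (N : ℕ) :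
    P.real {x | t ≤ |∑ i ∈ Finset.range N,
        (clip M (Y i x) - (P[fun y => clip M (Y i y)|𝒢 i]) x)| ∧
        ∑ i ∈ Finset.range N, (P[fun y => clip M (Y i y) ^ 2|𝒢 i]) x ≤ T}
      ≤ 2 * Real.exp (l ^ 2 * T - l * t) := by
  set X : ℕ → Ω → ℝ := fun i x => clip M (Y i x) with hXdef
  have hX : ∀ i, Measurable[𝒢 (i + 1)] (X i) := fun i => (measurable_clip M).comp (hY i)
  have hXb : ∀ i, Measurable (X i) := fun i => (hX i).mono (hle _) le_rfl
  have hXM : ∀ i x, |X i x| ≤ M := fun i x => abs_clip_le hM _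
  have hX2M : ∀ i x, |X i x ^ 2| ≤ M ^ 2 := fun i x => by
    rw [abs_pow]; exact pow_le_pow_left₀ (abs_nonneg _) (hXM i x) 2
  have hXi : ∀ i, Integrable (X i) P := fun i => integrable_of_abs_le (hXb i) (hXM i)
  have hX2i : ∀ i, Integrable (fun x => X i x ^ 2) P := fun i =>
    integrable_of_abs_le ((hXb i).pow_const 2) (hX2M i)
  -- versions of the conditional moments that are bounded everywhere
  set m : ℕ → Ω → ℝ := fun i x => clip M ((P[X i|𝒢 i]) x) with hmdef
  set v : ℕ → Ω → ℝ := fun i x => max 0 (min (M ^ 2) ((P[fun y => X i y ^ 2|𝒢 i]) x)) with hvdef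
  have hm : ∀ i, Measurable[𝒢 i] (m i) := fun i =>
    (measurable_clip M).comp stronglyMeasurable_condExp.measurable
  have hv : ∀ i, Measurable[𝒢 i] (v i) := fun i =>
    measurable_const.max (measurable_const.min stronglyMeasurable_condExp.measurable)
  have hmae : ∀ i, m i =ᵐ[P] P[X i|𝒢 i] := fun i => by
    filter_upwards [ae_bdd_abs_condExp_of_ae_bdd_abs (m := 𝒢 i) (R := M)
      (ae_of_all P (hXM i))] with x hx
    exact clip_of_abs_le hx
  have hvae : ∀ i, v i =ᵐ[P] P[fun y => X i y ^ 2|𝒢 i] := fun i => by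
    filter_upwards [ae_bdd_abs_condExp_of_ae_bdd_abs (m := 𝒢 i) (R := M ^ 2)
      (ae_of_all P (hX2M i)), condExp_nonneg (μ := P) (m := 𝒢 i) (f := fun y => X i y ^ 2)
        (ae_of_all _ fun x => sq_nonneg (X i x))] with x hx hx0
    have h1 := (abs_le.1 hx).2
    have h0 : 0 ≤ (P[fun y => X i y ^ 2|𝒢 i]) x := hx0
    simp only [hvdef]
    rw [min_eq_right h1, max_eq_right h0]
  have hv0 : ∀ i x, 0 ≤ v i x := fun i x => le_max_left _ _
  have hvM : ∀ i x, v i x ≤ M ^ 2 := fun i x => max_le (sq_nonneg M) (min_le_left _ _)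
  have hmX : ∀ i (W : Ω → ℝ) (C : ℝ), Measurable[𝒢 i] W → (∀ x, |W x| ≤ C) →
      ∫ x, W x * X i x ∂P = ∫ x, W x * m i x ∂P := fun i W C hW hC => by
    rw [integral_mul_condExp_of_abs_le (hle i) hW hC (hXi i)]
    refine integral_congr_ae ?_
    filter_upwards [hmae i] with x hx
    rw [hx]
  have hvX : ∀ i (W : Ω → ℝ) (C : ℝ), Measurable[𝒢 i] W → (∀ x, |W x| ≤ C) →
      ∫ x, W x * X i x ^ 2 ∂P = ∫ x, W x * v i x ∂P := fun i W C hW hC => by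
    rw [integral_mul_condExp_of_abs_le (g := fun x => X i x ^ 2) (hle i) hW hC (hX2i i)]
    refine integral_congr_ae ?_
    filter_upwards [hvae i] with x hx
    rw [hx]
  have hmM : ∀ i x, |m i x| ≤ M := fun i x => abs_clip_le hM _
  have hmb : ∀ i, Measurable (m i) := fun i => (hm i).mono (hle _) le_rfl
  have hvb : ∀ i, Measurable (v i) := fun i => (hv i).mono (hle _) le_rfl
  have key : P.real {x | t ≤ |∑ i ∈ Finset.range N, (X i x - m i x)| ∧
      ∑ i ∈ Finset.range N, v i x ≤ T} ≤ 2 * (1 * Real.exp (l ^ 2 * T - l * t)) := by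
    refine measureReal_abs_ge_le hl0 (fun s => ?_) fun s hs => ?_
    · refine integrable_exp_of_abs_le (C := |s| * (N * (2 * M)) + l ^ 2 * (N * M ^ 2)) ?_ fun x => ?_
      · exact ((Finset.measurable_fun_sum _ fun i _ => (hXb i).sub (hmb i)).const_mul s).sub
          ((Finset.measurable_fun_sum _ fun i _ => hvb i).const_mul _)
      · have h1 : |∑ i ∈ Finset.range N, (X i x - m i x)| ≤ N * (2 * M) := by
          refine (Finset.abs_sum_le_sum_abs _ _).trans ?_
          refine (Finset.sum_le_card_nsmul _ _ (2 * M) fun i _ => ?_).trans_eq (by simp)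
          exact (abs_sub _ _).trans (by linarith [hXM i x, hmM i x])
        have h2 : |∑ i ∈ Finset.range N, v i x| ≤ N * M ^ 2 := by
          refine (Finset.abs_sum_le_sum_abs _ _).trans ?_
          refine (Finset.sum_le_card_nsmul _ _ (M ^ 2) fun i _ => ?_).trans_eq (by simp)
          rw [abs_of_nonneg (hv0 i x)]; exact hvM i x
        refine (abs_sub _ _).trans ?_
        rw [abs_mul, abs_mul, abs_of_nonneg (sq_nonneg l)]
        gcongr
    · exact integral_exp_martingale_le hmono hle hX hm hv hXM hmM hv0 hvM hmX hvX
        (l := s) (by rwa [hs]) N |> fun h => by rwa [show s ^ 2 = l ^ 2 by rw [← sq_abs, hs]] at h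
  rw [one_mul] at key
  refine le_trans (le_of_eq (measureReal_congr ?_)) key
  have hall : ∀ᵐ x ∂P, ∀ i, m i x = (P[X i|𝒢 i]) x ∧ v i x = (P[fun y => X i y ^ 2|𝒢 i]) x :=
    ae_all_iff.2 fun i => (hmae i).and (hvae i)
  filter_upwards [hall] with x hx
  refine propext ?_
  show (_ ∧ _) ↔ (_ ∧ _)
  simp only [fun i => (hx i).1, fun i => (hx i).2]
  exact Iff.rfl

/-- Truncation commutes with the conditional expectation up to the conditional mean of the excess
of the envelope over the truncation level. -/
theorem abs_condExp_clip_sub_clip_condExp_le {m : MeasurableSpace Ω} {Y F : Ω → ℝ}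
    (hY : Measurable[mΩ] Y) (hYi : Integrable Y P) {M : ℝ} (hM : 0 ≤ M) (hm : m ≤ mΩ)
    (hYF : ∀ x, |Y x| ≤ F x) (he : Integrable (fun x => max (F x - M) 0) P) :
    ∀ᵐ x ∂P, |(P[fun y => clip M (Y y)|m]) x - clip M ((P[Y|m]) x)|
        ≤ 2 * (P[fun y => max (F y - M) 0|m]) x ∧
      |(P[Y|m]) x - clip M ((P[Y|m]) x)| ≤ (P[fun y => max (F y - M) 0|m]) x := by
  have hXi := integrable_clip_comp (mΩ := mΩ) (P := P) hY hM
  have hdiff : ∀ x, |Y x - clip M (Y x)| ≤ max (F x - M) 0 := fun x => abs_sub_clip_le hM (hYF x)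
  have hYM : ∀ x, |Y x| ≤ M + max (F x - M) 0 := fun x => by
    have := le_max_left (F x - M) 0
    linarith [hYF x]
  have h1 := condExp_mono (m := m) (hYi.sub hXi) he
    (ae_of_all P fun x => (abs_le.1 (hdiff x)).2)
  have h2 := condExp_mono (m := m) he.neg (hYi.sub hXi)
    (ae_of_all P fun x => (abs_le.1 (hdiff x)).1)
  have h3 := condExp_mono (m := m) hYi ((integrable_const M).add he)
    (ae_of_all P fun x => (abs_le.1 (hYM x)).2)
  have h4 := condExp_mono (m := m) ((integrable_const M).add he).neg hYi
    (ae_of_all P fun x => (abs_le.1 (hYM x)).1)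
  have h5 := condExp_add (μ := P) (integrable_const M) he m
  have h6 := condExp_neg (μ := P) ((fun _ => M) + fun x => max (F x - M) 0) m
  have h7 := condExp_neg (μ := P) (fun x => max (F x - M) 0) m
  have h8 := condExp_sub (μ := P) hYi hXi m
  have h9 : P[fun _ => M|m] = fun _ => M := condExp_const hm M
  have h10 := condExp_nonneg (μ := P) (m := m) (f := fun x => max (F x - M) 0)
    (ae_of_all P fun x => le_max_right _ _)
  filter_upwards [h1, h2, h3, h4, h5, h6, h7, h8, h10] with x h1 h2 h3 h4 h5 h6 h7 h8 h10
  simp only [Pi.add_apply, Pi.sub_apply, Pi.neg_apply, Pi.zero_apply, h9] at h1 h2 h3 h4 h5 h6 h7 h8 h10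
  have hW : |(P[Y|m]) x| ≤ M + (P[fun y => max (F y - M) 0|m]) x :=
    abs_le.2 ⟨by linarith, by linarith⟩
  have hclip := abs_sub_clip_le hM hW
  rw [add_sub_cancel_left, max_eq_left h10] at hclip
  have hX : |(P[fun y => clip M (Y y)|m]) x - (P[Y|m]) x|
      ≤ (P[fun y => max (F y - M) 0|m]) x := abs_le.2 ⟨by linarith, by linarith⟩
  refine ⟨?_, hclip⟩
  have := abs_sub_le ((P[fun y => clip M (Y y)|m]) x) ((P[Y|m]) x) (clip M ((P[Y|m]) x))
  linarith

/-- Decomposition of the centred sum into a martingale, a smooth part and the effect of the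
truncation.  The hypotheses `hsmooth` and `hsq` are tail bounds for the truncated conditional first
and second moments. -/
theorem measureReal_exists_abs_sum_ge_le {ι : Type*} [Fintype ι] {𝒢 : ℕ → MeasurableSpace Ω}
    (hmono : ∀ i, 𝒢 i ≤ 𝒢 (i + 1)) (hle : ∀ i, 𝒢 i ≤ mΩ) {N : ℕ} {Y : ι → ℕ → Ω → ℝ}
    (hY : ∀ f i, Measurable[𝒢 (i + 1)] (Y f i)) (hY2 : ∀ f, ∀ i < N, MemLp (Y f i) 2 P) {M : ℝ}
    (hM : 0 ≤ M) {F : ℕ → Ω → ℝ} (hYF : ∀ f i x, |Y f i x| ≤ F i x)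
    (he : ∀ i < N, Integrable (fun x => max (F i x - M) 0) P) {τ : ℝ}
    (hτ : ∑ i ∈ Finset.range N, ∫ x, max (F i x - M) 0 ∂P ≤ τ) {w₁ w₂ : ι → ℕ → Ω → ℝ}
    (hw₁ : ∀ f, ∀ i < N, w₁ f i =ᵐ[P] fun x => clip M ((P[Y f i|𝒢 i]) x))
    (hw₂ : ∀ f, ∀ i < N,
      ∀ᵐ x ∂P, w₂ f i x ^ 2 = min (M ^ 2) ((P[fun y => Y f i y ^ 2|𝒢 i]) x))
    {t T p₁ p₂ : ℝ} (ht : 0 < t)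
    (hsmooth : P.real {x | ∃ f, 2 * t ≤ |∑ i ∈ Finset.range N, (w₁ f i x - ∫ y, w₁ f i y ∂P)|}
      ≤ p₁)
    (hsq : P.real {x | ∃ f, T ≤ ∑ i ∈ Finset.range N, w₂ f i x ^ 2} ≤ p₂) {l : ℝ} (hl0 : 0 ≤ l)
    (hl : l * (2 * M) ≤ 1) :
    P.real {x | ∃ f, 4 * t ≤ |∑ i ∈ Finset.range N, (Y f i x - ∫ y, Y f i y ∂P)|}
      ≤ Fintype.card ι * (2 * Real.exp (l ^ 2 * T - l * t)) + p₂ + p₁ + 4 * τ / t := by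
  have hYb : ∀ f i, Measurable (Y f i) := fun f i => (hY f i).mono (hle _) le_rfl
  have hYi : ∀ f, ∀ i < N, Integrable (Y f i) P := fun f i hi =>
    (hY2 f i hi).integrable (by norm_num)
  have hXi : ∀ f i, Integrable (fun x => clip M (Y f i x)) P := fun f i =>
    integrable_clip_comp (hYb f i) hM
  set e : ℕ → Ω → ℝ := fun i x => max (F i x - M) 0 with hedef
  set R : Ω → ℝ := fun x => ∑ i ∈ Finset.range N,
    (e i x + 2 * (P[e i|𝒢 i]) x + ∫ y, e i y ∂P) with hR
  have hRi : ∀ i < N, Integrable (fun x => e i x + 2 * (P[e i|𝒢 i]) x + ∫ y, e i y ∂P) P :=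
    fun i hi => ((he i hi).add (integrable_condExp.const_mul 2)).add (integrable_const _)
  have hRint : Integrable R P :=
    integrable_finsetSum _ fun i hi => hRi i (Finset.mem_range.1 hi)
  have he0 : ∀ᵐ x ∂P, ∀ i, 0 ≤ (P[e i|𝒢 i]) x := ae_all_iff.2 fun i =>
    condExp_nonneg (ae_of_all _ fun x => le_max_right _ _)
  have hRnn : 0 ≤ᵐ[P] R := by
    filter_upwards [he0] with x hx
    refine Finset.sum_nonneg fun i _ => ?_
    have h1 : 0 ≤ e i x := le_max_right _ _
    have h2 : 0 ≤ ∫ y, e i y ∂P := integral_nonneg fun y => le_max_right _ _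
    have h3 := hx i
    positivity
  have hRtail : P.real {x | t ≤ R x} ≤ 4 * τ / t := by
    refine measureReal_ge_le_div hRnn hRint ht ?_
    rw [hR, integral_finsetSum _ fun i hi => hRi i (Finset.mem_range.1 hi)]
    calc ∑ i ∈ Finset.range N, ∫ x, (e i x + 2 * (P[e i|𝒢 i]) x + ∫ y, e i y ∂P) ∂P
        = ∑ i ∈ Finset.range N, 4 * ∫ x, e i x ∂P := by
          refine Finset.sum_congr rfl fun i hi => ?_
          have hi' := Finset.mem_range.1 hi
          have h1 := integral_add (μ := P) ((he i hi').add
            ((integrable_condExp (f := e i) (m := 𝒢 i)).const_mul 2)) (integrable_const (∫ y, e i y ∂P))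
          have h2 := integral_add (μ := P) (he i hi')
            ((integrable_condExp (f := e i) (m := 𝒢 i)).const_mul 2)
          simp only [Pi.add_apply] at h1
          rw [h1, h2, integral_const_mul, integral_condExp (hle i), integral_const]
          simp only [probReal_univ, one_smul]
          ring
      _ = 4 * ∑ i ∈ Finset.range N, ∫ x, e i x ∂P := (Finset.mul_sum _ _ _).symm
      _ ≤ 4 * τ := by linarith
  set A : ι → Set Ω := fun f => {x | t ≤ |∑ i ∈ Finset.range N,
        (clip M (Y f i x) - (P[fun y => clip M (Y f i y)|𝒢 i]) x)| ∧
        ∑ i ∈ Finset.range N, (P[fun y => clip M (Y f i y) ^ 2|𝒢 i]) x ≤ T} with hA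
  have hAtail : P.real {x | ∃ f, x ∈ A f}
      ≤ Fintype.card ι * (2 * Real.exp (l ^ 2 * T - l * t)) :=
    measureReal_exists_le fun f =>
      measureReal_abs_sum_clip_sub_condExp_ge_le hmono hle (hY f) hM hl0 hl t T N
  -- almost sure comparisons
  have hcomp : ∀ᵐ x ∂P, ∀ f, ∀ i < N,
      (|(P[fun y => clip M (Y f i y)|𝒢 i]) x - clip M ((P[Y f i|𝒢 i]) x)|
        ≤ 2 * (P[e i|𝒢 i]) x) ∧ w₁ f i x = clip M ((P[Y f i|𝒢 i]) x) ∧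
      (P[fun y => clip M (Y f i y) ^ 2|𝒢 i]) x ≤ w₂ f i x ^ 2 := by
    rw [ae_all_iff]
    intro f
    rw [ae_all_iff]
    intro i
    by_cases hi : i < N
    · have hX2 : Integrable (fun y => clip M (Y f i y) ^ 2) P :=
        integrable_of_abs_le (((measurable_clip M).comp (hYb f i)).pow_const 2) (C := M ^ 2)
          fun x => by
            rw [abs_pow]
            exact pow_le_pow_left₀ (abs_nonneg _) (abs_clip_le hM _) 2
      have h1 := condExp_mono (m := 𝒢 i) hX2 (hY2 f i hi).integrable_sq
        (ae_of_all P fun x => clip_sq_le hM (Y f i x))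
      have h2 := condExp_mono (m := 𝒢 i) hX2 (integrable_const (M ^ 2))
        (ae_of_all P fun x => sq_le_sq' (by linarith [(abs_le.1 (abs_clip_le hM (Y f i x))).1])
          (abs_le.1 (abs_clip_le hM (Y f i x))).2)
      rw [condExp_const (hle i)] at h2
      filter_upwards [abs_condExp_clip_sub_clip_condExp_le (hYb f i) (hYi f i hi) hM (hle i)
        (hYF f i) (he i hi), hw₁ f i hi, hw₂ f i hi, h1, h2] with x hx1 hx2 hx3 hx4 hx5
      exact fun _ => ⟨hx1.1, hx2, by rw [hx3]; exact le_min hx5 hx4⟩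
    · exact ae_of_all _ fun x h => absurd h hi
  -- the centring of the smooth part
  have hmean : ∀ f, ∀ i < N, |∫ y, Y f i y ∂P - ∫ y, w₁ f i y ∂P| ≤ ∫ y, e i y ∂P := by
    intro f i hi
    have hci : Integrable (fun x => clip M ((P[Y f i|𝒢 i]) x)) P :=
      integrable_clip_comp (stronglyMeasurable_condExp.measurable.mono (hle i) le_rfl) hM
    rw [integral_congr_ae (hw₁ f i hi), ← integral_condExp (f := Y f i) (hle i),
      ← integral_condExp (f := e i) (hle i), ← integral_sub integrable_condExp hci]
    refine abs_integral_le_integral_abs.trans (integral_mono_ae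
      (integrable_condExp.sub hci).abs integrable_condExp ?_)
    filter_upwards [abs_condExp_clip_sub_clip_condExp_le (hYb f i) (hYi f i hi) hM (hle i)
        (hYF f i) (he i hi)] with x hx
    exact hx.2
  have hsub : ∀ᵐ x ∂P, x ∈ {x | ∃ f, 4 * t ≤ |∑ i ∈ Finset.range N, (Y f i x - ∫ y, Y f i y ∂P)|} →
      x ∈ ({x | ∃ f, x ∈ A f} ∪ {x | ∃ f, T ≤ ∑ i ∈ Finset.range N, w₂ f i x ^ 2}) ∪
        ({x | ∃ f, 2 * t ≤ |∑ i ∈ Finset.range N, (w₁ f i x - ∫ y, w₁ f i y ∂P)|} ∪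
          {x | t ≤ R x}) := by
    filter_upwards [hcomp] with x hx
    rintro ⟨f, hf⟩
    by_contra hcon
    simp only [Set.mem_union, Set.mem_ofPred_eq, not_or, not_exists, not_le] at hcon
    obtain ⟨⟨hc1, hc2⟩, hc3, hc4⟩ := hcon
    have hvar : ∑ i ∈ Finset.range N, (P[fun y => clip M (Y f i y) ^ 2|𝒢 i]) x ≤ T :=
      (Finset.sum_le_sum fun i hi => (hx f i (Finset.mem_range.1 hi)).2.2).trans (hc2 f).le
    have hmart : |∑ i ∈ Finset.range N,
        (clip M (Y f i x) - (P[fun y => clip M (Y f i y)|𝒢 i]) x)| < t := by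
      by_contra h
      exact hc1 f ⟨not_lt.1 h, hvar⟩
    have hrem : |∑ i ∈ Finset.range N, ((Y f i x - clip M (Y f i x))
        + ((P[fun y => clip M (Y f i y)|𝒢 i]) x - w₁ f i x)
        + (∫ y, w₁ f i y ∂P - ∫ y, Y f i y ∂P))| ≤ R x := by
      refine (Finset.abs_sum_le_sum_abs _ _).trans (Finset.sum_le_sum fun i hi => ?_)
      have hi' := Finset.mem_range.1 hi
      refine (abs_add_three _ _ _).trans (add_le_add (add_le_add ?_ ?_) ?_)
      · exact abs_sub_clip_le hM (hYF f i x)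
      · rw [(hx f i hi').2.1]
        exact (hx f i hi').1
      · rw [abs_sub_comm]
        exact hmean f i hi'
    have hdec : ∑ i ∈ Finset.range N, (Y f i x - ∫ y, Y f i y ∂P)
        = ∑ i ∈ Finset.range N,
            (clip M (Y f i x) - (P[fun y => clip M (Y f i y)|𝒢 i]) x)
          + ∑ i ∈ Finset.range N, (w₁ f i x - ∫ y, w₁ f i y ∂P)
          + ∑ i ∈ Finset.range N, ((Y f i x - clip M (Y f i x))
            + ((P[fun y => clip M (Y f i y)|𝒢 i]) x - w₁ f i x)
            + (∫ y, w₁ f i y ∂P - ∫ y, Y f i y ∂P)) := by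
      rw [← Finset.sum_add_distrib, ← Finset.sum_add_distrib]
      exact Finset.sum_congr rfl fun i _ => by ring
    rw [hdec] at hf
    have := hf.trans (abs_add_three _ _ _)
    linarith [hc3 f]
  refine (ENNReal.toReal_mono (measure_ne_top _ _) (measure_mono_ae hsub)).trans ((measureReal_union_le _ _).trans ?_)
  have h1 := measureReal_union_le (μ := P) {x | ∃ f, x ∈ A f}
    {x | ∃ f, T ≤ ∑ i ∈ Finset.range N, w₂ f i x ^ 2}
  have h2 := measureReal_union_le (μ := P)
    {x | ∃ f, 2 * t ≤ |∑ i ∈ Finset.range N, (w₁ f i x - ∫ y, w₁ f i y ∂P)|} {x | t ≤ R x}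
  linarith

end Martingale

/-! ### The conditional moments as functions of the innovations -/

section Past

variable {Ω : Type*} {e d : ℕ}

theorem pastSigma_mono (ε : ℤ → Ω → Fin e → ℝ) : Monotone (pastSigma ε) := fun _ _ hij =>
  iSup_mono fun _ => iSup_const_mono fun h => h.trans hij

theorem measurable_hist_pastSigma (ε : ℤ → Ω → Fin e → ℝ) {J : ℤ → Hist e → Fin d → ℝ}
    (hJ : ∀ i, Measurable (J i)) (i : ℤ) : Measurable[pastSigma ε i] (hist ε J i) := by
  refine @measurable_pi_lambda _ _ _ (pastSigma ε i) _ _ fun j => (hJ _).comp ?_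
  refine @measurable_pi_lambda _ _ _ (pastSigma ε i) _ _ fun l => ?_
  exact (comap_measurable _).mono (le_iSup₂_of_le (i - j - l) (by omega) le_rfl) le_rfl

variable [mΩ : MeasurableSpace Ω]

theorem pastSigma_le {ε : ℤ → Ω → Fin e → ℝ} (hε : ∀ i, Measurable (ε i)) (i : ℤ) :
    pastSigma ε i ≤ mΩ :=
  iSup₂_le fun j _ => (hε j).comap_le

end Past

section MomentArray

variable {Ω : Type*} [mΩ : MeasurableSpace Ω] {P : Measure Ω} {e d d₀ : ℕ}
  {ε ε' : ℤ → Ω → Fin e → ℝ} {J : ℤ → Hist e → Fin d → ℝ} {𝓕 : Finset (Fn d)}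
  {D : Fn d → unitInterval → ℝ} {fbar : Fn d → Fn d} {ν : ℝ} {Δ : ℕ → ℝ} {𝔻n : ℝ} {n : ℕ}
  {J₀ : ℤ → Hist e → Fin d₀ → ℝ} {μ : ℕ → Fn d → ℕ → Fn d₀} {R : Fn d₀} {L : ℕ → ℝ} {s : ℝ}
  {p : ℝ≥0∞} {C_R C_f C_X : ℝ}

/-- The truncated conditional moments `D_f μ^{(κ)}_{f,i}(Z°_{i-1})`, at the point `i / n`, as
functions of the innovations.  For `κ = 2` only the square matters, so the sign of `D_f` is kept. -/
noncomputable def momentArray (𝓕 : Finset (Fn d)) (D : Fn d → unitInterval → ℝ)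
    (J₀ : ℤ → Hist e → Fin d₀ → ℝ) (μ : ℕ → Fn d → ℕ → Fn d₀) (n : ℕ) (M : ℝ) (κ : ℕ) (i : ℕ)
    (f : {f // f ∈ 𝓕}) (x : ℤ → Fin e → ℝ) : ℝ :=
  clip M (D f (grid n i) * μ κ f i (hist (coords e) J₀ ((i : ℤ) - 1) x) (grid n i))

/-- The truncated conditional moments have the dependence coefficients `|D_f| Δ(k)`: truncation is a
contraction. -/
theorem CompatAt.isShiftArray [IsProbabilityMeasure P]
    (h : CompatAt P ε ε' J 𝓕 D fbar ν Δ 𝔻n n J₀ μ R L s p C_R C_f C_X)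
    (hε : IsIIDWithCopy P ε ε') (hν : 2 ≤ ν) (hp : 1 < p) {M : ℝ} (hM : 0 ≤ M) {κ : ℕ}
    (hκ : κ ∈ ({1, 2} : Finset ℕ)) :
    IsShiftArray (P.map (ε 0)) n M Δ (fun i (f : {f // f ∈ 𝓕}) => |D f (grid n i)|)
      (momentArray 𝓕 D J₀ μ n M κ) where
  measurable i f := (measurable_clip M).comp
    (((h.measurable_μ κ f i _).comp (measurable_hist_coords h.measurable_J _)).const_mul _)
  abs_le i f x := abs_clip_le hM _
  dependsOn i f x y hxy := by
    have : hist (coords e) J₀ ((i : ℤ) - 1) x = hist (coords e) J₀ ((i : ℤ) - 1) y :=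
      dependsOn_hist_coords J₀ _ fun j hj => hxy j (by
        simp only [Set.mem_Iic, Set.mem_Iio] at hj ⊢
        omega)
    simp only [momentArray, this]
  nonneg i f := abs_nonneg _
  coupling i hi k _ := by
    obtain ⟨U, hU, hU2, hb⟩ := h.exists_coupling hε hν hp hi k (grid n i)
    refine ⟨U, hU, hU2, fun f x y => ?_⟩
    refine le_trans ?_ (mul_le_mul_right (hb κ hκ f f.2 x y) _)
    rw [← Real.enorm_of_nonneg (abs_nonneg (D f (grid n i))), Real.enorm_abs, ← enorm_mul, mul_sub]
    exact enorm_le_iff_norm_le.2 (abs_clip_sub_clip_le _ _ _)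

theorem CompatAt.memLp_comp
    (hfactor : ∀ f ∈ 𝓕, ∀ z u, f z u = D f u * fbar f z u)
    (h : CompatAt P ε ε' J 𝓕 D fbar ν Δ 𝔻n n J₀ μ R L s p C_R C_f C_X)
    {f : Fn d} (hf : f ∈ 𝓕) {i : ℕ} (hi : i ∈ Finset.Icc 1 n) (u : unitInterval) :
    MemLp (fun ω => f (hist ε J i ω) u) 2 P := by
  simp only [hfactor f hf]
  exact (h.memLp f hf i hi u).const_mul _

theorem CompatAt.condExp_comp_ae_eq
    (hfactor : ∀ f ∈ 𝓕, ∀ z u, f z u = D f u * fbar f z u)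
    (h : CompatAt P ε ε' J 𝓕 D fbar ν Δ 𝔻n n J₀ μ R L s p C_R C_f C_X) {f : Fn d} (hf : f ∈ 𝓕)
    {i : ℕ} (hi : i ∈ Finset.Icc 1 n) (u : unitInterval) :
    (P[fun ω => f (hist ε J i ω) u|pastSigma ε ((i : ℤ) - 1)]) =ᵐ[P]
      fun ω => D f u * μ 1 f i (hist ε J₀ ((i : ℤ) - 1) ω) u := by
  have h1 := h.cond_moment 1 (by simp) f hf i hi u
  have h2 := condExp_smul (μ := P) (D f u) (fun ω => fbar f (hist ε J i ω) u)
    (pastSigma ε ((i : ℤ) - 1))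
  simp only [hfactor f hf]
  simp only [pow_one, Nat.cast_one, div_one, Real.rpow_one] at h1
  filter_upwards [h1, h2] with ω hω1 hω2
  rw [hω1]
  exact hω2

theorem CompatAt.condExp_sq_comp_ae_eq
    (hfactor : ∀ f ∈ 𝓕, ∀ z u, f z u = D f u * fbar f z u)
    (h : CompatAt P ε ε' J 𝓕 D fbar ν Δ 𝔻n n J₀ μ R L s p C_R C_f C_X) {f : Fn d} (hf : f ∈ 𝓕)
    {i : ℕ} (hi : i ∈ Finset.Icc 1 n) (u : unitInterval) :
    (P[fun ω => f (hist ε J i ω) u ^ 2|pastSigma ε ((i : ℤ) - 1)]) =ᵐ[P]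
      fun ω => (D f u * μ 2 f i (hist ε J₀ ((i : ℤ) - 1) ω) u) ^ 2 := by
  have h1 := h.cond_moment 2 (by simp) f hf i hi u
  have h2 := condExp_smul (μ := P) (D f u ^ 2) (fun ω => fbar f (hist ε J i ω) u ^ 2)
    (pastSigma ε ((i : ℤ) - 1))
  have h3 := condExp_nonneg (μ := P) (m := pastSigma ε ((i : ℤ) - 1))
    (f := fun ω => fbar f (hist ε J i ω) u ^ 2) (ae_of_all _ fun ω => sq_nonneg _)
  simp only [hfactor f hf, mul_pow]
  filter_upwards [h1, h2, h3] with ω hω1 hω2 hω3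
  rw [hω1, Nat.cast_ofNat, ← Real.sqrt_eq_rpow, Real.sq_sqrt hω3]
  exact hω2

theorem CompatAt.integral_momentArray_sq_le [IsProbabilityMeasure P]
    (hfactor : ∀ f ∈ 𝓕, ∀ z u, f z u = D f u * fbar f z u)
    (h : CompatAt P ε ε' J 𝓕 D fbar ν Δ 𝔻n n J₀ μ R L s p C_R C_f C_X)
    (hε : IsIIDWithCopy P ε ε') {M : ℝ} (hM : 0 ≤ M) {κ : ℕ}
    (hκ : κ ∈ ({1, 2} : Finset ℕ)) (f : {f // f ∈ 𝓕}) {i : ℕ} (hi : i ∈ Finset.Icc 1 n) :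
    ∫ x, momentArray 𝓕 D J₀ μ n M κ i f x ^ 2 ∂(iidLaw ℤ (P.map (ε 0)))
      ≤ ∫ ω, f.1 (hist ε J i ω) (grid n i) ^ 2 ∂P := by
  have hm : pastSigma ε ((i : ℤ) - 1) ≤ mΩ := pastSigma_le hε.measurable _
  have hY := h.memLp_comp hfactor f.2 hi (grid n i)
  have hmeas : Measurable fun x => momentArray 𝓕 D J₀ μ n M κ i f x ^ 2 :=
    ((measurable_clip M).comp (((h.measurable_μ κ f i _).comp
      (measurable_hist_coords h.measurable_J _)).const_mul _)).pow_const 2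
  rw [← hε.measurePreserving_innov.map_eq,
    integral_map hε.measurePreserving_innov.measurable.aemeasurable hmeas.aestronglyMeasurable]
  have hle : ∀ ω, momentArray 𝓕 D J₀ μ n M κ i f (fun j => ε j ω) ^ 2
      ≤ (D f (grid n i) * μ κ f i (hist ε J₀ ((i : ℤ) - 1) ω) (grid n i)) ^ 2 := fun ω =>
    clip_sq_le hM _
  simp only [Finset.mem_insert, Finset.mem_singleton] at hκ
  rcases hκ with rfl | rfl
  · have h2 : ∫ ω, (P[fun ω => f.1 (hist ε J i ω) (grid n i)|pastSigma ε ((i : ℤ) - 1)]) ω ^ 2 ∂P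
        ≤ ∫ ω, f.1 (hist ε J i ω) (grid n i) ^ 2 ∂P := by
      have h3 := eLpNorm_condExp_le_eLpNorm (μ := P) (m := pastSigma ε ((i : ℤ) - 1))
        (fun ω => f.1 (hist ε J i ω) (grid n i)) (p := 2) one_le_two
      have h4 : 0 ≤ ∫ ω, f.1 (hist ε J i ω) (grid n i) ^ 2 ∂P :=
        integral_nonneg fun ω => sq_nonneg _
      have h5 := (eLpNorm_two_le_ofReal_iff hY (Real.sqrt_nonneg _)).2
        (by rw [Real.sq_sqrt h4]; simp only [Real.norm_eq_abs, sq_abs]; exact le_rfl)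
      have h6 := (eLpNorm_two_le_ofReal_iff (hY.condExp one_le_two) (Real.sqrt_nonneg _)).1
        (h3.trans h5)
      simpa only [Real.norm_eq_abs, sq_abs, Real.sq_sqrt h4] using h6
    refine le_trans (integral_mono_of_nonneg (ae_of_all _ fun ω => sq_nonneg _)
      (hY.condExp (m := pastSigma ε ((i : ℤ) - 1)) one_le_two).integrable_sq ?_) h2
    filter_upwards [h.condExp_comp_ae_eq hfactor f.2 hi (grid n i)] with ω hω
    rw [hω]
    exact hle ω
  · rw [← integral_condExp (f := fun ω => f.1 (hist ε J i ω) (grid n i) ^ 2) hm]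
    refine integral_mono_of_nonneg (ae_of_all _ fun ω => sq_nonneg _) integrable_condExp ?_
    filter_upwards [h.condExp_sq_comp_ae_eq hfactor f.2 hi (grid n i)] with ω hω
    rw [hω]
    exact hle ω

end MomentArray

/-! ### The tail bound for a fixed sample size -/

section FixedSize

theorem sum_range_add_one_eq_sum_Icc {A : Type*} [AddCommMonoid A] (n : ℕ) (g : ℕ → A) :
    ∑ i ∈ Finset.range n, g (i + 1) = ∑ i ∈ Finset.Icc 1 n, g i := by
  rw [Finset.range_eq_Ico, Finset.sum_Ico_add' g 0 n 1, zero_add, Finset.Ico_add_one_right_eq_Icc]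

theorem enorm_le_Dsup {d : ℕ} {𝓕 : Finset (Fn d)} (D : Fn d → unitInterval → ℝ) {f : Fn d}
    (hf : f ∈ 𝓕) (u : unitInterval) : ‖D f u‖ₑ ≤ Dsup 𝓕 D u :=
  le_iSup₂_of_le f hf le_rfl

theorem Dsup_ne_top {d : ℕ} (𝓕 : Finset (Fn d)) (D : Fn d → unitInterval → ℝ) (u : unitInterval) :
    Dsup 𝓕 D u ≠ ∞ := by
  rw [Dsup, ← Finset.sup_eq_iSup]
  exact ((Finset.sup_lt_iff (by simp)).2 fun f _ => enorm_lt_top).ne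

theorem abs_le_toReal_Dsup {d : ℕ} {𝓕 : Finset (Fn d)} (D : Fn d → unitInterval → ℝ) {f : Fn d}
    (hf : f ∈ 𝓕) (u : unitInterval) : |D f u| ≤ (Dsup 𝓕 D u).toReal := by
  have := ENNReal.toReal_mono (Dsup_ne_top 𝓕 D u) (enorm_le_Dsup D hf u)
  rwa [toReal_enorm] at this

theorem abs_le_envelope {d : ℕ} {𝓕 : Finset (Fn d)} (fbar : Fn d → Fn d) {f : Fn d} (hf : f ∈ 𝓕)
    (z : Hist d) (u : unitInterval) : |fbar f z u| ≤ envelope 𝓕 fbar z u :=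
  le_ciSup (f := fun f : {f // f ∈ 𝓕} => |fbar f z u|) (Set.finite_range _).bddAbove ⟨f, hf⟩

theorem envelope_nonneg {d : ℕ} (𝓕 : Finset (Fn d)) (fbar : Fn d → Fn d) (z : Hist d)
    (u : unitInterval) : 0 ≤ envelope 𝓕 fbar z u :=
  Real.iSup_nonneg fun _ => abs_nonneg _

theorem measurable_envelope {d : ℕ} {𝓕 : Finset (Fn d)} {fbar : Fn d → Fn d}
    (hfbar : ∀ f ∈ 𝓕, Measurable (Function.uncurry (fbar f))) (u : unitInterval) :
    Measurable fun z => envelope 𝓕 fbar z u := by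
  refine Measurable.iSup fun f => ?_
  exact ((hfbar f f.2).comp (measurable_id.prodMk measurable_const)).norm

variable {Ω : Type*} [mΩ : MeasurableSpace Ω] {P : Measure Ω} {e d d₀ : ℕ}
  {ε ε' : ℤ → Ω → Fin e → ℝ} {J : ℤ → Hist e → Fin d → ℝ} {𝓕 : Finset (Fn d)}
  {D : Fn d → unitInterval → ℝ} {fbar : Fn d → Fn d} {ν : ℝ} {Δ : ℕ → ℝ} {𝔻n : ℝ} {n : ℕ}
  {J₀ : ℤ → Hist e → Fin d₀ → ℝ} {μ : ℕ → Fn d → ℕ → Fn d₀} {R : Fn d₀} {L : ℕ → ℝ} {s : ℝ}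
  {p : ℝ≥0∞} {C_R C_f C_X : ℝ}

theorem sum_integral_sq_le_normTwo {Z : ℤ → Ω → Hist d} (hn : 1 ≤ n) {f : Fn d}
    (hf : ∀ i ∈ Finset.Icc 1 n, MemLp (fun ω => f (Z (i : ℕ) ω) (grid n i)) 2 P)
    (htop : normTwo P Z n f ≠ ∞) :
    ∑ i ∈ Finset.Icc 1 n, ∫ ω, f (Z i ω) (grid n i) ^ 2 ∂P
      ≤ n * (normTwo P Z n f).toReal ^ 2 := by
  set b : ℕ → ℝ := fun i => Real.sqrt (∫ ω, f (Z i ω) (grid n i) ^ 2 ∂P) with hb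
  have h0 : ∀ i : ℕ, 0 ≤ ∫ ω, f (Z i ω) (grid n i) ^ 2 ∂P := fun i =>
    integral_nonneg fun ω => sq_nonneg _
  have hbe : ∀ i ∈ Finset.Icc 1 n, ENNReal.ofReal (b i)
      = eLpNorm (fun ω => f (Z i ω) (grid n i)) 2 P := by
    intro i hi
    have h1 := (hf i hi).eLpNorm_eq_integral_rpow_norm (by norm_num) (by norm_num)
    rw [h1]
    simp only [ENNReal.toReal_ofNat, Real.rpow_ofNat, Real.norm_eq_abs, sq_abs]
    simp only [hb, Real.sqrt_eq_rpow, one_div]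
  have key := sum_sq_le_of_avgNorm_le hn (b := b) (fun i => Real.sqrt_nonneg _)
    (c := (normTwo P Z n f).toReal) ENNReal.toReal_nonneg (by
      rw [ENNReal.ofReal_toReal htop, normTwo]
      refine le_of_eq ?_
      simp only [avgNorm, ENNReal.ofNat_ne_top, if_false]
      rw [Finset.sum_congr rfl fun i hi => by rw [hbe i hi]])
  simpa only [hb, Real.sq_sqrt (h0 _)] using key

/-- The seminorm `V(f)` bounds the sum of the standard deviations of the increments. -/
theorem sum_min_le_of_seminormV_le {Z : ℤ → Ω → Hist d} {f : Fn d} {σ : ℝ} (hσ : 0 ≤ σ)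
    (hΔ : ∀ k, 0 ≤ Δ k) (h𝔻 : 0 ≤ 𝔻n)
    (hV : seminormV P Z Δ 𝔻n n f ≤ ENNReal.ofReal σ) (q : ℕ) :
    ∑ k ∈ Finset.range q, min (normTwo P Z n f).toReal (𝔻n * Δ (k + 1)) ≤ σ := by
  have htop : normTwo P Z n f ≠ ∞ :=
    ((le_self_add.trans hV).trans_lt ENNReal.ofReal_lt_top).ne
  rw [← ENNReal.ofReal_le_ofReal_iff hσ, ENNReal.ofReal_sum_of_nonneg fun k _ =>
    le_min ENNReal.toReal_nonneg (mul_nonneg h𝔻 (hΔ _))]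
  simp only [ENNReal.ofReal_min, ENNReal.ofReal_toReal htop]
  exact ((ENNReal.sum_le_tsum _).trans le_add_self).trans hV

/-- The tail bound for a given `n`, block length `q`, truncation level `M` and exponents `l`, `l'`.
The terms come from the martingale part, the conditional variances (two terms), the smooth part (two
terms) and the truncation. -/
theorem CompatAt.measureReal_exists_abs_sum_ge_le [IsProbabilityMeasure P]
    [Nonempty {f // f ∈ 𝓕}]
    (h : CompatAt P ε ε' J 𝓕 D fbar ν Δ 𝔻n n J₀ μ R L s p C_R C_f C_X)
    (hε : IsIIDWithCopy P ε ε') (hJ : ∀ i, Measurable (J i))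
    (hf : ∀ f ∈ 𝓕, Measurable (Function.uncurry f))
    (hfbar : ∀ f ∈ 𝓕, Measurable (Function.uncurry (fbar f)))
    (hfactor : ∀ f ∈ 𝓕, ∀ z u, f z u = D f u * fbar f z u) (hν : 2 ≤ ν) (hp : 1 < p) (hn : 1 ≤ n)
    (hΔ : ∀ k, 0 ≤ Δ k) (hanti : Antitone Δ) (hsum : Summable Δ) (h𝔻 : 0 ≤ 𝔻n) {ν₂ : ℝ≥0∞}
    (hν₂ : 2 ≤ ν₂) (henv : envMoment P (hist ε J) (envelope 𝓕 fbar) ν₂ n < ∞) {c c₂ : ℝ}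
    (hc : 0 ≤ c) (hc₂ : 0 ≤ c₂)
    (hDc : avgNorm 2 n (fun i => Dsup 𝓕 D (grid n i)) ≤ ENNReal.ofReal c)
    (hDc₂ : avgNorm ν₂ n (fun i => Dsup 𝓕 D (grid n i)) ≤ ENNReal.ofReal c₂) {σ : ℝ} (hσ : 0 < σ)
    (hV : ∀ f ∈ 𝓕, seminormV P (hist ε J) Δ 𝔻n n f ≤ ENNReal.ofReal σ) {q : ℕ} (hq : 1 ≤ q)
    {M : ℝ} (hM : 0 < M)
    (hMc : (n : ℝ) ^ (1 / ν₂).toReal *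
      (envMoment P (hist ε J) (envelope 𝓕 fbar) ν₂ n).toReal * c₂ ≤ M)
    {H : ℝ} (hH : 1 ≤ H) (hHc : Real.log 𝓕.card ≤ H) {l l' t T : ℝ} (hl0 : 0 ≤ l)
    (hl : l * (4 * q * M) ≤ 1) (hl0' : 0 ≤ l') (hl' : 2 * l' * (q * M ^ 2) ≤ 1) (ht : 0 < t)
    (hT : 0 < T) :
    P.real {ω | ∃ f : {f // f ∈ 𝓕}, 4 * t ≤ |∑ i ∈ Finset.Icc 1 n,
        (f.1 (hist ε J i ω) (grid n i) - ∫ ω', f.1 (hist ε J i ω') (grid n i) ∂P)|}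
      ≤ 𝓕.card * (2 * Real.exp (l ^ 2 * (4 * T) - l * t))
        + (𝓕.card * Real.exp (4 * l' * (n * σ ^ 2) - l' * T)
          + (Real.sqrt n * c * betaTail Δ q) ^ 2 / T)
        + (𝓕.card * (2 * Real.exp (4 * l ^ 2 * (n * (2 * σ) ^ 2) - l * t))
          + 4 * Real.sqrt H * (Real.sqrt n * c * betaTail Δ q) / t) + 4 * M / t := by
  have : IsProbabilityMeasure (P.map (ε 0)) :=
    Measure.isProbabilityMeasure_map (hε.measurable 0).aemeasurable
  have hcard : Fintype.card {f // f ∈ 𝓕} = 𝓕.card := Fintype.card_coe 𝓕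
  have hq0 : (0 : ℝ) < q := by exact_mod_cast hq
  have hw₁ := h.isShiftArray hε hν hp hM.le (κ := 1) (by simp)
  have hw₂ := h.isShiftArray hε hν hp hM.le (κ := 2) (by simp)
  have hYL := fun (f : {f // f ∈ 𝓕}) i hi => h.memLp_comp hfactor f.2 (i := i) hi (grid n i)
  -- second moments
  have htop : ∀ f : {f // f ∈ 𝓕}, normTwo P (hist ε J) n f.1 ≠ ∞ := fun f =>
    ((le_self_add.trans (hV f f.2)).trans_lt ENNReal.ofReal_lt_top).ne
  set a : {f // f ∈ 𝓕} → ℝ := fun f => (normTwo P (hist ε J) n f.1).toReal with ha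
  have ha0 : ∀ f, 0 ≤ a f := fun f => ENNReal.toReal_nonneg
  have haσ : ∀ f, a f ≤ σ := fun f => by
    have := ENNReal.toReal_mono ENNReal.ofReal_ne_top (le_self_add.trans (hV f f.2))
    rwa [ENNReal.toReal_ofReal hσ.le] at this
  have hY2 : ∀ f : {f // f ∈ 𝓕}, ∑ i ∈ Finset.Icc 1 n, ∫ ω, f.1 (hist ε J i ω) (grid n i) ^ 2 ∂P
      ≤ n * a f ^ 2 := fun f => sum_integral_sq_le_normTwo hn (hYL f) (htop f)
  have hsq : ∀ κ ∈ ({1, 2} : Finset ℕ), ∀ f, ∑ i ∈ Finset.Icc 1 n,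
      ∫ x, momentArray 𝓕 D J₀ μ n M κ i f x ^ 2 ∂(iidLaw ℤ (P.map (ε 0))) ≤ n * a f ^ 2 :=
    fun κ hκ f => (Finset.sum_le_sum fun i hi =>
      h.integral_momentArray_sq_le hfactor hε hM.le hκ f hi).trans (hY2 f)
  -- the envelopes of the factors
  set C : ℕ → ℝ := fun i => (Dsup 𝓕 D (grid n i)).toReal with hC
  have hC0 : ∀ i, 0 ≤ C i := fun i => ENNReal.toReal_nonneg
  have hCe : ∀ i, ENNReal.ofReal (C i) = Dsup 𝓕 D (grid n i) := fun i =>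
    ENNReal.ofReal_toReal (Dsup_ne_top _ _ _)
  have hcC : ∀ i (f : {f // f ∈ 𝓕}), |D f (grid n i)| ≤ C i := fun i f =>
    abs_le_toReal_Dsup D f.2 _
  have hCS : ∑ i ∈ Finset.Icc 1 n, C i ^ 2 ≤ (Real.sqrt n * c) ^ 2 := by
    rw [mul_pow, Real.sq_sqrt (Nat.cast_nonneg n)]
    exact sum_sq_le_of_avgNorm_le hn hC0 hc (by simpa only [hCe] using hDc)
  have hD2 : ∀ f : {f // f ∈ 𝓕}, ∑ i ∈ Finset.Icc 1 n, |D f (grid n i)| ^ 2 ≤ n * 𝔻n ^ 2 :=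
    fun f => sum_sq_le_of_avgNorm_le hn (fun i => abs_nonneg _) h𝔻 (by
      have := h.factor f f.2
      simpa only [← Real.enorm_of_nonneg (abs_nonneg _), Real.enorm_abs] using this)
  -- the smooth part
  have hp₁ := hw₁.measureReal_abs_sum_ge_le hM.le hΔ hanti hsum hq hC0 hcC (S := Real.sqrt n * c)
    (by positivity) hCS hH (by rwa [hcard])
    -- the summand `σ / q` makes the weights positive and at most doubles their sum
    (α := fun f k => min (a f) (𝔻n * Δ (k + 1)) + σ / q)
    (fun f k => add_pos_of_nonneg_of_pos (le_min (ha0 f) (mul_nonneg h𝔻 (hΔ _))) (by positivity))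
    (A := 2 * σ) (fun f => by
      rw [Finset.sum_add_distrib, Finset.sum_const, Finset.card_range, nsmul_eq_mul,
        mul_div_cancel₀ σ hq0.ne', two_mul]
      exact add_le_add_left (sum_min_le_of_seminormV_le hσ.le hΔ h𝔻 (hV f f.2) q) σ)
    (fun f k => by
      have hmin : ∑ i ∈ Finset.Icc 1 n, ∫ x, incr (P.map (ε 0)) ((i : ℤ) - (k + 1 : ℕ))
          (momentArray 𝓕 D J₀ μ n M 1 i f) x ^ 2 ∂(iidLaw ℤ (P.map (ε 0)))
            ≤ n * min (a f) (𝔻n * Δ (k + 1)) ^ 2 := by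
        rcases le_total (a f) (𝔻n * Δ (k + 1)) with hle | hle
        · rw [min_eq_left hle]
          exact (Finset.sum_le_sum fun i _ => integral_incr_sq_le (P.map (ε 0))
            (hw₁.measurable i f) (hw₁.abs_le i f) _).trans (hsq 1 (by simp) f)
        · rw [min_eq_right hle]
          calc _ ≤ ∑ i ∈ Finset.Icc 1 n, (|D f (grid n i)| * Δ (k + 1)) ^ 2 :=
                Finset.sum_le_sum fun i hi =>
                  hw₁.integral_incr_sq_le_coupling hΔ hi (by omega) f
            _ = Δ (k + 1) ^ 2 * ∑ i ∈ Finset.Icc 1 n, |D f (grid n i)| ^ 2 := by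
                rw [Finset.mul_sum]
                exact Finset.sum_congr rfl fun i _ => by ring
            _ ≤ Δ (k + 1) ^ 2 * (n * 𝔻n ^ 2) :=
                mul_le_mul_of_nonneg_left (hD2 f) (sq_nonneg _)
            _ = _ := by ring
      refine hmin.trans (mul_le_mul_of_nonneg_left (pow_le_pow_left₀
        (le_min (ha0 f) (mul_nonneg h𝔻 (hΔ _))) ?_ 2) (Nat.cast_nonneg n))
      exact le_add_of_nonneg_right (by positivity))
    hl0 hl ht
  -- the conditional second moments
  have hp₂ := hw₂.measureReal_sum_sq_ge_le hM.le hΔ hanti hsum hq hC0 hcC hCS (V := n * σ ^ 2)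
    (fun f => (hsq 2 (by simp) f).trans (mul_le_mul_of_nonneg_left
      (pow_le_pow_left₀ (ha0 f) (haσ f) 2) (Nat.cast_nonneg n))) hl0' hl' hT
  rw [hcard] at hp₁ hp₂
  -- the envelope
  set F : ℕ → Ω → ℝ := fun i ω => C i * envelope 𝓕 fbar (hist ε J i ω) (grid n i) with hF
  have hhist : ∀ i : ℤ, Measurable (hist ε J i) := fun i =>
    (measurable_hist_pastSigma ε hJ i).mono (pastSigma_le hε.measurable i) le_rfl
  have hEm : ∀ i : ℕ, Measurable fun ω => envelope 𝓕 fbar (hist ε J i ω) (grid n i) := fun i =>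
    (measurable_envelope hfbar _).comp (hhist i)
  have hFm : ∀ i, Measurable (F i) := fun i => (hEm i).const_mul _
  have hF0 : ∀ i ω, 0 ≤ F i ω := fun i ω => mul_nonneg (hC0 i) (envelope_nonneg _ _ _ _)
  have hFb : ∀ i ∈ Finset.Icc 1 n, eLpNorm (F i) ν₂ P
      ≤ ENNReal.ofReal (C i * (envMoment P (hist ε J) (envelope 𝓕 fbar) ν₂ n).toReal) := by
    intro i hi
    have h1 := eLpNorm_const_smul (C i)
      (fun ω => envelope 𝓕 fbar (hist ε J i ω) (grid n i)) ν₂ P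
    rw [ENNReal.ofReal_mul (hC0 i), ENNReal.ofReal_toReal henv.ne, ← Real.enorm_of_nonneg (hC0 i)]
    refine (le_of_eq h1).trans (mul_le_mul_right ?_ _)
    exact le_iSup₂_of_le (f := fun i _ => ⨆ u : unitInterval,
      eLpNorm (fun ω => envelope 𝓕 fbar (hist ε J (i : ℕ) ω) u) ν₂ P) i hi
      (le_iSup (fun u : unitInterval =>
        eLpNorm (fun ω => envelope 𝓕 fbar (hist ε J (i : ℕ) ω) u) ν₂ P) (grid n i))
  have hτ := sum_integral_excess_le hn hν₂ hFm hF0 hC0 ENNReal.toReal_nonneg hc₂ hFb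
    (by simpa only [hCe] using hDc₂) hM hMc
  have hFi : ∀ i ∈ Finset.Icc 1 n, Integrable (F i) P := fun i hi =>
    MemLp.integrable ((by norm_num : (1 : ℝ≥0∞) ≤ 2).trans hν₂)
      ⟨(hFm i).aestronglyMeasurable, (hFb i hi).trans_lt ENNReal.ofReal_lt_top⟩
  have hmp := hε.measurePreserving_innov
  have hmem : ∀ {i}, i < n → i + 1 ∈ Finset.Icc 1 n := fun hi => Finset.mem_Icc.2 ⟨by omega, by omega⟩
  have hint : ∀ i f, ∫ x, momentArray 𝓕 D J₀ μ n M 1 i f x ∂(iidLaw ℤ (P.map (ε 0)))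
      = ∫ ω, momentArray 𝓕 D J₀ μ n M 1 i f (fun j => ε j ω) ∂P := fun i f => by
    rw [← hmp.map_eq, integral_map hmp.measurable.aemeasurable
      (hw₁.measurable i f).aestronglyMeasurable]
  have key := EmpProc.measureReal_exists_abs_sum_ge_le (P := P) (ι := {f // f ∈ 𝓕})
    (𝒢 := fun i => pastSigma ε (((i + 1 : ℕ) : ℤ) - 1))
    (fun i => pastSigma_mono ε (by push_cast; omega)) (fun i => pastSigma_le hε.measurable _)
    (N := n) (Y := fun f i ω => f.1 (hist ε J ((i + 1 : ℕ) : ℤ) ω) (grid n (i + 1)))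
    (fun f i => ((hf f f.2).comp (measurable_id.prodMk measurable_const)).comp
      ((measurable_hist_pastSigma ε hJ _).mono (pastSigma_mono ε (by push_cast; omega)) le_rfl))
    (fun f i hi => hYL f (i + 1) (hmem hi)) hM.le (F := fun i => F (i + 1))
    (fun f i ω => by
      rw [hfactor f f.2, abs_mul]
      exact mul_le_mul (hcC _ f) (abs_le_envelope fbar f.2 _ _) (abs_nonneg _) (hC0 _))
    (fun i hi => ((hFi _ (hmem hi)).sub (integrable_const M)).sup (integrable_const 0))
    (τ := M) (by
      rw [sum_range_add_one_eq_sum_Icc n fun i => ∫ x, max (F i x - M) 0 ∂P]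
      exact hτ)
    (w₁ := fun f i ω => momentArray 𝓕 D J₀ μ n M 1 (i + 1) f fun j => ε j ω)
    (w₂ := fun f i ω => momentArray 𝓕 D J₀ μ n M 2 (i + 1) f fun j => ε j ω)
    (fun f i hi => by
      filter_upwards [h.condExp_comp_ae_eq hfactor f.2 (hmem hi) (grid n (i + 1))] with ω hω
      rw [hω]
      rfl)
    (fun f i hi => by
      filter_upwards [h.condExp_sq_comp_ae_eq hfactor f.2 (hmem hi) (grid n (i + 1))] with ω hω
      rw [hω]
      exact clip_sq hM.le _)
    (t := t) (T := 4 * T) ht (le_trans (ENNReal.toReal_mono (measure_ne_top _ _) (by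
      refine le_trans (le_of_eq ?_) ((Measure.le_map_apply hmp.measurable.aemeasurable _).trans_eq
        (by rw [hmp.map_eq]))
      congr 1
      ext ω
      simp only [Set.mem_preimage, Set.mem_ofPred_eq, hint]
      refine exists_congr fun f => ?_
      rw [sum_range_add_one_eq_sum_Icc n fun i =>
        momentArray 𝓕 D J₀ μ n M 1 i f (fun j => ε j ω)
          - ∫ ω', momentArray 𝓕 D J₀ μ n M 1 i f (fun j => ε j ω') ∂P])) hp₁)
    (le_trans (ENNReal.toReal_mono (measure_ne_top _ _) (by
      refine le_trans (le_of_eq ?_) ((Measure.le_map_apply hmp.measurable.aemeasurable _).trans_eq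
        (by rw [hmp.map_eq]))
      congr 1
      ext ω
      simp only [Set.mem_preimage, Set.mem_ofPred_eq]
      refine exists_congr fun f => ?_
      rw [sum_range_add_one_eq_sum_Icc n fun i =>
        momentArray 𝓕 D J₀ μ n M 2 i f (fun j => ε j ω) ^ 2])) hp₂) hl0 (by
      refine le_trans (mul_le_mul_of_nonneg_left (mul_le_mul_of_nonneg_right ?_ hM.le) hl0) hl
      have : (1 : ℝ) ≤ q := by exact_mod_cast hq
      linarith)
  rw [hcard] at key
  refine le_trans (le_of_eq ?_) key
  congr 1
  ext ω
  simp only [Set.mem_ofPred_eq]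
  refine exists_congr fun f => ?_
  rw [sum_range_add_one_eq_sum_Icc n fun i =>
    f.1 (hist ε J i ω) (grid n i) - ∫ ω', f.1 (hist ε J i ω') (grid n i) ∂P]

end FixedSize

/-! ### The choice of the block length and of the constants -/

section Constants

/-- The block length attached to `δ`: some `ρ` of the order of `r(δ)` and `q = q*(ρ)` satisfy
`β(q) ≤ q ρ ≤ δ`.  Since `r(δ)` is a supremum that need not be attained, `ρ` is only required to be
at least half of it. -/
theorem exists_blockLength (Δ : ℕ → ℝ) {δ : ℝ} (hδ : 0 < δ) : 0 < rFun Δ δ ∧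
    ∃ (ρ : ℝ) (q : ℕ), 0 < ρ ∧ 1 ≤ q ∧ betaTail Δ q ≤ q * ρ ∧
      q * ρ ≤ δ ∧ rFun Δ δ ≤ 2 * ρ := by
  have htend : Filter.Tendsto (betaTail Δ) Filter.atTop (nhds 0) := by
    have := tendsto_sum_nat_add Δ
    simp only [add_comm] at this
    exact this
  have hex : ∀ x : ℝ, 0 < x → ∃ q : ℕ, 1 ≤ q ∧ betaTail Δ q ≤ x := fun x hx => by
    obtain ⟨q, h1, h2⟩ := ((htend.eventually_le_const hx).and
      (Filter.eventually_ge_atTop 1)).exists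
    exact ⟨q, h2, h1⟩
  have hmem : ∀ x : ℝ, 0 < x → 1 ≤ qStar Δ x ∧ betaTail Δ (qStar Δ x) ≤ qStar Δ x * x :=
    fun x hx => by
    refine Nat.sInf_mem (s := {q : ℕ | 1 ≤ q ∧ betaTail Δ q ≤ q * x}) ?_
    obtain ⟨q, h1, h2⟩ := hex x hx
    refine ⟨q, h1, h2.trans (le_mul_of_one_le_left hx.le ?_)⟩
    exact_mod_cast h1
  set S : Set ℝ := {r : ℝ | 0 < r ∧ (qStar Δ r : ℝ) * r ≤ δ} with hS
  have hbdd : BddAbove S := ⟨δ, fun r hr => by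
    refine le_trans (le_mul_of_one_le_left hr.1.le ?_) hr.2
    exact_mod_cast (hmem r hr.1).1⟩
  obtain ⟨q, hq1, hq⟩ := hex δ hδ
  have hq0 : (0 : ℝ) < q := by exact_mod_cast hq1
  have hqS : δ / q ∈ S := by
    refine ⟨by positivity, ?_⟩
    have h1 : qStar Δ (δ / q) ≤ q := Nat.sInf_le ⟨hq1, by rwa [mul_div_cancel₀ δ hq0.ne']⟩
    calc (qStar Δ (δ / q) : ℝ) * (δ / q) ≤ q * (δ / q) := by gcongr
      _ = δ := mul_div_cancel₀ δ hq0.ne'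
  have hpos : 0 < rFun Δ δ := lt_of_lt_of_le hqS.1 (le_csSup hbdd hqS)
  refine ⟨hpos, ?_⟩
  obtain ⟨ρ, hρS, hρ⟩ := exists_lt_of_lt_csSup ⟨_, hqS⟩ (show rFun Δ δ / 2 < sSup S by
    have : rFun Δ δ = sSup S := rfl
    linarith)
  exact ⟨ρ, qStar Δ ρ, hρS.1, (hmem ρ hρS.1).1, (hmem ρ hρS.1).2, hρS.2, by linarith⟩

/-- A union bound over `N ≤ exp H` events costs the exponent `H`. -/
theorem mul_exp_le_inv {N H a g : ℝ} (hg : 0 < g) (hH : 1 ≤ H) (hN : N ≤ Real.exp H)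
    (ha : a ≤ -(H * (1 + g))) : N * Real.exp a ≤ 1 / g := by
  calc N * Real.exp a ≤ Real.exp H * Real.exp (-(H * (1 + g))) :=
        mul_le_mul hN (Real.exp_le_exp.2 ha) (Real.exp_pos _).le (Real.exp_pos _).le
    _ = Real.exp (-(H * g)) := by rw [← Real.exp_add]; congr 1; ring
    _ ≤ Real.exp (-g) := Real.exp_le_exp.2 (neg_le_neg (le_mul_of_one_le_left hg.le hH))
    _ ≤ 1 / g := by
        rw [Real.exp_neg, one_div]
        exact inv_anti₀ hg (by linarith [Real.add_one_le_exp g])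

/-- With the truncation level at most `B σ √n / √H`, the bounds for the martingale, the conditional
variances, the smooth part and the excess add up to at most `8 / g` at the level `Q √n √H`.  Here
`a` and `b` stand for `√n` and `√H`. -/
theorem tail_sum_le {σ B g a b N M x Γ Q : ℝ} (hσ : 0 < σ) (hB : 2 ≤ B) (hg : 0 < g) (ha : 0 < a)
    (hb : 1 ≤ b) (hN : N ≤ Real.exp (b ^ 2)) (hx0 : 0 ≤ x) (hx : x ≤ a * σ)
    (hM : M ≤ B * σ * a / b) (hΓ : Γ = 8 * B ^ 2 * (2 + g)) (hQ : Q = 16 * B * σ * (2 + Γ + g))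
    {l l' T t : ℝ} (hl : l = b / (4 * B * σ * a)) (hl' : l' = b ^ 2 / (2 * B ^ 2 * σ ^ 2 * a ^ 2))
    (hT : T = Γ * a ^ 2 * σ ^ 2 / 4) (ht : t = Q * a * b / 4) :
    N * (2 * Real.exp (l ^ 2 * (4 * T) - l * t))
        + (N * Real.exp (4 * l' * (a ^ 2 * σ ^ 2) - l' * T) + x ^ 2 / T)
        + (N * (2 * Real.exp (4 * l ^ 2 * (a ^ 2 * (2 * σ) ^ 2) - l * t)) + 4 * b * x / t)
        + 4 * M / t ≤ 8 / g := by
  have hB0 : 0 < B := by linarith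
  have hb0 : 0 < b := by linarith
  have hH : 1 ≤ b ^ 2 := one_le_pow₀ hb
  have hB2 : 4 ≤ B ^ 2 := by nlinarith
  have hΓ0 : 0 < Γ := by rw [hΓ]; positivity
  have hQ0 : 0 < Q := by rw [hQ]; positivity
  have hT0 : 0 < T := by rw [hT]; positivity
  have ht0 : 0 < t := by rw [ht]; positivity
  have hlt : l * t = b ^ 2 * (2 + Γ + g) := by
    rw [hl, ht, hQ]; field_simp; ring
  have hΓg : 4 * g ≤ Γ := by
    rw [hΓ]
    have h1 : 4 * (2 + g) ≤ B ^ 2 * (2 + g) := mul_le_mul_of_nonneg_right hB2 (by linarith)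
    linarith
  have e1 : N * Real.exp (l ^ 2 * (4 * T) - l * t) ≤ 1 / g := by
    refine mul_exp_le_inv hg hH hN ?_
    have h1 : l ^ 2 * (4 * T) = b ^ 2 * (Γ / (16 * B ^ 2)) := by
      rw [hl, hT]; field_simp; ring
    have h2 : Γ / (16 * B ^ 2) ≤ Γ := div_le_self hΓ0.le (by linarith)
    rw [h1, hlt, ← mul_sub, ← mul_neg]
    exact mul_le_mul_of_nonneg_left (by linarith) (sq_nonneg b)
  have e2 : N * Real.exp (4 * l' * (a ^ 2 * σ ^ 2) - l' * T) ≤ 1 / g := by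
    refine mul_exp_le_inv hg hH hN ?_
    have h1 : 4 * l' * (a ^ 2 * σ ^ 2) - l' * T = b ^ 2 * (2 / B ^ 2 - (2 + g)) := by
      rw [hl', hT, hΓ]; field_simp; ring
    have h2 : 2 / B ^ 2 ≤ 1 := by rw [div_le_one (by positivity)]; linarith
    rw [h1, ← mul_neg]
    exact mul_le_mul_of_nonneg_left (by linarith) (sq_nonneg b)
  have e3 : N * Real.exp (4 * l ^ 2 * (a ^ 2 * (2 * σ) ^ 2) - l * t) ≤ 1 / g := by
    refine mul_exp_le_inv hg hH hN ?_
    have h1 : 4 * l ^ 2 * (a ^ 2 * (2 * σ) ^ 2) = b ^ 2 * (1 / B ^ 2) := by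
      rw [hl]; field_simp; ring
    have h2 : 1 / B ^ 2 ≤ 1 := by rw [div_le_one (by positivity)]; linarith
    rw [h1, hlt, ← mul_sub, ← mul_neg]
    exact mul_le_mul_of_nonneg_left (by linarith) (sq_nonneg b)
  have e4 : x ^ 2 / T ≤ 1 / g := by
    rw [div_le_div_iff₀ hT0 hg, one_mul]
    have h1 : x ^ 2 ≤ a ^ 2 * σ ^ 2 := by
      rw [← mul_pow]; exact pow_le_pow_left₀ hx0 hx 2
    calc x ^ 2 * g ≤ a ^ 2 * σ ^ 2 * (Γ / 4) :=
          mul_le_mul h1 (by linarith) hg.le (by positivity)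
      _ = T := by rw [hT]; ring
  have hgB : g ≤ B * (2 + Γ + g) :=
    le_trans (by linarith) (le_mul_of_one_le_left (by linarith : 0 ≤ 2 + Γ + g) (by linarith))
  have e5 : 4 * b * x / t ≤ 1 / g := by
    rw [div_le_div_iff₀ ht0 hg, one_mul]
    calc 4 * b * x * g ≤ 4 * b * (a * σ) * (B * (2 + Γ + g)) :=
          mul_le_mul (mul_le_mul_of_nonneg_left hx (by positivity)) hgB hg.le (by positivity)
      _ = t := by rw [ht, hQ]; ring
  have e6 : 4 * M / t ≤ 1 / g := by
    rw [div_le_div_iff₀ ht0 hg, one_mul]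
    have h1 : B * σ * a / b ≤ B * σ * a * b := by
      exact (div_le_self (by positivity) hb).trans (le_mul_of_one_le_right (by positivity) hb)
    calc 4 * M * g ≤ 4 * (B * σ * a * b) * (2 + Γ + g) :=
          mul_le_mul (mul_le_mul_of_nonneg_left (hM.trans h1) (by norm_num)) (by linarith) hg.le
            (by positivity)
      _ = t := by rw [ht, hQ]; ring
  have : 8 / g = 8 * (1 / g) := by ring
  linarith

end Constants

end EmpProc

open EmpProc in
theorem mainTheorem3 {Ω : Type*} [MeasurableSpace Ω] (P : Measure Ω) [IsProbabilityMeasure P]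
    {k d : ℕ} (ε ε' : ℤ → Ω → Fin k → ℝ) (hε : IsIIDWithCopy P ε ε')
    -- the triangular array of processes `X_i = J_{i,n}(ε_i, ε_{i-1}, …)`
    (J : ℕ → ℤ → Hist k → Fin d → ℝ) (hJ : ∀ n i, Measurable (J n i))
    -- the finite classes `𝓕_n` and the factorizations `f(z,u) = D_{f,n}(u) fbar(z,u)`
    (𝓕 : ℕ → Finset (Fn d)) (D : ℕ → Fn d → unitInterval → ℝ) (fbar : ℕ → Fn d → Fn d)
    (hf_meas : ∀ n, ∀ f ∈ 𝓕 n, Measurable (Function.uncurry f))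
    (hfbar_meas : ∀ n, ∀ f ∈ 𝓕 n, Measurable (Function.uncurry (fbar n f)))
    (hfactor : ∀ n, ∀ f ∈ 𝓕 n, ∀ z u, f z u = D n f u * fbar n f z u)
    -- the sequences `Δ(k)` and `𝔻_n`
    (Δ : ℕ → ℝ) (hΔ_nonneg : ∀ j, 0 ≤ Δ j) (hΔ_anti : Antitone Δ) (hΔ_sum : Summable Δ)
    (𝔻 : ℕ → ℝ) (h𝔻 : ∀ n, 0 ≤ 𝔻 n)
    -- the two assumptions on the class
    (ν : ℝ) (hν : 2 ≤ ν) (hcompat : Compat P ε ε' J 𝓕 D fbar ν Δ 𝔻)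
    (hβ : SubmultBeta Δ)
    -- the envelope moment and the constants `𝔻^∞_n = 𝔻^∞_{2,n}` and `𝔻^∞_{ν₂,n}`
    (ν₂ : ℝ≥0∞) (hν₂ : 2 ≤ ν₂)
    (henv : ∀ n, 1 ≤ n → envMoment P (hist ε (J n)) (envelope (𝓕 n) (fbar n)) ν₂ n < ∞)
    (Dinf Dinf₂ : ℕ → ℝ) (hDinf_pos : ∀ n, 1 ≤ n → 0 < Dinf n)
    (hDinf : ∀ n, 1 ≤ n →
      avgNorm 2 n (fun i => Dsup (𝓕 n) (D n) (grid n i)) ≤ ENNReal.ofReal (Dinf n))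
    (hDinf₂ : ∀ n, 1 ≤ n →
      avgNorm ν₂ n (fun i => Dsup (𝓕 n) (D n) (grid n i)) ≤ ENNReal.ofReal (Dinf₂ n))
    -- the three uniform boundedness conditions
    (σ : ℝ) (hσ : 0 < σ)
    (hV : ∀ n, 1 ≤ n → ∀ f ∈ 𝓕 n,
      seminormV P (hist ε (J n)) Δ (𝔻 n) n f ≤ ENNReal.ofReal σ)
    (hratio : ∃ K : ℝ, ∀ n, 1 ≤ n → Dinf₂ n / Dinf n ≤ K)
    (hrate : ∃ K : ℝ, ∀ n : ℕ, 1 ≤ n →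
      (envMoment P (hist ε (J n)) (envelope (𝓕 n) (fbar n)) ν₂ n).toReal ^ 2
          * logCard (𝓕 n).card
        / ((n : ℝ) ^ (1 - (2 / ν₂).toReal) * rFun Δ (σ / Dinf n) ^ 2) ≤ K) :
    IsBigOP P (fun n ω => ⨆ f : {f // f ∈ 𝓕 n}, |empProc P (hist ε (J n)) n f ω|)
      (fun n => Real.sqrt (logCard (𝓕 n).card)) := by
  obtain ⟨d₀, L, s, p, C_R, C_f, C_X, hp, -, hcomp⟩ := hcompat
  obtain ⟨K₁', hK₁'⟩ := hratio
  obtain ⟨K₂', hK₂'⟩ := hrate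
  intro η hη
  set K₁ : ℝ := max K₁' 1 with hK₁
  set K₂ : ℝ := max K₂' 1 with hK₂
  have hK₁1 : 1 ≤ K₁ := le_max_right _ _
  have hK₂1 : 1 ≤ K₂ := le_max_right _ _
  set B : ℝ := 2 * K₁ * Real.sqrt K₂ with hBdef
  have hB : 2 ≤ B := by
    have h1 : 1 ≤ Real.sqrt K₂ := Real.one_le_sqrt.2 hK₂1
    have h2 := mul_le_mul hK₁1 h1 zero_le_one (by linarith)
    rw [hBdef]
    linarith
  have hB0 : 0 < B := by linarith
  set g : ℝ := 8 / η with hg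
  have hg0 : 0 < g := by positivity
  set Γ : ℝ := 8 * B ^ 2 * (2 + g) with hΓ
  have hΓ0 : 0 < Γ := by positivity
  set Q : ℝ := 16 * B * σ * (2 + Γ + g) with hQ
  have hQ0 : 0 < Q := by positivity
  refine ⟨Q, hQ0, fun n hn => ?_⟩
  rcases isEmpty_or_nonempty {f // f ∈ 𝓕 n} with hempty | hne
  -- a supremum over the empty class is `0`
  · refine le_of_eq_of_le ?_ zero_le
    refine measure_mono_null (fun ω hω => ?_) measure_empty
    simp only [Real.iSup_of_isEmpty, abs_zero, Set.mem_ofPred_eq] at hω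
    exact absurd hω (not_lt.2 (by positivity))
  obtain ⟨J₀, μ, R, hc⟩ := hcomp n hn
  have hn0 : (0 : ℝ) < n := by exact_mod_cast hn
  set H : ℝ := logCard (𝓕 n).card with hH
  have hH1 : 1 ≤ H := le_max_left _ _
  have hHc : Real.log (𝓕 n).card ≤ H := le_max_right _ _
  set a : ℝ := Real.sqrt n with ha
  set b : ℝ := Real.sqrt H with hb
  have ha0 : 0 < a := Real.sqrt_pos.2 hn0
  have hb1 : 1 ≤ b := Real.one_le_sqrt.2 hH1
  have hb0 : 0 < b := by linarith
  have ha2 : a ^ 2 = n := Real.sq_sqrt hn0.le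
  have hb2 : b ^ 2 = H := Real.sq_sqrt (by linarith)
  have hD := hDinf_pos n hn
  obtain ⟨hr, ρ, q, hρ, hq, hβq, hqρ, hrρ⟩ := exists_blockLength Δ (div_pos hσ hD)
  have hq1 : (1 : ℝ) ≤ q := by exact_mod_cast hq
  have hqD : q * ρ * Dinf n ≤ σ := (le_div_iff₀ hD).1 hqρ
  set C : ℝ := (envMoment P (hist ε (J n)) (envelope (𝓕 n) (fbar n)) ν₂ n).toReal with hC
  have hC0 : 0 ≤ C := ENNReal.toReal_nonneg
  -- the truncation level is chosen such that `q M` is of order `σ √n / √H`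
  set M : ℝ := B * a * ρ * Dinf n / b with hM
  have hM0 : 0 < M := by positivity
  have hqM : q * M ≤ B * σ * a / b := by
    rw [hM, ← mul_div_assoc]
    refine div_le_div_of_nonneg_right ?_ hb0.le
    calc q * (B * a * ρ * Dinf n) = B * a * (q * ρ * Dinf n) := by ring
      _ ≤ B * a * σ := mul_le_mul_of_nonneg_left hqD (by positivity)
      _ = B * σ * a := by ring
  have hMle : M ≤ B * σ * a / b := (le_mul_of_one_le_left hM0.le hq1).trans hqM
  have hβ0 : 0 ≤ betaTail Δ q := tsum_nonneg fun j => hΔ_nonneg _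
  have hx : a * Dinf n * betaTail Δ q ≤ a * σ := by
    rw [mul_assoc]
    refine mul_le_mul_of_nonneg_left (le_trans ?_ hqD) ha0.le
    rw [mul_comm]
    exact mul_le_mul_of_nonneg_right hβq hD.le
  have hν₂' : (2 / ν₂).toReal = 2 * (1 / ν₂).toReal := by
    rw [ENNReal.toReal_div, ENNReal.toReal_div, ENNReal.toReal_ofNat, ENNReal.toReal_one]
    ring
  set y : ℝ := (n : ℝ) ^ (1 / ν₂).toReal with hy
  have hy0 : 0 < y := Real.rpow_pos_of_pos hn0 _
  have hyn : (n : ℝ) ^ (1 - (2 / ν₂).toReal) = (a / y) ^ 2 := by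
    rw [Real.rpow_sub hn0, Real.rpow_one, hν₂', mul_comm, Real.rpow_mul hn0.le, ← hy, div_pow, ha2,
      Real.rpow_ofNat]
  have hCb : y * C * b ≤ 2 * Real.sqrt K₂ * a * ρ := by
    have h1 : C ^ 2 * H ≤ K₂ * ((a / y) ^ 2 * rFun Δ (σ / Dinf n) ^ 2) := by
      have h2 := (hK₂' n hn).trans (le_max_left K₂' 1)
      rwa [hyn, div_le_iff₀ (by positivity)] at h2
    have h3 : (C * b) ^ 2 ≤ (Real.sqrt K₂ * (a / y) * (2 * ρ)) ^ 2 := by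
      calc (C * b) ^ 2 = C ^ 2 * H := by rw [mul_pow, hb2]
        _ ≤ K₂ * ((a / y) ^ 2 * rFun Δ (σ / Dinf n) ^ 2) := h1
        _ ≤ K₂ * ((a / y) ^ 2 * (2 * ρ) ^ 2) := by gcongr
        _ = _ := by
          rw [mul_pow _ (2 * ρ), mul_pow (Real.sqrt K₂), Real.sq_sqrt (by linarith), mul_assoc]
    have h4 := (sq_le_sq₀ (by positivity) (by positivity)).1 h3
    calc y * C * b = y * (C * b) := mul_assoc _ _ _
      _ ≤ y * (Real.sqrt K₂ * (a / y) * (2 * ρ)) := mul_le_mul_of_nonneg_left h4 hy0.le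
      _ = _ := by field_simp
  have hD₂ : max (Dinf₂ n) 0 ≤ K₁ * Dinf n := by
    refine max_le ?_ (by positivity)
    exact (div_le_iff₀ hD).1 ((hK₁' n hn).trans (le_max_left _ _))
  -- the truncation level is large enough for the envelope
  have hMc : y * C * max (Dinf₂ n) 0 ≤ M := by
    rw [hM, le_div_iff₀ hb0]
    calc y * C * max (Dinf₂ n) 0 * b = y * C * b * max (Dinf₂ n) 0 := by ring
      _ ≤ 2 * Real.sqrt K₂ * a * ρ * (K₁ * Dinf n) :=
          mul_le_mul hCb hD₂ (le_max_right _ _) (by positivity)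
      _ = _ := by rw [hBdef]; ring
  have hl : b / (4 * B * σ * a) * (4 * q * M) ≤ 1 := by
    calc b / (4 * B * σ * a) * (4 * q * M) = b / (B * σ * a) * (q * M) := by field_simp
      _ ≤ b / (B * σ * a) * (B * σ * a / b) := mul_le_mul_of_nonneg_left hqM (by positivity)
      _ = 1 := by field_simp
  have hl' : 2 * (b ^ 2 / (2 * B ^ 2 * σ ^ 2 * a ^ 2)) * (q * M ^ 2) ≤ 1 := by
    have h1 : q * M ^ 2 ≤ (B * σ * a / b) ^ 2 := by
      calc q * M ^ 2 ≤ q * (q * M ^ 2) := le_mul_of_one_le_left (by positivity) hq1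
        _ = (q * M) ^ 2 := by ring
        _ ≤ _ := pow_le_pow_left₀ (by positivity) hqM 2
    calc 2 * (b ^ 2 / (2 * B ^ 2 * σ ^ 2 * a ^ 2)) * (q * M ^ 2)
        ≤ 2 * (b ^ 2 / (2 * B ^ 2 * σ ^ 2 * a ^ 2)) * (B * σ * a / b) ^ 2 :=
          mul_le_mul_of_nonneg_left h1 (by positivity)
      _ = 1 := by field_simp
  have htail := hc.measureReal_exists_abs_sum_ge_le hε (hJ n) (hf_meas n) (hfbar_meas n)
    (hfactor n) hν hp hn hΔ_nonneg hΔ_anti hΔ_sum (h𝔻 n) hν₂ (henv n hn) hD.le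
    (le_max_right (Dinf₂ n) 0) (hDinf n hn)
    ((hDinf₂ n hn).trans (ENNReal.ofReal_le_ofReal (le_max_left _ _))) hσ (hV n hn) hq hM0 hMc hH1
    hHc (l := b / (4 * B * σ * a)) (l' := b ^ 2 / (2 * B ^ 2 * σ ^ 2 * a ^ 2)) (t := Q * a * b / 4)
    (T := Γ * a ^ 2 * σ ^ 2 / 4) (by positivity) hl (by positivity) hl' (by positivity)
    (by positivity)
  have hN : ((𝓕 n).card : ℝ) ≤ Real.exp (b ^ 2) := by
    rw [hb2]
    exact (Real.le_exp_log _).trans (Real.exp_le_exp.2 hHc)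
  have hsum := tail_sum_le (N := ((𝓕 n).card : ℝ)) hσ hB hg0 ha0 hb1 hN
    (x := a * Dinf n * betaTail Δ q) (by positivity) hx hMle hΓ hQ rfl rfl rfl rfl
  rw [ha2] at hsum htail
  have hreal := htail.trans hsum
  rw [hg, div_div_cancel₀ (by norm_num : (8 : ℝ) ≠ 0)] at hreal
  refine le_trans (measure_mono fun ω hω => ?_)
    ((ENNReal.le_ofReal_iff_toReal_le (measure_ne_top P _) hη.le).2 hreal)
  -- the supremum over the finite class is attained
  obtain ⟨f, hf⟩ := exists_eq_ciSup_of_finite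
    (f := fun f : {f // f ∈ 𝓕 n} => |empProc P (hist ε (J n)) n f ω|)
  simp only [Set.mem_ofPred_eq] at hω
  rw [← hf, abs_abs, empProc, abs_mul, abs_of_pos (inv_pos.2 ha0), ← hH, ← hb] at hω
  refine ⟨f, ?_⟩
  have h1 := mul_lt_mul_of_pos_left hω ha0
  rw [mul_inv_cancel_left₀ ha0.ne'] at h1
  linarith
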